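/- Let $m_0\ge 1$ and $0\le n_0\le m_0-1$ be coprime integers, let $n_0'$ be an integer with $n_0n_0'\equiv 1 \pmod{m_0}$, and put $\Lambda_0=e^{2\pi i n_0/m_0}$. For $|q|\neq 1$ and $|z|<1$ let $f_\delta(q,z)=\sum_{n\ge1}\frac{z^n}{q^n-1}$. For $0<r<1$ let $B_r$ be the Banach space of bounded holomorphic functions on $\{|z|<r\}$ vanishing at $0$, with the sup norm. Then there are functions $a_n(z)$ $(n\ge 0)$ on the unit disk such that, for every $r\in(0,1)$, the $B_r$-valued function $q\mapsto (q-\Lambda_0)f_\delta(q,\cdot)$ has the Gevrey-1 asymptotic expansion $\sum_{n\ge0}a_n (q-\Lambda_0)^n$ at $\Lambda_0$, both in a disk $\Delta^-\subset\{|q|<1\}$ and in a disk $\Delta^+\subset\{|q|>1\}$ tangent to the unit circle at $\Lambda_0$; that is, the function is holomorphic on $\Delta^\pm$ and there are $c_0,c_1>0$ with $$\Big\|(q-\Lambda_0)f_\delta(q,\cdot)-\sum_{n<N}a_n(q-\Lambda_0)^n\Big\|_{B_r}\le c_0c_1^N N!\,|q-\Lambda_0|^N\qquad (N\ge0,\ q\in\Delta^\pm).$$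 For any such $(a_n)$ (they are unique), let $$\hat\Phi^\delta(\xi,z)=\sum_{n\ge0}\Lambda_0^{n+1}a_{n+1}(z)\frac{\xi^n}{n!}$$ be the Borel transform of this expansion with respect to $t=(q-\Lambda_0)/\Lambda_0$. Fix $z$ with $0<|z|<1$ and a value of $\log z$, and for $a\in\mathbb Z\setminus\{0\}$, $b\in\mathbb Z$ put $$\xi_{a,b}=\frac{2\pi a}{m_0}\Big(-i\log z+\frac{2\pi b}{m_0}\Big),\qquad C_{a,b}=\frac1{m_0}e^{2\pi i ab n_0'/m_0}.$$ Then: (i) The series $\hat\Phi^\delta(\cdot,z)$ has a positive radius of convergence, and its sum extends analytically to the universal covering of $\mathbb C\setminus\{\xi_{a,b}\}$; i.e. the germ at $0$ can be continued analytically along every path in $\mathbb C\setminus\{\xi_{a,b}\}$ starting at $0$. In particular it is holomorphic on the main sheet, the set of all $\xi$ such that the segment $[0,\xi]$ contains no $\xi_{a,b}$. (ii) Near each $\omega=\xi_{a,b}$, on the main sheet, $$\hat\Phi^\delta(\xi,z)=\Lambda_0C_{a,b}\Big(\frac{e^{-\omega/2}}{\xi-\omega}+\hat L_\omega(\xi-\omega)\log(\xi-\omega)\Big)+R(\xi),$$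 with $R$ holomorphic in a full neighbourhood of $\omega$ (on each connected piece of the main sheet near $\omega$ and for each determination of $\log(\xi-\omega)$ there, $R$ depending on these choices). Here $\hat L_\omega$ is the entire function $\hat L_\omega(\zeta)=\sum_{n\ge0}\ell_{n+1}\zeta^n/n!$, where $\sum_{n\ge1}\ell_nt^n$ is the Taylor series at $0$ of the function $$L_\omega(t)=-e^{-\omega/2}+(1+tL(t))e^{-\omega L(t)},\qquad L(t)=\frac1{\log(1+t)}-\frac1t,\quad L(0)=\tfrac12,$$ which is holomorphic near $0$ and vanishes at $0$. (iii) For every line through $0$ containing none of the points $\xi_{a,b}$ there are constants $K,\delta$ with $|\hat\Phi^\delta(\xi,z)|\le Ke^{\delta|\xi|}$ for all $\xi$ on that line. -/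

import Mathlib

namespace QLog

open Metric Filter Topology BoundedContinuousFunction

noncomputable section

/-- The fundamental solution `f_δ(q, z) = ∑_{n ≥ 1} z ^ n / (q ^ n - 1)`, for `|q| ≠ 1`, `|z| < 1`. -/
def fDelta (q z : ℂ) : ℂ := ∑' n : ℕ, z ^ (n + 1) / (q ^ (n + 1) - 1)

/-- `B_r = z H^∞(𝔻_r)`: bounded holomorphic functions on the disk of radius `r` which vanish at
the origin, with the norm of the supremum (inherited from the bounded continuous functions). -/
def Br (r : ℝ) : Submodule ℂ (ball (0 : ℂ) r →ᵇ ℂ) where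
  carrier := {f | ∃ g : ℂ → ℂ, DifferentiableOn ℂ g (ball 0 r) ∧ g 0 = 0 ∧
    ∀ x : ball (0 : ℂ) r, f x = g x}
  add_mem' := by
    rintro f₁ f₂ ⟨g₁, h₁, h₁', h₁''⟩ ⟨g₂, h₂, h₂', h₂''⟩
    exact ⟨g₁ + g₂, h₁.add h₂, by simp [h₁', h₂'], fun x => by simp [h₁'', h₂'']⟩
  zero_mem' := ⟨0, differentiableOn_const 0, rfl, fun _ => rfl⟩
  smul_mem' := by
    rintro c f ⟨g, h, h', h''⟩
    exact ⟨c • g, h.const_smul c, by simp [h'], fun x => by simp [h'']⟩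

/-- `f` is holomorphic in `Δ`, with Gevrey-1 asymptotic expansion `∑ a_n (q - lam) ^ n` there. -/
def HasGevreyOneExpansionOn {B : Type*} [NormedAddCommGroup B] [NormedSpace ℂ B]
    (lam : ℂ) (Δ : Set ℂ) (f : ℂ → B) (a : ℕ → B) : Prop :=
  DifferentiableOn ℂ f Δ ∧
    ∃ c₀ > (0 : ℝ), ∃ c₁ > (0 : ℝ), ∀ N : ℕ, ∀ q ∈ Δ,
      ‖f q - ∑ n ∈ Finset.range N, (q - lam) ^ n • a n‖ ≤
        c₀ * c₁ ^ N * (N.factorial : ℝ) * ‖q - lam‖ ^ N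

/-- `f` belongs to the Gevrey class `𝒢₁(lam, B)` and `J_lam(f) = ∑ a_n Q ^ n`, where `|lam| = 1`:
there are disks tangent to the unit circle at `lam`, one inside and one outside the unit disk,
on both of which `f` has the Gevrey-1 asymptotic expansion `∑ a_n (q - lam) ^ n`. -/
def HasGevreyOneExpansion {B : Type*} [NormedAddCommGroup B] [NormedSpace ℂ B]
    (lam : ℂ) (f : ℂ → B) (a : ℕ → B) : Prop :=
  (∃ ρ : ℝ, 0 < ρ ∧ ρ < 1 ∧ HasGevreyOneExpansionOn lam (ball ((1 - ρ) * lam) ρ) f a) ∧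
    (∃ ρ : ℝ, 0 < ρ ∧ HasGevreyOneExpansionOn lam (ball ((1 + ρ) * lam) ρ) f a)

/-- `a = (a_n)` are the coefficients, as functions of `z` in the unit disk, of the asymptotic
expansion of `(q - Λ₀) f_δ(q, ·)` at `Λ₀`: for all `r ∈ (0, 1)`, the function
`q ↦ (q - Λ₀) f_δ(q, ·)` belongs to `𝒢₁(Λ₀, B_r)` with expansion `∑ a_n Q ^ n`. -/
def IsExpansionOfFDelta (Λ₀ : ℂ) (a : ℕ → ℂ → ℂ) : Prop :=
  ∀ r : ℝ, 0 < r → r < 1 → ∃ (F : ℂ → Br r) (A : ℕ → Br r),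
    (∀ q : ℂ, ‖q‖ ≠ 1 → ∀ x : ball (0 : ℂ) r, (F q).1 x = (q - Λ₀) * fDelta q x) ∧
    (∀ n : ℕ, ∀ x : ball (0 : ℂ) r, (A n).1 x = a n x) ∧
    HasGevreyOneExpansion Λ₀ F A

/-- The `n`-th term, at the point `ξ`, of the formal Borel transform
`∑_{n ≥ 0} c_{n+1} ξ ^ n / n!` of a formal series `∑ c_n t ^ n` (its constant term is not used). -/
def borelTerm (c : ℕ → ℂ) (ξ : ℂ) (n : ℕ) : ℂ := c (n + 1) * ξ ^ n / (n.factorial : ℂ)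

/-- `Λ₀ = exp (2 π i n₀ / m₀)`. -/
def resonance (m₀ n₀ : ℕ) : ℂ := Complex.exp (2 * Real.pi * Complex.I * n₀ / m₀)

/-- The moving singular point `ξ_{a,b}`; `s` is the chosen determination of `log z`. -/
def xi (m₀ : ℕ) (s : ℂ) (a b : ℤ) : ℂ :=
  2 * Real.pi * a / m₀ * (-Complex.I * s + 2 * Real.pi * b / m₀)

/-- The set of all moving singular points `ξ_{a,b}`, `a ≠ 0`. -/
def singularSet (m₀ : ℕ) (s : ℂ) : Set ℂ := {ω | ∃ a b : ℤ, a ≠ 0 ∧ ω = xi m₀ s a b}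

/-- `C_{a,b}`, where `n₀'` is an inverse of `n₀` modulo `m₀`. -/
def resCoeff (m₀ : ℕ) (n₀' : ℤ) (a b : ℤ) : ℂ :=
  1 / m₀ * Complex.exp (2 * Real.pi * Complex.I * a * b * n₀' / m₀)

/-- `L(t) = 1 / log (1 + t) - 1 / t`, with its limit `1 / 2` at `t = 0`. -/
def Lfun (t : ℂ) : ℂ := if t = 0 then 1 / 2 else 1 / Complex.log (1 + t) - 1 / t

/-- `L_ω(t) = - e ^ (- ω / 2) + (1 + t L(t)) e ^ (- ω L(t))`. -/
def Lomega (ω t : ℂ) : ℂ :=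
  -Complex.exp (-ω / 2) + (1 + t * Lfun t) * Complex.exp (-ω * Lfun t)

/-- Taylor coefficients at the origin. -/
def taylorCoeff (f : ℂ → ℂ) (n : ℕ) : ℂ := iteratedDeriv n f 0 / (n.factorial : ℂ)

/-- The Borel transform of the Taylor series of `L_ω` at `t = 0`. -/
def LomegaHat (ω ζ : ℂ) : ℂ := ∑' n : ℕ, borelTerm (taylorCoeff (Lomega ω)) ζ n

/-- The main sheet: points which can be reached from the origin along a straight segment
avoiding `S`. -/
def mainSheet (S : Set ℂ) : Set ℂ := {ξ | ∀ ω ∈ S, ω ∉ segment ℝ (0 : ℂ) ξ}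

/-- The germ of `φ` at `γ 0` can be continued analytically along the path `γ`: there is a family
`g t` of germs of analytic functions at `γ t`, which starts with the germ of `φ` and such that
nearby germs are restrictions of each other. -/
def ContinuesAlong (φ : ℂ → ℂ) (γ : unitInterval → ℂ) : Prop :=
  ∃ g : unitInterval → ℂ → ℂ,
    (∀ t, AnalyticAt ℂ (g t) (γ t)) ∧
    g 0 =ᶠ[𝓝 (γ 0)] φ ∧
    ∀ t, ∀ᶠ u in 𝓝 t, g u =ᶠ[𝓝 (γ u)] g t

/-- The germ of `φ` at the origin extends analytically to the universal covering of `ℂ ∖ S`: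
analytic continuation is possible along any path issuing from the origin in `ℂ ∖ S`. -/
def ExtendsToUniversalCover (φ : ℂ → ℂ) (S : Set ℂ) : Prop :=
  ∀ γ : unitInterval → ℂ, Continuous γ → γ 0 = 0 → (∀ t, γ t ∉ S) → ContinuesAlong φ γ

/-- Near `ω`, the function `Φ` on the main sheet has the form
`c * (e ^ (- ω / 2) / (ξ - ω) + L̂_ω(ξ - ω) log (ξ - ω)) + regular function`.
The main sheet may be cut into two pieces near `ω` (when `ω` is hidden from the origin by other
singular points), hence the statement on an arbitrary connected piece `V`, with an arbitrary
determination `ℓ` of `log (ξ - ω)` on it; the regular function `R` is holomorphic in a full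
neighbourhood of `ω`. -/
def HasSimpleSingularity (S : Set ℂ) (Φ : ℂ → ℂ) (ω c : ℂ) : Prop :=
  ∃ ρ > (0 : ℝ), (∀ p ∈ S, p ∈ ball ω ρ → p = ω) ∧
    ∀ V ⊆ ball ω ρ ∩ mainSheet S, IsPreconnected V →
      ∀ ℓ : ℂ → ℂ, ContinuousOn ℓ V → (∀ ξ ∈ V, Complex.exp (ℓ ξ) = ξ - ω) →
        ∃ R : ℂ → ℂ, DifferentiableOn ℂ R (ball ω ρ) ∧
          ∀ ξ ∈ V, Φ ξ =
            c * (Complex.exp (-ω / 2) / (ξ - ω) + LomegaHat ω (ξ - ω) * ℓ ξ) + R ξ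

end

end QLog

/-! Put q = Λ₀(1 + t), h = log(1 + t), so that q = Λ₀eʰ, and z = eˢ with Re s < 0. Everything is
computed term by term in f_δ = ∑ zⁿ/(qⁿ − 1).

Expansion. The logarithmic derivative of qⁿ − 1 writes 1/(qⁿ − 1) as the average of ζ/(q − ζ) over
the n-th roots of unity ζ. A root ζ ≠ Λ₀ is at distance at least 1/(m₀n) from Λ₀, so the k-th
coefficient of (q − Λ₀)/(qⁿ − 1) is at most (m₀n)ᵏ. In a tangent disk |q − Λ₀|² ≤ 2·||q| − 1|, which
controls the remainders in the same way (`norm_step_remainder_le`). Since ∑ nᵏrⁿ grows like k! times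
a geometric factor, the expansion is Gevrey-1 (`hasGevreyOneExpansionOn_tsum`). Evaluation on a
radius gives uniqueness.

Borel transform in h. As a function of h, 1/(Λ₀ⁿeⁿʰ − 1) has simple poles at 1/(nμ_j) = 2πij/(m₀n),
for m₀ ∣ j + n n₀ (`hasSum_partialFractions`). The Borel transform of h/(1 − nμ_j h) is exp(nμ_j ξ).
The congruence is detected by characters modulo m₀, and the sum over n of zⁿexp(nμ_j ξ) becomes a
combination of geometric series in exp(s + 2πib/m₀ + μ_j ξ). Their poles are exactly the ξ_{a,b},
with residue C_{a,b} (`exists_logBorel_eq`).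

Change of variable. Since (q − Λ₀)f_δ = Λ₀(t/h)(h f_δ), one has to pass from h to t and multiply by
t/h. In the Borel plane this is the integral operator `kernelTransform`, with entire kernel L̂_ξ(ζ −
ξ); it is verified on exponentials (`kernelTransform_exp`), which suffices because the transform in
h is a series of exponentials near 0. Applied to 1/(ξ − ω) it yields exp(−ω/2)/(ζ − ω) + L̂_ω(ζ − ω)
log(1 − ζ/ω) plus an entire function (`exists_kernelTransform_inv_sub`).

Hence in each disk the transform is, on the main sheet, a finite sum of such explicit terms plus a
holomorphic function (`exists_fullBorel_eq`). Continuation along paths and the local form at ω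
reduce to following finitely many logarithms. On a line avoiding the ξ_{a,b} the transform in h
grows at most linearly and the kernel at most exponentially, which gives the growth bound. -/

namespace QLog

open Metric Filter Topology

/-! ### Integrals and circle averages depending on a parameter -/

/-- An integral of holomorphic functions depending continuously on a real parameter is
holomorphic. -/
theorem differentiableOn_intervalIntegral {U : Set ℂ} (hU : IsOpen U) {F : ℂ → ℝ → ℂ} {a b : ℝ}
    (hc : ContinuousOn (Function.uncurry F) (U ×ˢ Set.uIcc a b))
    (hd : ∀ x ∈ Set.uIcc a b, DifferentiableOn ℂ (fun ζ => F ζ x) U) :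
    DifferentiableOn ℂ (fun ζ => ∫ x in a..b, F ζ x) U := by
  intro ζ₀ hζ₀
  obtain ⟨R, hR, hRU⟩ := Metric.isOpen_iff.1 hU ζ₀ hζ₀
  -- With a third of the radius, circles of radius r about points of `ball ζ₀ r` stay in `closedBall
  -- ζ₀ (2 * r)`, a compact subset of U where F is bounded by C. Cauchy's estimate then dominates
  -- the derivative by C / r.
  set r := R / 3 with hr
  have hr0 : 0 < r := by positivity
  have hsub : closedBall ζ₀ (2 * r) ⊆ U :=
    (closedBall_subset_ball (by linarith)).trans hRU
  obtain ⟨C, hC⟩ :=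
    ((isCompact_closedBall ζ₀ (2 * r)).prod isCompact_uIcc).exists_bound_of_continuousOn
    (hc.mono (Set.prod_mono hsub subset_rfl))
  have hslice : ∀ ζ ∈ U, ContinuousOn (F ζ) (Set.uIcc a b) := fun ζ hζ =>
    hc.comp (f := fun x : ℝ => (ζ, x)) (by fun_prop) fun x hx => ⟨hζ, hx⟩
  have hmeas : ∀ ζ ∈ U, MeasureTheory.AEStronglyMeasurable (F ζ)
      (MeasureTheory.volume.restrict (Set.uIoc a b)) := fun ζ hζ =>
    ((hslice ζ hζ).mono Set.uIoc_subset_uIcc).aestronglyMeasurable measurableSet_uIoc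
  have hdiffAt : ∀ x ∈ Set.uIcc a b, ∀ ζ ∈ U, DifferentiableAt ℂ (fun ζ => F ζ x) ζ :=
    fun x hx ζ hζ => (hd x hx).differentiableAt (hU.mem_nhds hζ)
  refine (intervalIntegral.hasDerivAt_integral_of_dominated_loc_of_deriv_le
    (F' := fun ζ x => deriv (fun ζ => F ζ x) ζ) (s := ball ζ₀ r) (bound := fun _ => C / r)
    (ball_mem_nhds _ hr0) ?_ ?_ ?_ ?_ ?_ ?_).2.differentiableAt.differentiableWithinAt
  · filter_upwards [hU.mem_nhds hζ₀] with ζ hζ using hmeas ζ hζ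
  · exact (hslice ζ₀ hζ₀).intervalIntegrable
  -- The derivative at ζ₀ is measurable in x as the pointwise limit of difference quotients along ζ₀
  -- + r/(n + 1).
  · have hseq : Tendsto (fun n : ℕ => ζ₀ + (r : ℂ) * (1 / ((n : ℂ) + 1))) atTop (𝓝[≠] ζ₀) := by
      rw [tendsto_nhdsWithin_iff]
      constructor
      · have := (tendsto_one_div_add_atTop_nhds_zero_nat (𝕜 := ℂ)).const_mul (r : ℂ)
        simpa using this.const_add ζ₀
      · refine Eventually.of_forall fun n => ?_
        have : (n : ℂ) + 1 ≠ 0 := by exact_mod_cast Nat.succ_ne_zero n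
        simp [hr0.ne', this]
    have hmemU : ∀ n : ℕ, ζ₀ + (r : ℂ) * (1 / ((n : ℂ) + 1)) ∈ U := by
      intro n
      apply hsub
      have h1 : ‖(1 : ℂ) / ((n : ℂ) + 1)‖ ≤ 1 := by
        have : ‖(n : ℂ) + 1‖ = n + 1 := by
          have := Complex.norm_natCast (n + 1); push_cast at this; exact this
        rw [norm_div, this, norm_one, div_le_one (by positivity)]
        linarith [(Nat.cast_nonneg n : (0 : ℝ) ≤ n)]
      rw [mem_closedBall, dist_eq_norm, add_sub_cancel_left, norm_mul, Complex.norm_real,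
        Real.norm_of_nonneg hr0.le]
      nlinarith
    refine aestronglyMeasurable_of_tendsto_ae atTop
      (f := fun (n : ℕ) x => slope (fun ζ => F ζ x) ζ₀ (ζ₀ + (r : ℂ) * (1 / ((n : ℂ) + 1)))) ?_ ?_
    · intro n
      simp only [slope, vsub_eq_sub, smul_eq_mul]
      exact ((hmeas _ (hmemU n)).sub (hmeas _ hζ₀)).const_mul _
    · rw [MeasureTheory.ae_restrict_iff' measurableSet_uIoc]
      refine MeasureTheory.ae_of_all _ fun x hx => ?_
      have := (hdiffAt x (Set.uIoc_subset_uIcc hx) ζ₀ hζ₀).hasDerivAt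
      exact (hasDerivAt_iff_tendsto_slope.1 this).comp hseq
  · refine MeasureTheory.ae_of_all _ fun x hx ζ hζ => ?_
    refine Complex.norm_deriv_le_of_forall_mem_sphere_norm_le hr0 ?_ ?_
    · refine ((hd x (Set.uIoc_subset_uIcc hx)).mono ?_).diffContOnCl
      refine (closure_ball_subset_closedBall).trans (Set.Subset.trans ?_ hsub)
      refine closedBall_subset_closedBall' ?_
      linarith [mem_ball.1 hζ]
    · intro w hw
      refine hC (w, x) ⟨?_, Set.uIoc_subset_uIcc hx⟩
      rw [mem_sphere] at hw
      rw [mem_closedBall]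
      linarith [dist_triangle w ζ ζ₀, mem_ball.1 hζ]
  · exact intervalIntegrable_const
  · refine MeasureTheory.ae_of_all _ fun x hx ζ hζ => ?_
    refine (hdiffAt x (Set.uIoc_subset_uIcc hx) ζ (hsub ?_)).hasDerivAt
    rw [mem_closedBall]; linarith [mem_ball.1 hζ]

theorem circleMap_mem_sphere_zero {ε : ℝ} (hε : 0 < ε) (θ : ℝ) :
    circleMap 0 ε θ ∈ sphere (0 : ℂ) ε := circleMap_mem_sphere 0 hε.le θ

/-- Circle averages of holomorphic functions depending continuously on a parameter. -/
theorem differentiableOn_circleAverage {U : Set ℂ} (hU : IsOpen U) {F : ℂ → ℂ → ℂ} {ε : ℝ}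
    (hε : 0 < ε) (hc : ContinuousOn (Function.uncurry F) (U ×ˢ sphere 0 ε))
    (hd : ∀ t ∈ sphere (0 : ℂ) ε, DifferentiableOn ℂ (fun ζ => F ζ t) U) :
    DifferentiableOn ℂ (fun ζ => Real.circleAverage (F ζ) 0 ε) U := by
  simp only [Real.circleAverage_def]
  refine DifferentiableOn.const_smul (differentiableOn_intervalIntegral hU ?_ ?_) _
  · refine hc.comp (f := fun p : ℂ × ℝ => (p.1, circleMap 0 ε p.2)) (by fun_prop) ?_
    exact fun p hp => ⟨hp.1, circleMap_mem_sphere_zero hε _⟩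
  · exact fun x _ => hd _ (circleMap_mem_sphere_zero hε _)

theorem continuous_comp_circleMap {f : ℂ → ℂ} {ε : ℝ} (hε : 0 < ε)
    (hf : ContinuousOn f (sphere 0 ε)) : Continuous fun θ => f (circleMap 0 ε θ) :=
  hf.comp_continuous (continuous_circleMap 0 ε) (circleMap_mem_sphere_zero hε)

theorem circleIntegrable_of_continuousOn {f : ℂ → ℂ} {ε : ℝ} (hε : 0 < ε)
    (hf : ContinuousOn f (sphere 0 ε)) : CircleIntegrable f 0 ε :=
  hf.circleIntegrable hε.le

/-- Circle averages commute with uniformly absolutely convergent sums. -/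
theorem hasSum_circleAverage {ι : Type*} [Countable ι] {f : ι → ℂ → ℂ} {F : ℂ → ℂ} {u : ι → ℝ}
    {ε : ℝ} (hε : 0 < ε) (hu : Summable u) (hf : ∀ i, ContinuousOn (f i) (sphere 0 ε))
    (hb : ∀ i, ∀ t ∈ sphere (0 : ℂ) ε, ‖f i t‖ ≤ u i)
    (hs : ∀ t ∈ sphere (0 : ℂ) ε, HasSum (fun i => f i t) (F t)) :
    HasSum (fun i => Real.circleAverage (f i) 0 ε) (Real.circleAverage F 0 ε) := by
  simp only [Real.circleAverage_def]
  refine HasSum.const_smul _ (intervalIntegral.hasSum_integral_of_dominated_convergence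
    (fun i _ => u i) ?_ ?_ ?_ ?_ ?_)
  · exact fun i => (continuous_comp_circleMap hε (hf i)).aestronglyMeasurable
  · exact fun i => MeasureTheory.ae_of_all _ fun x _ => hb i _ (circleMap_mem_sphere_zero hε _)
  · exact MeasureTheory.ae_of_all _ fun _ _ => hu
  · exact intervalIntegrable_const
  · exact MeasureTheory.ae_of_all _ fun x _ => hs _ (circleMap_mem_sphere_zero hε _)

/-- Fubini for circle averages and interval integrals of continuous functions. -/
theorem intervalIntegral_circleAverage_swap {F : ℝ → ℂ → ℂ} {a b ε : ℝ} (hε : 0 < ε)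
    (hc : ContinuousOn (Function.uncurry F) (Set.univ ×ˢ sphere 0 ε)) :
    ∫ x in a..b, Real.circleAverage (F x) 0 ε =
      Real.circleAverage (fun t => ∫ x in a..b, F x t) 0 ε := by
  simp only [Real.circleAverage_def]
  rw [intervalIntegral.integral_smul, MeasureTheory.intervalIntegral_intervalIntegral_swap]
  have hcont : Continuous (Function.uncurry fun x y => F x (circleMap 0 ε y)) := by
    have : Continuous fun p : ℝ × ℝ => (p.1, circleMap 0 ε p.2) := by fun_prop
    exact hc.comp_continuous this fun p => ⟨trivial, circleMap_mem_sphere_zero hε _⟩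
  refine (hcont.continuousOn.integrableOn_compact
    (isCompact_uIcc.prod isCompact_uIcc)).mono_set
      (Set.prod_mono Set.uIoc_subset_uIcc Set.uIoc_subset_uIcc)

/-! ### The Borel transform as a circle average -/

theorem circleAverage_zpow {ε : ℝ} (hε : 0 < ε) (k : ℤ) :
    Real.circleAverage (fun t : ℂ => t ^ k) 0 ε = if k = 0 then 1 else 0 := by
  split_ifs with hk
  · subst hk; simp [Real.circleAverage_const]
  · rw [Real.circleAverage_eq_circleIntegral hε.ne']
    have : (∮ z in C(0, ε), (z - 0)⁻¹ • z ^ k) = ∮ z in C(0, ε), (z - 0) ^ (k - 1) := by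
      refine circleIntegral.integral_congr hε.le fun z hz => ?_
      have hz0 : z ≠ 0 := by rintro rfl; simp at hz; exact hε.ne hz
      simp only [sub_zero, smul_eq_mul]
      rw [zpow_sub₀ hz0, zpow_one]; field_simp
    rw [this, circleIntegral.integral_sub_zpow_of_ne (by omega)]
    simp

theorem ne_zero_of_mem_sphere_zero {ε : ℝ} (hε : 0 < ε) {t : ℂ} (ht : t ∈ sphere (0 : ℂ) ε) :
    t ≠ 0 := by
  rintro rfl; simp at ht; exact hε.ne ht

theorem hasSum_mul_of_summable_norm {ι κ : Type*} {f : ι → ℂ} {g : κ → ℂ} {a b : ℂ}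
    (hf : HasSum f a) (hg : HasSum g b) (hf' : Summable fun i => ‖f i‖)
    (hg' : Summable fun i => ‖g i‖) : HasSum (fun p : ι × κ => f p.1 * g p.2) (a * b) := by
  rw [← hf.tsum_eq, ← hg.tsum_eq, tsum_mul_tsum_of_summable_norm hf' hg']
  exact (summable_mul_of_summable_norm hf' hg').hasSum

/-- The formal Borel transform of a convergent series, as a circle average. -/
theorem hasSum_borelTerm_circleAverage {c : ℕ → ℂ} {A : ℂ → ℂ} {ε : ℝ} (hε : 0 < ε)
    (hc : Summable fun k => ‖c k‖ * ε ^ k)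
    (hA : ∀ t ∈ sphere (0 : ℂ) ε, HasSum (fun k => c k * t ^ k) (A t)) (ζ : ℂ) :
    HasSum (borelTerm c ζ)
      (Real.circleAverage (fun t => A t * (Complex.exp (ζ / t) / t)) 0 ε) := by
  set f : ℕ × ℕ → ℂ → ℂ := fun p t =>
    (c p.1 * t ^ p.1) * ((ζ / t) ^ p.2 / (p.2.factorial : ℂ) / t) with hf
  have hexp : ∀ t : ℂ, HasSum (fun i : ℕ => (ζ / t) ^ i / (i.factorial : ℂ) / t)
      (Complex.exp (ζ / t) / t) := by
    intro t
    have := NormedSpace.expSeries_div_hasSum_exp (𝔸 := ℂ) (ζ / t)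
    rw [← Complex.exp_eq_exp_ℂ] at this
    exact this.div_const t
  have hnexp : Summable fun i : ℕ => (‖ζ‖ / ε) ^ i / (i.factorial : ℝ) / ε :=
    (Real.summable_pow_div_factorial _).div_const ε
  have hbnd : ∀ i : ℕ, ∀ t ∈ sphere (0 : ℂ) ε, ‖(ζ / t) ^ i / (i.factorial : ℂ) / t‖
      = (‖ζ‖ / ε) ^ i / (i.factorial : ℝ) / ε := by
    intro i t ht
    have : ‖t‖ = ε := by simpa using ht
    simp [this]
  have hbndc : ∀ k : ℕ, ∀ t ∈ sphere (0 : ℂ) ε, ‖c k * t ^ k‖ = ‖c k‖ * ε ^ k := by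
    intro i t ht
    have : ‖t‖ = ε := by simpa using ht
    simp [this]
  have hsum : ∀ t ∈ sphere (0 : ℂ) ε, HasSum (fun p => f p t)
      (A t * (Complex.exp (ζ / t) / t)) := by
    intro t ht
    have s1 : Summable fun k => ‖c k * t ^ k‖ := by
      refine hc.congr fun k => ?_
      rw [hbndc k t ht]
    have s2 : Summable fun i : ℕ => ‖(ζ / t) ^ i / (i.factorial : ℂ) / t‖ := by
      refine hnexp.congr fun k => ?_
      rw [hbnd k t ht]
    exact hasSum_mul_of_summable_norm (f := fun k => c k * t ^ k)
      (g := fun i : ℕ => (ζ / t) ^ i / (i.factorial : ℂ) / t) (hA t ht) (hexp t) s1 s2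
  have key := hasSum_circleAverage (f := f)
    (F := fun t => A t * (Complex.exp (ζ / t) / t))
    (u := fun p => (‖c p.1‖ * ε ^ p.1) * ((‖ζ‖ / ε) ^ p.2 / (p.2.factorial : ℝ) / ε))
    hε (hc.mul_of_nonneg hnexp (fun _ => by positivity) (fun _ => by positivity)) ?_ ?_ ?_
  -- Averaging keeps only the terms with exponent k − (i + 1) = 0, which is the index shift in
  -- `borelTerm`.
  · have hval : ∀ p : ℕ × ℕ, Real.circleAverage (f p) 0 ε =
        if p.1 = p.2 + 1 then c p.1 * ζ ^ p.2 / (p.2.factorial : ℂ) else 0 := by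
      rintro ⟨k, i⟩
      have : Set.EqOn (f (k, i)) (fun t => (c k * ζ ^ i / (i.factorial : ℂ)) •
          t ^ ((k : ℤ) - (i + 1 : ℕ))) (sphere 0 |ε|) := by
        intro t ht
        rw [abs_of_pos hε] at ht
        have ht0 := ne_zero_of_mem_sphere_zero hε ht
        simp only [hf, smul_eq_mul]
        rw [zpow_sub₀ ht0, zpow_natCast, zpow_natCast, div_pow, pow_succ]
        field_simp
      rw [Real.circleAverage_congr_sphere this, Real.circleAverage_fun_smul,
        circleAverage_zpow hε]
      by_cases h : k = i + 1
      · simp [h]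
      · rw [if_neg h, if_neg (by omega), smul_zero]
    simp only [hval] at key
    have hinj : Function.Injective fun i : ℕ => ((i + 1, i) : ℕ × ℕ) := fun i j h => by
      simpa using h
    rw [← hinj.hasSum_iff] at key
    · refine key.congr_fun ?_ |> fun h => h
      intro i; simp [borelTerm]
    · rintro ⟨k, i⟩ hk
      have : k ≠ i + 1 := fun h => hk ⟨i, by simp [h]⟩
      simp [this]
  · intro p
    simp only [hf]
    refine ContinuousOn.mul (by fun_prop) (ContinuousOn.div (ContinuousOn.div_const
      (ContinuousOn.pow (continuousOn_const.div continuousOn_id ?_) _) _) continuousOn_id ?_) <;>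
    exact fun t ht => ne_zero_of_mem_sphere_zero hε ht
  · intro p t ht
    rw [hf]; simp only [norm_mul (c p.1 * t ^ p.1)]
    rw [hbnd _ t ht, hbndc _ t ht]
  · exact hsum

/-! ### The functions log(1 + t), L and L_ω near t = 0 -/

theorem one_add_mem_slitPlane {t : ℂ} (ht : t ∈ ball (0 : ℂ) 1) : 1 + t ∈ Complex.slitPlane :=
  Complex.mem_slitPlane_of_norm_lt_one (by simpa using ht)

theorem log_one_add_ne_zero {t : ℂ} (ht : t ∈ ball (0 : ℂ) 1) (h0 : t ≠ 0) :
    Complex.log (1 + t) ≠ 0 := by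
  intro h
  have := Complex.exp_log (Complex.slitPlane_ne_zero (one_add_mem_slitPlane ht))
  rw [h, Complex.exp_zero] at this
  exact h0 (by linear_combination -this)

theorem differentiableOn_log_one_add :
    DifferentiableOn ℂ (fun t : ℂ => Complex.log (1 + t)) (ball 0 1) := fun _ ht =>
  ((differentiableAt_id.const_add (1 : ℂ)).clog
    (one_add_mem_slitPlane ht)).differentiableWithinAt

theorem norm_log_one_add_le_two_mul {t : ℂ} (ht : ‖t‖ ≤ 1 / 2) :
    ‖Complex.log (1 + t)‖ ≤ 2 * ‖t‖ := by
  have h1 := Complex.norm_log_one_add_half_le_self ht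
  linarith [norm_nonneg t]

/-- The expansion log(1 + t) = t − t²/2 + O(t³) makes 1/log(1 + t) − 1/t − 1/2 of order t; this is
the continuity needed to remove the singularity of L at 0. -/
theorem norm_Lfun_sub_half_le {t : ℂ} (ht : ‖t‖ ≤ 1 / 2) : ‖Lfun t - 1 / 2‖ ≤ 4 * ‖t‖ := by
  rcases eq_or_ne t 0 with rfl | h0
  · simp [Lfun]
  have hn0 : 0 < ‖t‖ := norm_pos_iff.2 h0
  have hb : t ∈ ball (0 : ℂ) 1 := by simp; linarith
  have hh := log_one_add_ne_zero hb h0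
  rw [Lfun, if_neg h0]
  set h := Complex.log (1 + t) with hdef
  have h1 : (1 - ‖t‖)⁻¹ ≤ 2 := by
    rw [inv_le_comm₀ (by linarith) two_pos]; linarith
  have e1 : ‖h - t‖ ≤ ‖t‖ ^ 2 := by
    refine (Complex.norm_log_one_add_sub_self_le (by linarith)).trans ?_
    nlinarith [sq_nonneg ‖t‖]
  have e2 : ‖h - (t - t ^ 2 / 2)‖ ≤ ‖t‖ ^ 3 := by
    have := Complex.norm_log_sub_logTaylor_le 2 (z := t) (by linarith)
    have e : Complex.logTaylor (2 + 1) t = t - t ^ 2 / 2 := by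
      simp [Complex.logTaylor_succ, Complex.logTaylor_zero]; ring
    rw [e] at this
    refine this.trans ?_
    have : 0 ≤ ‖t‖ ^ 3 := by positivity
    norm_num
    nlinarith
  have e3 : ‖t‖ / 2 ≤ ‖h‖ := by
    have := norm_sub_norm_le t (t - h)
    rw [sub_sub_cancel, norm_sub_rev] at this
    nlinarith
  have e4 : 1 / h - 1 / t - 1 / 2 = (t * (t - h) / 2 - (h - (t - t ^ 2 / 2))) / (t * h) := by
    field_simp; ring
  rw [e4, norm_div, norm_mul, div_le_iff₀ (by positivity)]
  refine (norm_sub_le _ _).trans ?_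
  rw [norm_div, norm_mul, norm_sub_rev t h, Complex.norm_two]
  have : ‖t‖ * ‖h - t‖ / 2 ≤ ‖t‖ ^ 3 / 2 := by nlinarith
  have h5 : 4 * ‖t‖ * (‖t‖ * (‖t‖ / 2)) ≤ 4 * ‖t‖ * (‖t‖ * ‖h‖) := by gcongr
  nlinarith [pow_pos hn0 3]

theorem differentiableOn_Lfun : DifferentiableOn ℂ Lfun (ball 0 1) := by
  have hnhds : ball (0 : ℂ) 1 ∈ 𝓝 (0 : ℂ) := ball_mem_nhds _ one_pos
  rw [← Complex.differentiableOn_compl_singleton_and_continuousAt_iff hnhds]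
  constructor
  · have : DifferentiableOn ℂ (fun t : ℂ => 1 / Complex.log (1 + t) - 1 / t)
        (ball 0 1 \ {0}) := by
      refine DifferentiableOn.sub (DifferentiableOn.div (differentiableOn_const _)
        (differentiableOn_log_one_add.mono Set.sdiff_subset) fun t ht => ?_)
        (DifferentiableOn.div (differentiableOn_const _) differentiableOn_id fun t ht => ?_)
      · exact log_one_add_ne_zero ht.1 ht.2
      · exact ht.2
    exact this.congr fun t ht => if_neg ht.2
  · have hL0 : Lfun 0 = 1 / 2 := if_pos rfl
    rw [ContinuousAt, hL0, tendsto_iff_norm_sub_tendsto_zero]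
    refine squeeze_zero' (g := fun t : ℂ => 4 * ‖t‖) (Eventually.of_forall fun _ => norm_nonneg _)
      ?_ ?_
    · filter_upwards [closedBall_mem_nhds (0 : ℂ) (by norm_num : (0 : ℝ) < 1 / 2)] with t ht
      exact norm_Lfun_sub_half_le (by simpa using ht)
    · have : Continuous fun t : ℂ => 4 * ‖t‖ := by fun_prop
      simpa using this.tendsto 0

theorem differentiableOn_Lomega (ω : ℂ) : DifferentiableOn ℂ (Lomega ω) (ball 0 1) := by
  have h := differentiableOn_Lfun
  unfold Lomega
  exact (differentiableOn_const _).add (((differentiableOn_id.mul h).const_add 1).mul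
    (h.const_mul _).cexp)

theorem analyticAt_Lomega (ω : ℂ) : AnalyticAt ℂ (Lomega ω) 0 :=
  (differentiableOn_Lomega ω).analyticAt (ball_mem_nhds _ one_pos)

theorem Lomega_zero (ω : ℂ) : Lomega ω 0 = 0 := by
  simp [Lomega, Lfun]; ring_nf

/-! ### Borel transforms of Taylor series and L̂_ω -/

theorem hasSum_taylorCoeff {f : ℂ → ℂ} {R : ℝ} (hf : DifferentiableOn ℂ f (ball 0 R)) {t : ℂ}
    (ht : t ∈ ball (0 : ℂ) R) : HasSum (fun k => taylorCoeff f k * t ^ k) (f t) := by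
  have := Complex.hasSum_taylorSeries_on_ball hf ht
  refine this.congr_fun fun k => ?_
  simp [taylorCoeff]; ring

theorem summable_norm_taylorCoeff {f : ℂ → ℂ} {R : ℝ} (hf : DifferentiableOn ℂ f (ball 0 R))
    {ε : ℝ} (hε : 0 < ε) (hεR : ε < R) : Summable fun k => ‖taylorCoeff f k‖ * ε ^ k := by
  have := (hasSum_taylorCoeff hf (t := (ε : ℂ)) (by simpa [abs_of_pos hε] using hεR)).summable.norm
  refine this.congr fun k => ?_
  simp [abs_of_pos hε]

/-- The Borel transform of the Taylor series of a holomorphic function. -/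
theorem hasSum_borelTerm_taylorCoeff {f : ℂ → ℂ} {R : ℝ} (hf : DifferentiableOn ℂ f (ball 0 R))
    {ε : ℝ} (hε : 0 < ε) (hεR : ε < R) (ζ : ℂ) :
    HasSum (borelTerm (taylorCoeff f) ζ)
      (Real.circleAverage (fun t => f t * (Complex.exp (ζ / t) / t)) 0 ε) :=
  hasSum_borelTerm_circleAverage hε (summable_norm_taylorCoeff hf hε hεR) (fun _ ht =>
    hasSum_taylorCoeff hf (sphere_subset_ball hεR ht)) ζ

/-- This is the Borel transform of the constant series 1, which vanishes because the constant term
is discarded. -/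
theorem circleAverage_exp_div_div {ε : ℝ} (hε : 0 < ε) (ζ : ℂ) :
    Real.circleAverage (fun t => Complex.exp (ζ / t) / t) 0 ε = 0 := by
  have h := hasSum_borelTerm_circleAverage (c := fun k => if k = 0 then 1 else 0)
    (A := fun _ => 1) hε
    (summable_of_ne_finset_zero (s := {0}) fun k hk => by simp at hk; simp [hk])
    (fun t _ => by
      have := hasSum_single (f := fun k : ℕ => (if k = 0 then (1 : ℂ) else 0) * t ^ k) 0
        (fun k hk => by simp [hk])
      simpa using this) ζ
  have h2 : borelTerm (fun k => if k = 0 then 1 else 0) ζ = 0 := by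
    funext n; simp [borelTerm]
  rw [h2] at h
  simpa using h.unique hasSum_zero

/-- This is the Borel transform of the series t. -/
theorem circleAverage_exp_div {ε : ℝ} (hε : 0 < ε) (ζ : ℂ) :
    Real.circleAverage (fun t => Complex.exp (ζ / t)) 0 ε = 1 := by
  have h := hasSum_borelTerm_circleAverage (c := fun k => if k = 1 then 1 else 0)
    (A := fun t => t) hε
    (summable_of_ne_finset_zero (s := {1}) fun k hk => by simp at hk; simp [hk])
    (fun t _ => by
      have := hasSum_single (f := fun k : ℕ => (if k = 1 then (1 : ℂ) else 0) * t ^ k) 1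
        (fun k hk => by simp [hk])
      simpa using this) ζ
  have h2 : HasSum (borelTerm (fun k => if k = 1 then 1 else 0) ζ) 1 := by
    have := hasSum_single (f := borelTerm (fun k => if k = 1 then 1 else 0) ζ) 0
      fun k hk => by simp [borelTerm, hk]
    simpa [borelTerm] using this
  rw [← h.unique h2]
  refine Real.circleAverage_congr_sphere fun t ht => ?_
  rw [abs_of_pos hε] at ht
  have := ne_zero_of_mem_sphere_zero hε ht
  field_simp

theorem ne_zero_and_mem_ball {ε : ℝ} (hε : 0 < ε) (hε1 : ε < 1) {t : ℂ}
    (ht : t ∈ sphere (0 : ℂ) ε) :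
    t ≠ 0 ∧ t ∈ ball (0 : ℂ) 1 ∧ Complex.log (1 + t) ≠ 0 :=
  have h1 := ne_zero_of_mem_sphere_zero hε ht
  have h2 := sphere_subset_ball hε1 ht
  ⟨h1, h2, log_one_add_ne_zero h2 h1⟩

theorem continuousOn_log_one_add {ε : ℝ} (hε1 : ε < 1) :
    ContinuousOn (fun t : ℂ => Complex.log (1 + t)) (sphere 0 ε) :=
  differentiableOn_log_one_add.continuousOn.mono (sphere_subset_ball hε1)

/-- Since 1 + tL(t) = t/log(1 + t), the function L_ω(t) + exp(−ω/2) is t/log(1 + t) times exp(ω/t −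
ω/log(1 + t)). The constant exp(−ω/2) is invisible to the Borel transform. -/
theorem LomegaHat_eq_circleAverage {ε : ℝ} (hε : 0 < ε) (hε1 : ε < 1) (ω ζ : ℂ) :
    LomegaHat ω ζ = Real.circleAverage (fun t =>
      Complex.exp ((ζ + ω) / t - ω / Complex.log (1 + t)) / Complex.log (1 + t)) 0 ε := by
  have h := hasSum_borelTerm_taylorCoeff (differentiableOn_Lomega ω) hε hε1 ζ
  rw [LomegaHat, h.tsum_eq]
  have h1 : Set.EqOn (fun t => Lomega ω t * (Complex.exp (ζ / t) / t))
      (fun t => Complex.exp ((ζ + ω) / t - ω / Complex.log (1 + t)) / Complex.log (1 + t) -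
        Complex.exp (-ω / 2) • (Complex.exp (ζ / t) / t)) (sphere 0 |ε|) := by
    intro t ht
    rw [abs_of_pos hε] at ht
    obtain ⟨h0, h1, h2⟩ := ne_zero_and_mem_ball hε hε1 ht
    have e : Complex.exp ((ζ + ω) / t - ω / Complex.log (1 + t)) =
        Complex.exp (-ω * (1 / Complex.log (1 + t) - 1 / t)) * Complex.exp (ζ / t) := by
      rw [← Complex.exp_add]; congr 1; ring
    simp only [Lomega, Lfun, if_neg h0, smul_eq_mul]
    rw [e]
    field_simp
    ring
  have hc2 : ContinuousOn (fun t => Complex.exp (-ω / 2) • (Complex.exp (ζ / t) / t))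
      (sphere 0 ε) := by
    simp only [smul_eq_mul]
    refine continuousOn_const.mul (ContinuousOn.div (ContinuousOn.cexp
      (continuousOn_const.div continuousOn_id ?_)) continuousOn_id ?_) <;>
    exact fun t ht => ne_zero_of_mem_sphere_zero hε ht
  have hc1 : ContinuousOn (fun t => Complex.exp ((ζ + ω) / t - ω / Complex.log (1 + t)) /
      Complex.log (1 + t)) (sphere 0 ε) := by
    have hl := continuousOn_log_one_add hε1
    refine ContinuousOn.div (ContinuousOn.cexp ((continuousOn_const.div continuousOn_id ?_).sub
      (continuousOn_const.div hl ?_))) hl ?_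
    · exact fun t ht => ne_zero_of_mem_sphere_zero hε ht
    · exact fun t ht => (ne_zero_and_mem_ball hε hε1 ht).2.2
    · exact fun t ht => (ne_zero_and_mem_ball hε hε1 ht).2.2
  rw [Real.circleAverage_congr_sphere h1, Real.circleAverage_fun_sub
    (circleIntegrable_of_continuousOn hε hc1) (circleIntegrable_of_continuousOn hε hc2),
    Real.circleAverage_fun_smul, circleAverage_exp_div_div hε, smul_zero, sub_zero]

theorem summable_borelTerm_Lomega (ω ζ : ℂ) :
    Summable (borelTerm (taylorCoeff (Lomega ω)) ζ) :=
  (hasSum_borelTerm_taylorCoeff (differentiableOn_Lomega ω) (by norm_num : (0 : ℝ) < 1 / 2)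
    (by norm_num) ζ).summable

/-! ### The kernel of the change of variable from h to t -/

/-- The kernel `L̂_ξ(ζ - ξ)` of the change of variable `t ↦ log (1 + t)` in the Borel plane. -/
noncomputable def borelKernel (ξ ζ : ℂ) : ℂ := LomegaHat ξ (ζ - ξ)

/-- Substituting ζ − ξ in the formula for L̂_ξ separates the variables: exp(ζ/t) times exp(−ξ/log(1
+ t)). Regularity in both variables and growth of the kernel are all read off from this. -/
theorem borelKernel_eq_circleAverage {ε : ℝ} (hε : 0 < ε) (hε1 : ε < 1) (ξ ζ : ℂ) :
    borelKernel ξ ζ = Real.circleAverage (fun t =>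
      Complex.exp (ζ / t - ξ / Complex.log (1 + t)) / Complex.log (1 + t)) 0 ε := by
  rw [borelKernel, LomegaHat_eq_circleAverage hε hε1, sub_add_cancel]

theorem continuousOn_kernelIntegrand {X : Type*} [TopologicalSpace X] {ε : ℝ} (hε : 0 < ε)
    (hε1 : ε < 1) {s : Set X} {u v : X → ℂ} (hu : ContinuousOn u s) (hv : ContinuousOn v s) :
    ContinuousOn (fun p : X × ℂ =>
      Complex.exp (v p.1 / p.2 - u p.1 / Complex.log (1 + p.2)) / Complex.log (1 + p.2))
      (s ×ˢ sphere 0 ε) := by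
  have hl : ContinuousOn (fun p : X × ℂ => Complex.log (1 + p.2)) (s ×ˢ sphere 0 ε) :=
    (continuousOn_log_one_add hε1).comp continuousOn_snd fun p hp => hp.2
  have hu' : ContinuousOn (fun p : X × ℂ => u p.1) (s ×ˢ sphere 0 ε) :=
    hu.comp continuousOn_fst fun p hp => hp.1
  have hv' : ContinuousOn (fun p : X × ℂ => v p.1) (s ×ˢ sphere 0 ε) :=
    hv.comp continuousOn_fst fun p hp => hp.1
  refine ContinuousOn.div (ContinuousOn.cexp ((hv'.div continuousOn_snd ?_).sub
    (hu'.div hl ?_))) hl ?_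
  · exact fun p hp => ne_zero_of_mem_sphere_zero hε hp.2
  · exact fun p hp => (ne_zero_and_mem_ball hε hε1 hp.2).2.2
  · exact fun p hp => (ne_zero_and_mem_ball hε hε1 hp.2).2.2

theorem differentiable_borelKernel {u v : ℂ → ℂ} (hu : Differentiable ℂ u)
    (hv : Differentiable ℂ v) : Differentiable ℂ fun ζ => borelKernel (u ζ) (v ζ) := by
  have h2 : (0 : ℝ) < 1 / 2 := by norm_num
  simp only [borelKernel_eq_circleAverage h2 (by norm_num)]
  rw [← differentiableOn_univ]
  refine differentiableOn_circleAverage (F := fun ζ t => Complex.exp (v ζ / t -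
    u ζ / Complex.log (1 + t)) / Complex.log (1 + t)) isOpen_univ h2
    (continuousOn_kernelIntegrand h2 (by norm_num) hu.continuous.continuousOn
      hv.continuous.continuousOn) fun t ht => ?_
  fun_prop

theorem continuous_borelKernel : Continuous fun p : ℂ × ℂ => borelKernel p.1 p.2 := by
  have h2 : (0 : ℝ) < 1 / 2 := by norm_num
  simp only [borelKernel_eq_circleAverage h2 (by norm_num), Real.circleAverage_def]
  refine Continuous.const_smul
    (intervalIntegral.continuous_parametric_intervalIntegral_of_continuous' ?_ _ _) _
  refine (continuousOn_kernelIntegrand (X := ℂ × ℂ) (s := Set.univ) h2 (by norm_num)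
    continuousOn_fst continuousOn_snd).comp_continuous
    (f := fun p : (ℂ × ℂ) × ℝ => (p.1, circleMap 0 (1 / 2) p.2)) (by fun_prop) ?_
  exact fun p => ⟨trivial, circleMap_mem_sphere_zero h2 _⟩

theorem differentiable_LomegaHat (ω : ℂ) : Differentiable ℂ (LomegaHat ω) := by
  have := differentiable_borelKernel (u := fun _ => ω) (v := fun ζ => ζ + ω)
    (by fun_prop) (by fun_prop)
  simpa [borelKernel] using this

/-- On the circle |t| = 1/2 both 1/t and 1/log(1 + t) are bounded, so the exponent is linear in |ξ|
+ |ζ|; one constant serves as both prefactor and rate. -/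
theorem exists_norm_borelKernel_le :
    ∃ C > 0, ∀ ξ ζ : ℂ, ‖borelKernel ξ ζ‖ ≤ C * Real.exp (C * (‖ξ‖ + ‖ζ‖)) := by
  have h2 : (0 : ℝ) < 1 / 2 := by norm_num
  obtain ⟨C, hC⟩ := (isCompact_sphere (0 : ℂ) (1 / 2)).exists_bound_of_continuousOn
    (f := fun t => 1 / Complex.log (1 + t)) (continuousOn_const.div
      (continuousOn_log_one_add (by norm_num))
      fun t ht => (ne_zero_and_mem_ball h2 (by norm_num) ht).2.2)
  set D := max C 2 with hD
  have hD2 : 2 ≤ D := le_max_right _ _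
  refine ⟨D, by linarith, fun ξ ζ => ?_⟩
  rw [borelKernel_eq_circleAverage h2 (by norm_num), Real.circleAverage_def, norm_smul]
  have hb : ‖∫ θ in (0 : ℝ)..2 * Real.pi, Complex.exp (ζ / circleMap 0 (1 / 2) θ -
      ξ / Complex.log (1 + circleMap 0 (1 / 2) θ)) / Complex.log (1 + circleMap 0 (1 / 2) θ)‖
      ≤ (D * Real.exp (D * (‖ξ‖ + ‖ζ‖))) * |2 * Real.pi - 0| := by
    refine intervalIntegral.norm_integral_le_of_norm_le_const fun θ _ => ?_
    have ht := circleMap_mem_sphere_zero h2 θ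
    generalize circleMap 0 (1 / 2) θ = t at ht
    have hl : ‖1 / Complex.log (1 + t)‖ ≤ D := (hC t ht).trans (le_max_left _ _)
    have htn : ‖t‖ = 1 / 2 := by simpa using ht
    rw [div_eq_mul_one_div, norm_mul, mul_comm]
    refine mul_le_mul hl ?_ (norm_nonneg _) (by linarith)
    rw [Complex.norm_exp]
    refine Real.exp_le_exp.2 ((Complex.re_le_norm _).trans ((norm_sub_le _ _).trans ?_))
    have e1 : ‖ζ / t‖ ≤ D * ‖ζ‖ := by
      rw [norm_div, htn]
      have := mul_le_mul_of_nonneg_right hD2 (norm_nonneg ζ)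
      linarith
    have e2 : ‖ξ / Complex.log (1 + t)‖ ≤ D * ‖ξ‖ := by
      rw [div_eq_mul_one_div, norm_mul, mul_comm]
      gcongr
    linarith
  have hpi : 0 < 2 * Real.pi := by positivity
  rw [sub_zero, abs_of_pos hpi] at hb
  rw [Real.norm_of_nonneg (by positivity), inv_mul_le_iff₀ hpi]
  linarith

/-! ### The change of variable as an operator in the Borel plane -/

/-- The effect in the Borel plane of the change of variable `t ↦ h = log (1 + t)`, followed by
multiplication by `t / h`. -/
noncomputable def kernelTransform (G : ℂ → ℂ) (ζ : ℂ) : ℂ :=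
  Complex.exp (-ζ / 2) * G ζ + ζ * ∫ x in (0 : ℝ)..1, G (x * ζ) * borelKernel (x * ζ) ζ

/-- The exponential exp(αξ) is the Borel transform of h/(1 − αh), and the right side is that of
(t/h)·h/(1 − αh) with h = log(1 + t). After exchanging integral and average, the integral over the
segment is elementary: its endpoint 0 gives the claimed average, and its endpoint 1 cancels
exp(−ζ/2)exp(αζ). -/
theorem kernelTransform_exp {ε : ℝ} (hε : 0 < ε) (hε1 : ε < 1) {α : ℂ}
    (hα : ∀ t ∈ closedBall (0 : ℂ) ε, ‖α * Complex.log (1 + t)‖ < 1) (ζ : ℂ) :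
    kernelTransform (fun ξ => Complex.exp (α * ξ)) ζ = Real.circleAverage (fun t =>
      t / (1 - α * Complex.log (1 + t)) * (Complex.exp (ζ / t) / t)) 0 ε := by
  have hne : ∀ t ∈ closedBall (0 : ℂ) ε, 1 - α * Complex.log (1 + t) ≠ 0 := by
    intro t ht h
    have := hα t ht
    rw [← sub_eq_zero.1 h] at this
    simp at this
  have hl := continuousOn_log_one_add hε1
  have hl' : DifferentiableOn ℂ (fun t : ℂ => Complex.log (1 + t)) (closedBall 0 ε) :=
    differentiableOn_log_one_add.mono (closedBall_subset_ball hε1)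
  have step1 : ζ * ∫ x in (0 : ℝ)..1, Complex.exp (α * (x * ζ)) * borelKernel (x * ζ) ζ =
      ∫ x in (0 : ℝ)..1, Real.circleAverage (fun t => (ζ * Complex.exp (α * (x * ζ))) *
        (Complex.exp (ζ / t - x * ζ / Complex.log (1 + t)) / Complex.log (1 + t))) 0 ε := by
    rw [← intervalIntegral.integral_const_mul]
    refine intervalIntegral.integral_congr fun x _ => ?_
    simp only [borelKernel_eq_circleAverage hε hε1]
    have := Real.circleAverage_fun_smul (𝕜 := ℂ) (a := ζ * Complex.exp (α * (x * ζ)))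
      (f := fun t => Complex.exp (ζ / t - x * ζ / Complex.log (1 + t)) / Complex.log (1 + t))
      (c := 0) (R := ε)
    simp only [smul_eq_mul] at this
    rw [this]; ring
  have step2 : Set.EqOn (fun t => ∫ x in (0 : ℝ)..1, (ζ * Complex.exp (α * (x * ζ))) *
        (Complex.exp (ζ / t - x * ζ / Complex.log (1 + t)) / Complex.log (1 + t)))
      (fun t => t / (1 - α * Complex.log (1 + t)) * (Complex.exp (ζ / t) / t) -
        Complex.exp (α * ζ) • (Complex.exp (-ζ * Lfun t) / (1 - α * Complex.log (1 + t))))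
      (sphere 0 |ε|) := by
    intro t ht
    rw [abs_of_pos hε] at ht
    obtain ⟨h0, hb, hlog⟩ := ne_zero_and_mem_ball hε hε1 ht
    have hn := hne t (sphere_subset_closedBall ht)
    simp only [Lfun, if_neg h0, smul_eq_mul]
    set h := Complex.log (1 + t)
    -- As a function of x the integrand is an exponential of rate ζ(α − 1/h), and α − 1/h = −(1 −
    -- αh)/h, hence this primitive.
    have hder : ∀ x ∈ Set.uIcc (0 : ℝ) 1, HasDerivAt (fun x : ℝ =>
        -(Complex.exp (ζ / t) / (1 - α * h)) * Complex.exp (x * (ζ * (α - 1 / h))))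
        ((ζ * Complex.exp (α * (x * ζ))) * (Complex.exp (ζ / t - x * ζ / h) / h)) x := by
      intro x _
      have hx : HasDerivAt (fun x : ℝ => (x : ℂ) * (ζ * (α - 1 / h)))
          (1 * (ζ * (α - 1 / h))) x := (Complex.ofRealCLM.hasDerivAt).mul_const _
      refine (hx.cexp.const_mul _).congr_deriv ?_
      have e : Complex.exp (α * (x * ζ)) * Complex.exp (ζ / t - x * ζ / h) =
          Complex.exp (ζ / t) * Complex.exp (x * (ζ * (α - 1 / h))) := by
        rw [← Complex.exp_add, ← Complex.exp_add]; congr 1; ring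
      have : (ζ * Complex.exp (α * (x * ζ))) * (Complex.exp (ζ / t - x * ζ / h) / h) =
          ζ / h * (Complex.exp (α * (x * ζ)) * Complex.exp (ζ / t - x * ζ / h)) := by ring
      rw [this, e]
      field_simp
      ring
    rw [intervalIntegral.integral_eq_sub_of_hasDerivAt hder]
    · have e : Complex.exp (ζ / t) * Complex.exp ((1 : ℝ) * (ζ * (α - 1 / h))) =
          Complex.exp (α * ζ) * Complex.exp (-ζ * (1 / h - 1 / t)) := by
        rw [← Complex.exp_add, ← Complex.exp_add]; congr 1; push_cast; ring
      have : -(Complex.exp (ζ / t) / (1 - α * h)) * Complex.exp ((1 : ℝ) * (ζ * (α - 1 / h))) =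
        -(1 / (1 - α * h)) * (Complex.exp (ζ / t) *
          Complex.exp ((1 : ℝ) * (ζ * (α - 1 / h)))) := by ring
      rw [this, e]
      simp only [Complex.ofReal_zero, zero_mul, Complex.exp_zero]
      field_simp
      ring
    · refine Continuous.intervalIntegrable ?_ _ _
      fun_prop
  have hc1 : ContinuousOn (fun t => t / (1 - α * Complex.log (1 + t)) *
      (Complex.exp (ζ / t) / t)) (sphere 0 ε) := by
    refine (continuousOn_id.div (continuousOn_const.sub (continuousOn_const.mul hl)) ?_).mul
      ((ContinuousOn.cexp (continuousOn_const.div continuousOn_id ?_)).div continuousOn_id ?_)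
    · exact fun t ht => hne t (sphere_subset_closedBall ht)
    · exact fun t ht => ne_zero_of_mem_sphere_zero hε ht
    · exact fun t ht => ne_zero_of_mem_sphere_zero hε ht
  have hd2 : DifferentiableOn ℂ (fun t => Complex.exp (-ζ * Lfun t) /
      (1 - α * Complex.log (1 + t))) (closedBall 0 ε) :=
    ((differentiableOn_Lfun.mono (closedBall_subset_ball hε1)).const_mul _).cexp.div
      ((hl'.const_mul α).const_sub 1) hne
  have hc2 : ContinuousOn (fun t => Complex.exp (α * ζ) • (Complex.exp (-ζ * Lfun t) /
      (1 - α * Complex.log (1 + t)))) (sphere 0 ε) := by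
    simp only [smul_eq_mul]
    exact continuousOn_const.mul (hd2.continuousOn.mono sphere_subset_closedBall)
  -- The poles of 1/t and 1/h cancel in L(t), so this function is holomorphic on the disk and its
  -- average is its value at t = 0, where L = 1/2.
  have step3 : Real.circleAverage (fun t => Complex.exp (-ζ * Lfun t) /
      (1 - α * Complex.log (1 + t))) 0 ε = Complex.exp (-ζ / 2) := by
    rw [DiffContOnCl.circleAverage]
    · simp [Lfun]; ring_nf
    · rw [abs_of_pos hε]
      exact (hd2.mono (by rw [closure_ball _ hε.ne'])).diffContOnCl
  rw [kernelTransform, step1, intervalIntegral_circleAverage_swap hε,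
    Real.circleAverage_congr_sphere step2, Real.circleAverage_fun_sub
    (circleIntegrable_of_continuousOn hε hc1) (circleIntegrable_of_continuousOn hε hc2),
    Real.circleAverage_fun_smul, step3, smul_eq_mul]
  · ring
  · refine ContinuousOn.mul (by fun_prop) ?_
    exact continuousOn_kernelIntegrand (X := ℝ) (s := Set.univ) (u := fun x => x * ζ)
      (v := fun _ => ζ) hε hε1 (by fun_prop) (by fun_prop)

theorem kernelTransform_one (ζ : ℂ) : kernelTransform (fun _ => 1) ζ = 1 := by
  have h2 : (0 : ℝ) < 1 / 2 := by norm_num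
  have := kernelTransform_exp h2 (by norm_num) (α := 0) (by simp) ζ
  simp only [zero_mul, Complex.exp_zero, sub_zero, div_one] at this
  rw [this, ← circleAverage_exp_div h2 ζ]
  refine Real.circleAverage_congr_sphere fun t ht => ?_
  rw [abs_of_pos h2] at ht
  have := ne_zero_of_mem_sphere_zero h2 ht
  field_simp

/-! ### Partial fractions of 1/(Λ₀ⁿeⁿʰ − 1) -/

theorem two_pi_I_ne_zero : (2 * Real.pi * Complex.I : ℂ) ≠ 0 := Complex.two_pi_I_ne_zero

/-- The Mittag-Leffler expansion of the cotangent, as an absolutely convergent sum over `ℤ`. -/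
theorem hasSum_cot_int {w : ℂ} (hw : w ∈ Complex.integerComplement) :
    HasSum (fun k : ℤ => 1 / (w - k) + 1 / (k : ℂ)) (Real.pi * Complex.cot (Real.pi * w)) := by
  have hk : ∀ k : ℤ, w - k ≠ 0 := fun k => by
    simpa [sub_eq_add_neg] using Complex.integerComplement_add_ne_zero hw (-k)
  have hs : Summable fun k : ℤ => 1 / (w - k) + 1 / (k : ℂ) := by
    -- The k-th term is w/((w − k)k), of quadratic decay. At k = 0 the convention 1/0 = 0 makes this
    -- product vanish while the term is 1/w, whence the correction `h2`.
    have h1 := (EisensteinSeries.summable_linear_sub_mul_linear_add w 1 0).mul_left w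
    have h2 : Summable fun k : ℤ => if k = 0 then 1 / w else 0 :=
      summable_of_ne_finset_zero (s := {0}) fun k hk => by simp at hk; simp [hk]
    refine (h1.add h2).congr fun k => ?_
    rcases eq_or_ne k 0 with rfl | h0
    · simp
    · have : (k : ℂ) ≠ 0 := by exact_mod_cast h0
      have := hk k
      simp only [Int.cast_one, one_mul, Int.cast_zero, zero_mul, zero_add, h0, if_false, add_zero]
      field_simp
      ring
  have hp : Summable fun n : ℕ+ => 1 / (w - ((n : ℤ) : ℂ)) + 1 / (((n : ℤ)) : ℂ) :=
    hs.comp_injective (i := fun n : ℕ+ => ((n : ℕ) : ℤ)) fun a b h => by simpa using h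
  have hm : Summable fun n : ℕ+ => 1 / (w - ((-(n : ℤ) : ℤ) : ℂ)) + 1 / (((-(n : ℤ) : ℤ)) : ℂ) :=
    hs.comp_injective (i := fun n : ℕ+ => (-((n : ℕ) : ℤ))) fun a b h => by simpa using h
  have hval := hs.hasSum
  rw [tsum_int_eq_zero_add_tsum_pnat hs] at hval
  convert hval using 1
  rw [cot_series_rep hw, add_assoc, ← hp.tsum_add hm]
  congr 1
  · simp
  · refine tsum_congr fun n => ?_
    push_cast
    rw [sub_neg_eq_add, div_neg]
    ring

theorem exp_two_pi_I_mul_ne_one {w : ℂ} (hw : w ∈ Complex.integerComplement) :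
    Complex.exp (2 * Real.pi * Complex.I * w) - 1 ≠ 0 := by
  intro h
  obtain ⟨n, hn⟩ := Complex.exp_eq_one_iff.1 (sub_eq_zero.1 h)
  refine hw ⟨n, ?_⟩
  have := two_pi_I_ne_zero
  refine mul_left_cancel₀ this ?_
  rw [hn]; ring

/-- The sum is cot(πw)/(2i), the odd part of 1/(exp(2πiw) − 1) after adding 1/2. -/
theorem hasSum_inv_exp_sub_one {w : ℂ} (hw : w ∈ Complex.integerComplement) :
    HasSum (fun k : ℤ => (1 / (w - k) + 1 / (k : ℂ)) / (2 * Real.pi * Complex.I))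
      (1 / (Complex.exp (2 * Real.pi * Complex.I * w) - 1) + 1 / 2) := by
  have h := (hasSum_cot_int hw).div_const (2 * Real.pi * Complex.I)
  suffices key : 1 / (Complex.exp (2 * Real.pi * Complex.I * w) - 1) + 1 / 2 =
      Real.pi * Complex.cot (Real.pi * w) / (2 * Real.pi * Complex.I) by rw [key]; exact h
  rw [Complex.cot_pi_eq_exp_ratio]
  have h1 := exp_two_pi_I_mul_ne_one hw
  have h2 : 1 - Complex.exp (2 * Real.pi * Complex.I * w) ≠ 0 := by
    rw [← neg_sub]; exact neg_ne_zero.2 h1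
  have hpi : (Real.pi : ℂ) ≠ 0 := by exact_mod_cast Real.pi_ne_zero
  have hI := Complex.I_ne_zero
  generalize Complex.exp (2 * Real.pi * Complex.I * w) = e at *
  field_simp
  rw [Complex.I_sq]
  ring

/-- The numbers `μ_j = m₀ / (2 π i j)`. -/
noncomputable def mu (m₀ : ℕ) (j : ℤ) : ℂ := m₀ / (2 * Real.pi * Complex.I * j)

/-- Division by zero gives the value 0 here, so sums over all j ∈ ℤ automatically omit j = 0, the
pole at h = 0, which is carried by `polePart` instead. -/
theorem mu_zero (m₀ : ℕ) : mu m₀ 0 = 0 := by simp [mu]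

theorem norm_two_pi_I : ‖(2 * Real.pi * Complex.I : ℂ)‖ = 2 * Real.pi := by
  simp [abs_of_pos Real.pi_pos]

theorem norm_mu (m₀ : ℕ) (j : ℤ) : ‖mu m₀ j‖ = m₀ / (2 * Real.pi * |(j : ℝ)|) := by
  rw [mu, norm_div, norm_mul, norm_two_pi_I, Complex.norm_natCast, Complex.norm_intCast]

theorem norm_mu_le (m₀ : ℕ) (j : ℤ) : ‖mu m₀ j‖ ≤ m₀ / (2 * Real.pi) := by
  rw [norm_mu]
  rcases eq_or_ne j 0 with rfl | h
  · simp; positivity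
  · have : (1 : ℝ) ≤ |(j : ℝ)| := by exact_mod_cast Int.one_le_abs h
    have hpi := Real.pi_pos
    refine div_le_div_of_nonneg_left (by positivity) (by positivity) ?_
    nlinarith

theorem norm_mu_le_self (m₀ : ℕ) (j : ℤ) : ‖mu m₀ j‖ ≤ m₀ := by
  refine (norm_mu_le m₀ j).trans (div_le_self (by positivity) ?_)
  linarith [Real.pi_gt_three]

theorem summable_norm_mu_sq (m₀ : ℕ) : Summable fun j : ℤ => ‖mu m₀ j‖ ^ 2 := by
  have := (Real.summable_one_div_int_pow (p := 2)).2 (by norm_num)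
  refine (this.mul_left ((m₀ / (2 * Real.pi)) ^ 2)).congr fun j => ?_
  rw [norm_mu, div_pow, div_pow, mul_pow _ |(j : ℝ)|, sq_abs]
  simp [div_eq_mul_inv]; ring

/-- The residue of `1 / (Λ₀ ^ n e ^ (n h) - 1)` at `h = 0`. -/
noncomputable def polePart (m₀ n : ℕ) : ℂ := if m₀ ∣ n then 1 / n else 0

/-- The constant term of `1 / (Λ₀ ^ n e ^ (n h) - 1)` at `h = 0`. -/
noncomputable def constPart (m₀ n₀ n : ℕ) : ℂ :=
  if m₀ ∣ n then -1 / 2 else 1 / (resonance m₀ n₀ ^ n - 1)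

theorem resonance_pow (m₀ n₀ n : ℕ) :
    resonance m₀ n₀ ^ n = Complex.exp (2 * Real.pi * Complex.I * (n * n₀ / m₀)) := by
  rw [resonance, ← Complex.exp_nat_mul]; congr 1; ring

/-- Otherwise w·m₀ would be a nonzero integer of modulus less than 1. -/
theorem mem_integerComplement_of_norm_lt {m₀ : ℕ} (hm : 0 < m₀) {w : ℂ} (hw0 : w ≠ 0)
    (hw : ‖w‖ * m₀ < 1) (N : ℤ) : w + N / m₀ ∈ Complex.integerComplement := by
  rintro ⟨k, hk⟩
  have hm' : (m₀ : ℂ) ≠ 0 := by exact_mod_cast hm.ne'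
  have e : w * m₀ = ((k * m₀ - N : ℤ) : ℂ) := by
    push_cast; rw [hk]; field_simp; ring
  have h0 : k * m₀ - N ≠ 0 := by
    intro h; rw [h] at e; simp [hw0, hm'] at e
  have h1 : (1 : ℝ) ≤ ‖((k * m₀ - N : ℤ) : ℂ)‖ := by
    rw [Complex.norm_intCast]; exact_mod_cast Int.one_le_abs h0
  rw [← e, norm_mul, Complex.norm_natCast] at h1
  linarith

/-- Partial fractions of `1 / (Λ₀ ^ n e ^ (n h) - 1)` as a function of `h`. -/
theorem hasSum_partialFractions {m₀ n₀ n : ℕ} (hm : 0 < m₀) (hn : 0 < n)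
    (hcop : Nat.Coprime n₀ m₀) {h : ℂ} (h0 : h ≠ 0) (hh : n * ‖h‖ * m₀ < 2 * Real.pi) :
    HasSum (fun j : ℤ => if (m₀ : ℤ) ∣ j + n * n₀ then
        mu m₀ j * (1 / (1 - n * mu m₀ j * h) - 1) else 0)
      (polePart m₀ n / h + constPart m₀ n₀ n -
        1 / (resonance m₀ n₀ ^ n * Complex.exp (n * h) - 1)) := by
  have h2 := two_pi_I_ne_zero
  have hm' : (m₀ : ℂ) ≠ 0 := by exact_mod_cast hm.ne'
  have hn' : (n : ℂ) ≠ 0 := by exact_mod_cast hn.ne'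
  set w : ℂ := n * h / (2 * Real.pi * Complex.I) with hw
  have hw0 : w ≠ 0 := by rw [hw]; positivity
  have hwn : ‖w‖ * m₀ < 1 := by
    rw [hw, norm_div, norm_two_pi_I, norm_mul, Complex.norm_natCast, div_mul_eq_mul_div,
      div_lt_one (by positivity)]
    exact hh
  have hx := mem_integerComplement_of_norm_lt hm hw0 hwn (n * n₀)
  have hsum := hasSum_inv_exp_sub_one hx
  have hexp : Complex.exp (2 * Real.pi * Complex.I * (w + ((n * n₀ : ℤ) : ℂ) / m₀)) =
      resonance m₀ n₀ ^ n * Complex.exp (n * h) := by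
    rw [resonance_pow, ← Complex.exp_add]; congr 1
    rw [hw]; push_cast; field_simp; ring
  rw [hexp] at hsum
  have hinj : Function.Injective fun k : ℤ => k * m₀ - n * n₀ := fun a b hab => by
    have : a * (m₀ : ℤ) = b * m₀ := by simpa using hab
    exact mul_right_cancel₀ (by exact_mod_cast hm.ne') this
  have hne : ∀ j : ℤ, w - j / m₀ ≠ 0 := by
    intro j hj
    have := mem_integerComplement_of_norm_lt hm hw0 hwn (-j)
    refine Complex.integerComplement.ne_zero this ?_
    rw [← hj]; push_cast; ring
  have hterm : ∀ j : ℤ, j ≠ 0 → mu m₀ j * (1 / (1 - n * mu m₀ j * h) - 1) =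
      -((1 / (w - j / m₀) + m₀ / j) / (2 * Real.pi * Complex.I)) := by
    intro j hj
    have hj' : (j : ℂ) ≠ 0 := by exact_mod_cast hj
    have h1 := hne j
    have e1 : n * mu m₀ j * h = w * m₀ / j := by rw [mu, hw]; field_simp
    have e2 : mu m₀ j = m₀ / j / (2 * Real.pi * Complex.I) := by rw [mu]; field_simp
    have h3 : (j : ℂ) - w * m₀ ≠ 0 := by
      intro h; apply h1; rw [sub_eq_zero.1 h]; field_simp; simp
    have h4 : w * m₀ - j ≠ 0 := by rw [← neg_sub]; exact neg_ne_zero.2 h3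
    have e3 : w - j / m₀ = (w * m₀ - j) / m₀ := by field_simp
    have e4 : 1 - w * m₀ / j = (j - w * m₀) / j := by field_simp
    rw [e1, e2, e3, e4, one_div_div, one_div_div]
    have e5 : (m₀ : ℂ) / (w * m₀ - j) = -(m₀ / (j - w * m₀)) := by
      rw [← div_neg, neg_sub]
    rw [e5]
    field_simp
    ring
  -- The indices satisfying the congruence are j = k m₀ − n n₀. With w = nh/(2πi) they turn w + n
  -- n₀/m₀ − k into w − j/m₀, so the cotangent series becomes a series over the poles in h.
  rw [← hinj.hasSum_iff]
  swap
  · intro j hj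
    rw [if_neg]
    rintro ⟨k, hk⟩
    exact hj ⟨k, by simp only; linarith⟩
  have hdvd : ∀ k : ℤ, (m₀ : ℤ) ∣ (k * m₀ - n * n₀) + n * n₀ := fun k => ⟨k, by ring⟩
  simp only [Function.comp_def, hdvd, if_true]
  have hshift : ∀ k : ℤ, w + ((n * n₀ : ℤ) : ℂ) / m₀ - k =
      w - ((k * m₀ - n * n₀ : ℤ) : ℂ) / m₀ := by
    intro k; push_cast; field_simp; ring
  -- If m₀ ∣ n, one index is j = 0: its term 1/w is removed from the series and becomes
  -- `polePart`/h, and 1/2 is the constant term. Otherwise h = 0 is regular, and subtracting the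
  -- series at h = 0 normalises each term to vanish there.
  by_cases hdn : m₀ ∣ n
  · obtain ⟨l, rfl⟩ := hdn
    have hres : resonance m₀ n₀ ^ (m₀ * l) = 1 := by
      rw [resonance_pow, Complex.exp_eq_one_iff]
      exact ⟨l * n₀, by push_cast; field_simp⟩
    have hw1 : w ∈ Complex.integerComplement := by
      simpa using mem_integerComplement_of_norm_lt hm hw0 hwn 0
    have hE : Complex.exp (2 * Real.pi * Complex.I * w) =
        Complex.exp (((m₀ * l : ℕ) : ℂ) * h) := by
      congr 1; rw [hw]; field_simp
    have hs1 := ((hasSum_inv_exp_sub_one hw1).sub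
      (hasSum_ite_eq (0 : ℤ) (1 / w / (2 * Real.pi * Complex.I)))).neg
    have hs2 := (Equiv.subRight (l * n₀ : ℤ)).hasSum_iff.2 hs1
    rw [hE] at hs2
    have hval : polePart m₀ (m₀ * l) / h + constPart m₀ n₀ (m₀ * l) -
        1 / (resonance m₀ n₀ ^ (m₀ * l) * Complex.exp (((m₀ * l : ℕ) : ℂ) * h) - 1) =
        -(1 / (Complex.exp (((m₀ * l : ℕ) : ℂ) * h) - 1) + 1 / 2 -
          1 / w / (2 * Real.pi * Complex.I)) := by
      have : 1 / w / (2 * Real.pi * Complex.I) = 1 / ((m₀ * l : ℕ) : ℂ) / h := by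
        rw [hw]; field_simp
      rw [hres, one_mul, polePart, constPart, if_pos (dvd_mul_right _ _),
        if_pos (dvd_mul_right _ _), this]
      ring
    rw [hval]
    refine hs2.congr_fun fun k => ?_
    simp only [Function.comp_apply, Equiv.subRight_apply]
    have hj : k * (m₀ : ℤ) - ((m₀ * l : ℕ) : ℤ) * n₀ = (k - l * n₀) * m₀ := by push_cast; ring
    rw [hj]
    generalize k - l * n₀ = k'
    rcases eq_or_ne k' 0 with rfl | hk'
    · simp [mu_zero]
    · have hk'' : (k' : ℂ) ≠ 0 := by exact_mod_cast hk'
      rw [hterm _ (mul_ne_zero hk' (by exact_mod_cast hm.ne')), if_neg hk', sub_zero]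
      push_cast
      have e1 : (k' : ℂ) * m₀ / m₀ = k' := by field_simp
      have e2 : (m₀ : ℂ) / (k' * m₀) = 1 / k' := by field_simp
      rw [e1, e2]
  · have hndvd : ¬ (m₀ : ℤ) ∣ n * n₀ := by
      intro hd
      have : m₀ ∣ n * n₀ := by exact_mod_cast hd
      exact hdn (hcop.symm.dvd_of_dvd_mul_right this)
    have hj0 : ∀ k : ℤ, k * m₀ - n * n₀ ≠ 0 := fun k hk => hndvd ⟨k, by linarith⟩
    have hy : ((n : ℂ) * n₀ / m₀) ∈ Complex.integerComplement := by
      rintro ⟨k, hk⟩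
      apply hj0 k
      have : (k : ℂ) * m₀ - n * n₀ = 0 := by rw [hk]; field_simp; ring
      exact_mod_cast this
    have hs := (hasSum_inv_exp_sub_one hy).sub hsum
    have hval : polePart m₀ n / h + constPart m₀ n₀ n -
        1 / (resonance m₀ n₀ ^ n * Complex.exp (n * h) - 1) =
        1 / (Complex.exp (2 * Real.pi * Complex.I * (n * n₀ / m₀)) - 1) + 1 / 2 -
        (1 / (resonance m₀ n₀ ^ n * Complex.exp (n * h) - 1) + 1 / 2) := by
      rw [polePart, constPart, if_neg hdn, if_neg hdn, ← resonance_pow]; ring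
    rw [hval]
    refine hs.congr_fun fun k => ?_
    have hjk : ((k * m₀ - n * n₀ : ℤ) : ℂ) ≠ 0 := by exact_mod_cast hj0 k
    rw [hterm _ (hj0 k), hshift k]
    have e1 : (n : ℂ) * n₀ / m₀ - k = -(((k * m₀ - n * n₀ : ℤ) : ℂ) / m₀) := by
      push_cast; field_simp; ring
    rw [e1, div_neg, one_div_div]
    ring

/-! ### Characters modulo m₀ -/

theorem dvd_iff_dvd_of_inverse {m₀ n₀ : ℕ} {n₀' : ℤ} (hinv : (n₀ : ℤ) * n₀' ≡ 1 [ZMOD (m₀ : ℤ)])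
    (j n : ℤ) : (m₀ : ℤ) ∣ j * n₀' + n ↔ (m₀ : ℤ) ∣ j + n * n₀ := by
  have hd : (m₀ : ℤ) ∣ 1 - n₀ * n₀' := hinv.dvd
  constructor
  · intro h
    have e : j + n * n₀ = (j * n₀' + n) * n₀ + j * (1 - n₀ * n₀') := by ring
    rw [e]; exact dvd_add (h.mul_right _) (hd.mul_left _)
  · intro h
    have e : j * n₀' + n = (j + n * n₀) * n₀' + n * (1 - n₀ * n₀') := by ring
    rw [e]; exact dvd_add (h.mul_right _) (hd.mul_left _)

/-- Orthogonality of the additive characters modulo `m₀`. -/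
theorem sum_resCoeff_mul_exp {m₀ n₀ : ℕ} (hm : 0 < m₀) {n₀' : ℤ}
    (hinv : (n₀ : ℤ) * n₀' ≡ 1 [ZMOD (m₀ : ℤ)]) (j : ℤ) (n : ℕ) :
    ∑ b ∈ Finset.range m₀, resCoeff m₀ n₀' j b *
      Complex.exp (2 * Real.pi * Complex.I * b * n / m₀) =
      if (m₀ : ℤ) ∣ j + n * n₀ then 1 else 0 := by
  have hm' : (m₀ : ℂ) ≠ 0 := by exact_mod_cast hm.ne'
  set x : ℂ := Complex.exp (2 * Real.pi * Complex.I * ((j * n₀' + n : ℤ) / m₀)) with hx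
  have h1 : ∀ b ∈ Finset.range m₀, resCoeff m₀ n₀' j b *
      Complex.exp (2 * Real.pi * Complex.I * b * n / m₀) = 1 / m₀ * x ^ b := by
    intro b _
    rw [resCoeff, mul_assoc, ← Complex.exp_add, hx, ← Complex.exp_nat_mul]
    congr 2; push_cast; ring
  rw [Finset.sum_congr rfl h1, ← Finset.mul_sum]
  have hxm : x ^ m₀ = 1 := by
    rw [hx, ← Complex.exp_nat_mul, Complex.exp_eq_one_iff]
    exact ⟨j * n₀' + n, by field_simp⟩
  have hiff : x = 1 ↔ (m₀ : ℤ) ∣ j + n * n₀ := by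
    rw [← dvd_iff_dvd_of_inverse hinv, hx, Complex.exp_eq_one_iff]
    constructor
    · rintro ⟨k, hk⟩
      refine ⟨k, ?_⟩
      have h3 : ((j * n₀' + n : ℤ) : ℂ) / m₀ = k :=
        mul_left_cancel₀ two_pi_I_ne_zero (by rw [hk]; ring)
      rw [div_eq_iff hm'] at h3
      have : ((j * n₀' + n : ℤ) : ℂ) = ((m₀ * k : ℤ) : ℂ) := by rw [h3]; push_cast; ring
      exact_mod_cast this
    · rintro ⟨k, hk⟩
      refine ⟨k, ?_⟩
      rw [hk]; push_cast; field_simp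
  split_ifs with hd
  · rw [hiff.2 hd]; simp [hm']
  · have hx1 : x ≠ 1 := fun h => hd (hiff.1 h)
    rw [geom_sum_eq hx1, hxm]; simp

theorem norm_resCoeff (m₀ : ℕ) (n₀' a b : ℤ) : ‖resCoeff m₀ n₀' a b‖ = 1 / m₀ := by
  have : (2 * Real.pi * Complex.I * a * b * n₀' / m₀ : ℂ) =
      ((2 * Real.pi * a * b * n₀' / m₀ : ℝ) : ℂ) * Complex.I := by push_cast; ring
  rw [resCoeff, this, norm_mul, Complex.norm_exp_ofReal_mul_I]
  simp

/-! ### The geometric series of exponentials and its poles -/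

/-- The sum of the geometric series `∑_{n ≥ 1} e ^ (n p)`. -/
noncomputable def geomExp (p : ℂ) : ℂ := Complex.exp p / (1 - Complex.exp p)

theorem norm_exp_lt_one {p : ℂ} (hp : p.re < 0) : ‖Complex.exp p‖ < 1 := by
  rw [Complex.norm_exp]; simpa using hp

theorem hasSum_geomExp {p : ℂ} (hp : p.re < 0) :
    HasSum (fun n : ℕ => Complex.exp (((n + 1 : ℕ) : ℂ) * p)) (geomExp p) := by
  have := (hasSum_geometric_of_norm_lt_one (norm_exp_lt_one hp)).mul_left (Complex.exp p)
  refine this.congr_fun fun n => ?_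
  rw [Complex.exp_nat_mul, pow_succ']

/-- Finitely many poles of `geomExp` may be split off, the rest being holomorphic in a large
disk. -/
theorem exists_geomExp_eq_sub_sum (N : ℕ) : ∃ P : ℂ → ℂ, DifferentiableOn ℂ P (ball 0 N) ∧
    ∀ p ∈ ball (0 : ℂ) N, (∀ l : ℤ, p ≠ 2 * Real.pi * Complex.I * l) →
      geomExp p = P p - ∑ l ∈ Finset.Icc (-N : ℤ) N, 1 / (p - 2 * Real.pi * Complex.I * l) := by
  have h2 := two_pi_I_ne_zero
  -- For |l| > N the pole 2πil is at distance at least 2π|l| − N ≥ |l| from every point of the disk,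
  -- so the remaining terms are holomorphic there and of order N/l².
  set S := Finset.Icc (-N : ℤ) N with hS
  set T : ℤ → ℂ → ℂ := fun l p => 1 / (p - 2 * Real.pi * Complex.I * l) +
    1 / (2 * Real.pi * Complex.I * l) with hT
  set T' : ℤ → ℂ → ℂ := fun l p => if l ∈ S then 0 else T l p with hT'
  have hlow : ∀ l : ℤ, l ∉ S → ∀ p ∈ ball (0 : ℂ) N, (1 : ℝ) ≤ |(l : ℝ)| ∧
      |(l : ℝ)| ≤ ‖p - 2 * Real.pi * Complex.I * l‖ := by
    intro l hl p hp
    have hl' : (N : ℤ) < |l| := by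
      rw [hS, Finset.mem_Icc, ← abs_le, not_le] at hl; exact hl
    have hl'' : (N : ℝ) < |(l : ℝ)| := by exact_mod_cast hl'
    have hp' : ‖p‖ < N := by simpa using hp
    have h1 : (1 : ℝ) ≤ |(l : ℝ)| := by
      have : (1 : ℤ) ≤ |l| := by omega
      exact_mod_cast this
    have h3 := norm_sub_norm_le (2 * Real.pi * Complex.I * l) p
    rw [norm_mul, norm_two_pi_I, Complex.norm_intCast, norm_sub_rev] at h3
    refine ⟨h1, ?_⟩
    nlinarith [Real.pi_gt_three]
  have hbound : ∀ l : ℤ, ∀ p ∈ ball (0 : ℂ) N, ‖T' l p‖ ≤ N * (1 / (l : ℝ) ^ 2) := by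
    intro l p hp
    simp only [hT']
    split_ifs with hl
    · simp; positivity
    · obtain ⟨h1, h3⟩ := hlow l hl p hp
      have hl0 : (l : ℂ) ≠ 0 := by
        rintro h; have : (l : ℝ) = 0 := by exact_mod_cast h
        rw [this] at h1; norm_num at h1
      have hne : p - 2 * Real.pi * Complex.I * l ≠ 0 := by
        rw [← norm_pos_iff]; linarith
      have e : T l p = p / ((p - 2 * Real.pi * Complex.I * l) * (2 * Real.pi * Complex.I * l)) := by
        simp only [hT]; field_simp; ring
      have hp' : ‖p‖ ≤ N := (by simpa using hp : ‖p‖ < N).le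
      rw [e, norm_div, norm_mul, norm_mul _ (l : ℂ), norm_two_pi_I, Complex.norm_intCast,
        ← sq_abs (l : ℝ), mul_one_div]
      refine div_le_div₀ (by positivity) hp' (by positivity) ?_
      rw [sq]
      have : |(l : ℝ)| ≤ 2 * Real.pi * |(l : ℝ)| := by nlinarith [Real.pi_gt_three]
      exact mul_le_mul h3 this (by positivity) (norm_nonneg _)
  have hu : Summable fun l : ℤ => (N : ℝ) * (1 / (l : ℝ) ^ 2) :=
    ((Real.summable_one_div_int_pow (p := 2)).2 (by norm_num)).mul_left _
  refine ⟨fun p => -1 / 2 - ∑ l ∈ S, 1 / (2 * Real.pi * Complex.I * l) - ∑' l : ℤ, T' l p,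
    ?_, ?_⟩
  · refine (differentiableOn_const _).sub (Complex.differentiableOn_tsum_of_summable_norm hu
      (fun l => ?_) isOpen_ball fun l p hp => hbound l p hp)
    simp only [hT']
    split_ifs with hl
    · exact differentiableOn_const _
    · simp only [hT]
      refine DifferentiableOn.add_const _ (DifferentiableOn.div (differentiableOn_const _)
        (differentiableOn_id.sub_const _) fun p hp => ?_)
      obtain ⟨h1, h3⟩ := hlow l hl p hp
      change p - _ ≠ 0
      rw [← norm_pos_iff]; linarith
  · intro p hp hpl
    have hw : p / (2 * Real.pi * Complex.I) ∈ Complex.integerComplement := by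
      rintro ⟨k, hk⟩
      refine hpl k ?_
      rw [hk]; field_simp
    have hs := hasSum_inv_exp_sub_one hw
    have hpe : 2 * Real.pi * Complex.I * (p / (2 * Real.pi * Complex.I)) = p := by field_simp
    have hE := exp_two_pi_I_mul_ne_one hw
    rw [hpe] at hs hE
    have hTs : HasSum (fun l => T l p) (1 / (Complex.exp p - 1) + 1 / 2) := by
      refine hs.congr_fun fun k => ?_
      have := hpl k
      have h4 : p - 2 * Real.pi * Complex.I * k ≠ 0 := sub_ne_zero.2 this
      simp only [hT]
      have e : p / (2 * Real.pi * Complex.I) - k =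
        (p - 2 * Real.pi * Complex.I * k) / (2 * Real.pi * Complex.I) := by field_simp
      rw [e, one_div_div, add_div]
      congr 1
      · field_simp
      · rw [div_div, mul_comm]
    have hS' : HasSum (fun l => if l ∈ S then T l p else 0) (∑ l ∈ S, T l p) := by
      have e : ∑ l ∈ S, T l p = ∑ l ∈ S, if l ∈ S then T l p else 0 :=
        Finset.sum_congr rfl fun l hl => (if_pos hl).symm
      rw [e]
      exact hasSum_sum_of_ne_finset_zero fun l hl => if_neg hl
    have hT's : HasSum (fun l => T' l p) (1 / (Complex.exp p - 1) + 1 / 2 - ∑ l ∈ S, T l p) := by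
      refine (hTs.sub hS').congr_fun fun l => ?_
      simp only [hT']
      split_ifs <;> simp
    beta_reduce
    rw [hT's.tsum_eq]
    -- This is where the residue −1 at each pole comes from; it cancels the minus sign of `logBorel`
    -- later.
    have e2 : geomExp p = -1 - 1 / (Complex.exp p - 1) := by
      have : 1 - Complex.exp p ≠ 0 := by rw [← neg_sub]; exact neg_ne_zero.2 hE
      rw [geomExp]; field_simp; ring
    rw [e2]
    simp only [hT, Finset.sum_add_distrib]
    ring

/-! ### Expansion of (q − Λ)/(qⁿ − 1) through roots of unity -/

open Polynomial in
theorem sum_nthRootsFinset_div_sub {n : ℕ} (hn : 0 < n) {q : ℂ} (hq : q ^ n ≠ 1) :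
    1 / (q ^ n - 1) = 1 / n * ∑ ζ ∈ nthRootsFinset n (1 : ℂ), ζ / (q - ζ) := by
  classical
  have hq' : q ^ n - 1 ≠ 0 := sub_ne_zero.2 hq
  have hn' : (n : ℂ) ≠ 0 := by exact_mod_cast hn.ne'
  have hprim := Complex.isPrimitiveRoot_exp n hn.ne'
  have hval : (nthRootsFinset n (1 : ℂ)).val = nthRoots n (1 : ℂ) := by
    rw [nthRootsFinset_def, Multiset.toFinset_val, (hprim.nthRoots_one_nodup).dedup]
  have hcard : (nthRootsFinset n (1 : ℂ)).card = n := hprim.card_nthRootsFinset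
  have h1 := (IsAlgClosed.splits (X ^ n - C (1 : ℂ))).eval_derivative_div_eval_of_ne_zero
    (x := q) (by simpa using hq')
  have h2 : ((X ^ n - C (1 : ℂ)).roots.map fun z => 1 / (q - z)).sum =
      ∑ ζ ∈ nthRootsFinset n (1 : ℂ), 1 / (q - ζ) := by
    rw [Finset.sum, hval]; rfl
  rw [h2] at h1
  simp only [derivative_sub, derivative_X_pow, derivative_C, sub_zero, eval_mul, eval_C,
    eval_pow, eval_X, eval_sub] at h1
  have hne : ∀ ζ ∈ nthRootsFinset n (1 : ℂ), q - ζ ≠ 0 := by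
    intro ζ hζ h
    rw [mem_nthRootsFinset hn] at hζ
    rw [sub_eq_zero.1 h] at hq
    exact hq hζ
  have h3 : ∑ ζ ∈ nthRootsFinset n (1 : ℂ), ζ / (q - ζ) =
      q * ∑ ζ ∈ nthRootsFinset n (1 : ℂ), 1 / (q - ζ) - n := by
    have : (n : ℂ) = ∑ _ζ ∈ nthRootsFinset n (1 : ℂ), (1 : ℂ) := by simp [hcard]
    rw [this, Finset.mul_sum, ← Finset.sum_sub_distrib]
    refine Finset.sum_congr rfl fun ζ hζ => ?_
    have := hne ζ hζ
    field_simp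
    ring
  rw [h3, ← h1]
  have h4 : q * (n * q ^ (n - 1) / (q ^ n - 1)) = n * q ^ n / (q ^ n - 1) := by
    rw [← mul_div_assoc]
    congr 1
    rw [mul_left_comm, mul_pow_sub_one hn.ne']
  rw [h4]
  field_simp
  ring

/-- The powers of x sum to 0, so N = −∑(xᵏ − 1) over k < N, and |xᵏ − 1| ≤ N|x − 1|. Only the linear
order in N matters: it makes the k-th coefficient O((mn)ᵏ), hence the Gevrey order one. -/
theorem one_le_mul_norm_sub_one {x : ℂ} {N : ℕ} (hN : 0 < N) (hx : x ^ N = 1) (h1 : x ≠ 1) :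
    1 ≤ N * ‖x - 1‖ := by
  have hnx : ‖x‖ = 1 := Complex.norm_eq_one_of_pow_eq_one hx hN.ne'
  have h0 : ∑ k ∈ Finset.range N, x ^ k = 0 := by
    rw [geom_sum_eq h1, hx]; simp
  have h2 : (N : ℂ) = -∑ k ∈ Finset.range N, (x ^ k - 1) := by
    rw [Finset.sum_sub_distrib, h0]; simp
  have h3 : ∀ k ∈ Finset.range N, ‖x ^ k - 1‖ ≤ N * ‖x - 1‖ := by
    intro k hk
    rw [← mul_geom_sum, norm_mul, mul_comm]
    gcongr
    refine (norm_sum_le _ _).trans ?_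
    simp only [norm_pow, hnx, one_pow, Finset.sum_const, Finset.card_range, nsmul_eq_mul, mul_one]
    exact_mod_cast (Finset.mem_range.1 hk).le
  have h4 : (N : ℝ) ≤ N * (N * ‖x - 1‖) := by
    have := norm_sum_le_of_le _ h3
    rw [Finset.sum_const, Finset.card_range, nsmul_eq_mul, ← norm_neg, ← h2,
      Complex.norm_natCast] at this
    exact this
  have hN' : (0 : ℝ) < N := by exact_mod_cast hN
  nlinarith

/-- The coefficients of the expansion of `ζ (q - Λ) / (q - ζ)` in powers of `q - Λ`. -/
noncomputable def rootCoeff (Λ ζ : ℂ) (k : ℕ) : ℂ :=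
  if ζ = Λ then (if k = 0 then Λ else 0) else (if k = 0 then 0 else -ζ / (ζ - Λ) ^ k)

/-- The coefficients of the expansion of `(q - Λ) / (q ^ n - 1)` in powers of `q - Λ`. -/
noncomputable def stepCoeff (Λ : ℂ) (n k : ℕ) : ℂ :=
  1 / n * ∑ ζ ∈ Polynomial.nthRootsFinset n (1 : ℂ), rootCoeff Λ ζ k

theorem norm_rootCoeff_le {Λ ζ : ℂ} (hΛ : ‖Λ‖ = 1) (hζ : ‖ζ‖ = 1) {ν : ℝ} (hν : 1 ≤ ν)
    (hd : ζ ≠ Λ → 1 ≤ ν * ‖ζ - Λ‖) (k : ℕ) : ‖rootCoeff Λ ζ k‖ ≤ ν ^ k := by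
  have h1 : (1 : ℝ) ≤ ν ^ k := one_le_pow₀ hν
  unfold rootCoeff
  split_ifs with h1 h2 h2
  · simp [hΛ, h2]
  · simp; positivity
  · simp; positivity
  · have hpos : 0 < ‖ζ - Λ‖ := norm_pos_iff.2 (sub_ne_zero.2 h1)
    rw [norm_div, norm_neg, hζ, norm_pow, div_le_iff₀ (by positivity), ← mul_pow]
    exact one_le_pow₀ (hd h1)

/-- If q is closer to Λ than half of |ζ − Λ|, then |q − ζ| ≥ |q − Λ|. Otherwise |q − Λ| > 1/(2ν),
while the tangency condition gives |q − ζ| ≥ ||q| − 1| ≥ |q − Λ|²/2; together |q − Λ| ≤ 4ν|q − ζ|.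
-/
theorem norm_mul_div_sub_le {Λ ζ q : ℂ} (hζ : ‖ζ‖ = 1) {ν : ℝ}
    (hν : 1 ≤ ν) (hd : ζ ≠ Λ → 1 ≤ ν * ‖ζ - Λ‖) (hq : ‖q‖ ≠ 1)
    (hqΛ : ‖q - Λ‖ ^ 2 ≤ 2 * |‖q‖ - 1|) : ‖(q - Λ) / (q - ζ)‖ ≤ 4 * ν := by
  have hqζ : q - ζ ≠ 0 := by
    intro h; rw [sub_eq_zero.1 h] at hq; exact hq hζ
  have hpos : 0 < ‖q - ζ‖ := norm_pos_iff.2 hqζ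
  by_cases hζΛ : ζ = Λ
  · rw [← hζΛ, div_self hqζ]; simp; linarith
  have hd' := hd hζΛ
  have hdpos : 0 < ‖ζ - Λ‖ := norm_pos_iff.2 (sub_ne_zero.2 hζΛ)
  rw [norm_div, div_le_iff₀ hpos]
  by_cases hc : ‖q - Λ‖ ≤ ‖ζ - Λ‖ / 2
  · have : ‖ζ - Λ‖ - ‖q - Λ‖ ≤ ‖q - ζ‖ := by
      have := norm_sub_norm_le (ζ - Λ) (q - Λ)
      rw [sub_sub_sub_cancel_right, norm_sub_rev ζ q] at this
      exact this
    nlinarith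
  · push Not at hc
    have h1 : |‖q‖ - 1| ≤ ‖q - ζ‖ := by
      have := abs_norm_sub_norm_le q ζ; rwa [hζ] at this
    have h2 : ‖q - Λ‖ ^ 2 ≤ 2 * ‖q - ζ‖ := by linarith
    have hQ : 0 < ‖q - Λ‖ := by linarith
    have h3 : 1 ≤ 2 * ν * ‖q - Λ‖ := by nlinarith
    nlinarith

/-- The remainder of a geometric series of ratio (q − Λ)/(ζ − Λ) is explicit. Its last factor (ζ −
Λ)/(q − ζ) = (q − Λ)/(q − ζ) − 1 costs at most 5ν. -/
theorem norm_root_remainder_le {Λ ζ q : ℂ} (hζ : ‖ζ‖ = 1) {ν : ℝ}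
    (hν : 1 ≤ ν) (hd : ζ ≠ Λ → 1 ≤ ν * ‖ζ - Λ‖) (hq : ‖q‖ ≠ 1)
    (hqΛ : ‖q - Λ‖ ^ 2 ≤ 2 * |‖q‖ - 1|) (N : ℕ) :
    ‖(q - Λ) * (ζ / (q - ζ)) - ∑ k ∈ Finset.range N, (q - Λ) ^ k * rootCoeff Λ ζ k‖ ≤
      5 * ν * (ν ^ N * ‖q - Λ‖ ^ N) := by
  have hb := norm_mul_div_sub_le hζ hν hd hq hqΛ
  have hqζ : q - ζ ≠ 0 := by
    intro h; rw [sub_eq_zero.1 h] at hq; exact hq hζ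
  -- The closed form of the remainder fails at N = 0, because for ζ ≠ Λ the geometric series starts
  -- at k = 1.
  rcases Nat.eq_zero_or_pos N with rfl | hN
  · simp only [Finset.range_zero, Finset.sum_empty, sub_zero, pow_zero, mul_one]
    rw [show (q - Λ) * (ζ / (q - ζ)) = ζ * ((q - Λ) / (q - ζ)) by ring, norm_mul, hζ]
    linarith
  obtain ⟨M, rfl⟩ := Nat.exists_eq_add_of_le hN
  by_cases hζΛ : ζ = Λ
  · have : ∑ k ∈ Finset.range (0 + 1 + M), (q - Λ) ^ k * rootCoeff Λ ζ k = Λ := by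
      rw [Finset.sum_eq_single 0]
      · simp [rootCoeff, hζΛ]
      · intro k _ hk; simp [rootCoeff, hζΛ, hk]
      · intro h; simp at h
    rw [this, hζΛ]
    rw [hζΛ] at hqζ
    rw [show (q - Λ) * (Λ / (q - Λ)) - Λ = 0 by field_simp; ring, norm_zero]
    positivity
  have hd0 : ζ - Λ ≠ 0 := sub_ne_zero.2 hζΛ
  have hdpos : 0 < ‖ζ - Λ‖ := norm_pos_iff.2 hd0
  have hid : (q - Λ) * (ζ / (q - ζ)) -
      ∑ k ∈ Finset.range (0 + 1 + M), (q - Λ) ^ k * rootCoeff Λ ζ k =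
      ζ * ((q - Λ) / (ζ - Λ)) ^ (0 + 1 + M) * ((ζ - Λ) / (q - ζ)) := by
    clear hN
    induction M with
    | zero =>
      simp only [rootCoeff, hζΛ, if_false, Finset.sum_range_succ, Finset.range_zero,
        Finset.sum_empty, add_zero, zero_add, if_true, mul_zero, pow_one, sub_zero]
      field_simp
    | succ M ih =>
      rw [← add_assoc, Finset.sum_range_succ, ← sub_sub, ih]
      simp only [rootCoeff, hζΛ, if_false]
      rw [if_neg (by omega), pow_succ, div_pow]
      field_simp
      ring
  rw [hid, norm_mul, norm_mul, hζ, one_mul, norm_pow]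
  have h1 : ‖(q - Λ) / (ζ - Λ)‖ ≤ ν * ‖q - Λ‖ := by
    rw [norm_div, div_le_iff₀ hdpos]
    nlinarith [norm_nonneg (q - Λ), hd hζΛ]
  have h2 : ‖(ζ - Λ) / (q - ζ)‖ ≤ 5 * ν := by
    have : (ζ - Λ) / (q - ζ) = (q - Λ) / (q - ζ) - 1 := by field_simp; ring
    rw [this]
    refine (norm_sub_le _ _).trans ?_
    rw [norm_one]; linarith
  rw [mul_comm, ← mul_pow]
  gcongr

section Resonance

variable {m : ℕ} {Λ : ℂ}

/-- The quotient ζ/Λ is a root of unity of order dividing mn, different from 1. -/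
theorem root_separation (hm : 0 < m) (hΛ : Λ ^ m = 1) {n : ℕ} (hn : 0 < n) {ζ : ℂ}
    (hζ : ζ ^ n = 1) (h : ζ ≠ Λ) : 1 ≤ ((m * n : ℕ) : ℝ) * ‖ζ - Λ‖ := by
  have hΛn : ‖Λ‖ = 1 := Complex.norm_eq_one_of_pow_eq_one hΛ hm.ne'
  have hΛ0 : Λ ≠ 0 := by rw [← norm_pos_iff, hΛn]; exact one_pos
  have h1 := one_le_mul_norm_sub_one (x := ζ / Λ) (N := m * n) (by positivity)
    (by rw [div_pow, pow_mul Λ, hΛ, mul_comm m n, pow_mul, hζ]; simp)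
    (by rw [Ne, div_eq_one_iff_eq hΛ0]; exact h)
  have h2 : ζ / Λ - 1 = (ζ - Λ) / Λ := by field_simp
  rwa [h2, norm_div, hΛn, div_one] at h1

theorem norm_average_le {n : ℕ} (hn : 0 < n) {f : ℂ → ℂ} {B : ℝ}
    (hf : ∀ ζ ∈ Polynomial.nthRootsFinset n (1 : ℂ), ‖f ζ‖ ≤ B) :
    ‖1 / (n : ℂ) * ∑ ζ ∈ Polynomial.nthRootsFinset n (1 : ℂ), f ζ‖ ≤ B := by
  have hn' : (0 : ℝ) < n := by exact_mod_cast hn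
  have := norm_sum_le_of_le _ hf
  rw [Finset.sum_const, (Complex.isPrimitiveRoot_exp n hn.ne').card_nthRootsFinset,
    nsmul_eq_mul] at this
  rw [norm_mul, norm_div, norm_one, Complex.norm_natCast, one_div, inv_mul_le_iff₀ hn']
  exact this

theorem norm_stepCoeff_le (hm : 0 < m) (hΛ : Λ ^ m = 1) {n : ℕ} (hn : 0 < n) (k : ℕ) :
    ‖stepCoeff Λ n k‖ ≤ ((m * n : ℕ) : ℝ) ^ k := by
  refine norm_average_le hn fun ζ hζ => ?_
  rw [Polynomial.mem_nthRootsFinset hn] at hζ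
  refine norm_rootCoeff_le (Complex.norm_eq_one_of_pow_eq_one hΛ hm.ne')
    (Complex.norm_eq_one_of_pow_eq_one hζ hn.ne') ?_ (root_separation hm hΛ hn hζ) k
  exact_mod_cast Nat.mul_pos hm hn

theorem pow_ne_one_of_norm_ne_one {q : ℂ} (hq : ‖q‖ ≠ 1) {n : ℕ} (hn : 0 < n) : q ^ n ≠ 1 :=
  fun h => hq (Complex.norm_eq_one_of_pow_eq_one h hn.ne')

theorem norm_step_remainder_le (hm : 0 < m) (hΛ : Λ ^ m = 1) {n : ℕ} (hn : 0 < n) {q : ℂ}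
    (hq : ‖q‖ ≠ 1) (hqΛ : ‖q - Λ‖ ^ 2 ≤ 2 * |‖q‖ - 1|) (N : ℕ) :
    ‖(q - Λ) / (q ^ n - 1) - ∑ k ∈ Finset.range N, (q - Λ) ^ k * stepCoeff Λ n k‖ ≤
      5 * ((m * n : ℕ) : ℝ) * (((m * n : ℕ) : ℝ) ^ N * ‖q - Λ‖ ^ N) := by
  have h1 : (q - Λ) / (q ^ n - 1) - ∑ k ∈ Finset.range N, (q - Λ) ^ k * stepCoeff Λ n k =
      1 / (n : ℂ) * ∑ ζ ∈ Polynomial.nthRootsFinset n (1 : ℂ), ((q - Λ) * (ζ / (q - ζ)) -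
        ∑ k ∈ Finset.range N, (q - Λ) ^ k * rootCoeff Λ ζ k) := by
    rw [div_eq_mul_one_div, sum_nthRootsFinset_div_sub hn (pow_ne_one_of_norm_ne_one hq hn),
      Finset.sum_sub_distrib, Finset.sum_comm, mul_sub]
    congr 1
    · rw [← Finset.mul_sum]; ring
    · rw [Finset.mul_sum]
      refine Finset.sum_congr rfl fun k _ => ?_
      rw [stepCoeff, ← Finset.mul_sum]; ring
  rw [h1]
  refine norm_average_le hn fun ζ hζ => ?_
  rw [Polynomial.mem_nthRootsFinset hn] at hζ
  refine norm_root_remainder_le (Complex.norm_eq_one_of_pow_eq_one hζ hn.ne') ?_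
    (root_separation hm hΛ hn hζ) hq hqΛ N
  exact_mod_cast Nat.mul_pos hm hn

end Resonance

/-! ### Tangent disks -/

theorem norm_sub_real_mul_sq {Λ : ℂ} (hΛ : ‖Λ‖ = 1) (q : ℂ) (c : ℝ) :
    ‖q - c * Λ‖ ^ 2 = ‖q‖ ^ 2 - 2 * c * inner ℝ q Λ + c ^ 2 := by
  have : (c : ℂ) * Λ = c • Λ := by simp
  rw [this, norm_sub_sq_real, real_inner_smul_right, norm_smul, hΛ]
  simp; ring

/-- Membership in the disk reads |q|² < Re(q·conj Λ), so |q − Λ|² < 1 − |q|² ≤ 2(1 − |q|). -/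
theorem tangent_inside {Λ : ℂ} (hΛ : ‖Λ‖ = 1) {q : ℂ}
    (hq : q ∈ ball ((1 - ((1 / 2 : ℝ) : ℂ)) * Λ) (1 / 2)) :
    ‖q‖ ≠ 1 ∧ ‖q - Λ‖ ^ 2 ≤ 2 * |‖q‖ - 1| := by
  rw [mem_ball, dist_eq_norm] at hq
  have e : ((1 - ((1 / 2 : ℝ) : ℂ)) * Λ) = ((1 / 2 : ℝ) : ℂ) * Λ := by push_cast; ring
  rw [e] at hq
  have h1 := norm_sub_real_mul_sq hΛ q (1 / 2)
  have h2 := norm_sub_real_mul_sq hΛ q 1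
  rw [Complex.ofReal_one, one_mul] at h2
  have h3 : ‖q - ((1 / 2 : ℝ) : ℂ) * Λ‖ ^ 2 < (1 / 2) ^ 2 :=
    pow_lt_pow_left₀ hq (norm_nonneg _) (by norm_num)
  have hq0 := norm_nonneg q
  have h5 := sq_nonneg ‖q - Λ‖
  have h4 : ‖q‖ < 1 := by nlinarith
  refine ⟨h4.ne, ?_⟩
  rw [abs_of_neg (by linarith)]
  nlinarith

/-- Expanding the square as for the inner disk gives |q − Λ|² < (|q|² − 1)/3, and |q| < 2 bounds the
factor |q| + 1. -/
theorem tangent_outside {Λ : ℂ} (hΛ : ‖Λ‖ = 1) {q : ℂ}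
    (hq : q ∈ ball ((1 + ((1 / 2 : ℝ) : ℂ)) * Λ) (1 / 2)) :
    ‖q‖ ≠ 1 ∧ ‖q - Λ‖ ^ 2 ≤ 2 * |‖q‖ - 1| := by
  rw [mem_ball, dist_eq_norm] at hq
  have e : ((1 + ((1 / 2 : ℝ) : ℂ)) * Λ) = ((3 / 2 : ℝ) : ℂ) * Λ := by push_cast; ring
  rw [e] at hq
  have h1 := norm_sub_real_mul_sq hΛ q (3 / 2)
  have h2 := norm_sub_real_mul_sq hΛ q 1
  rw [Complex.ofReal_one, one_mul] at h2
  have h3 : ‖q - ((3 / 2 : ℝ) : ℂ) * Λ‖ ^ 2 < (1 / 2) ^ 2 :=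
    pow_lt_pow_left₀ hq (norm_nonneg _) (by norm_num)
  have hq0 := norm_nonneg q
  have h5 := sq_nonneg ‖q - Λ‖
  have h4 : 1 < ‖q‖ := by nlinarith
  have h6 : ‖q‖ < 2 := by
    have := norm_sub_norm_le q (((3 / 2 : ℝ) : ℂ) * Λ)
    rw [norm_mul, hΛ, Complex.norm_real] at this
    norm_num at this
    norm_num at hq
    linarith
  refine ⟨h4.ne', ?_⟩
  rw [abs_of_pos (by linarith)]
  nlinarith

/-! ### The Banach space B_r -/

open BoundedContinuousFunction

/-- Uniform limits of holomorphic functions are holomorphic. Closedness gives completeness, which is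
needed to sum series of monomials in B_r. -/
theorem isClosed_Br {r : ℝ} (hr : 0 < r) : IsClosed (Br r : Set (ball (0 : ℂ) r →ᵇ ℂ)) := by
  classical
  rw [← isSeqClosed_iff_isClosed]
  intro f f₀ hf hlim
  choose g hgd hg0 hgf using hf
  have h0 : (0 : ℂ) ∈ ball (0 : ℂ) r := mem_ball_self hr
  set g₀ : ℂ → ℂ := fun x => if h : x ∈ ball (0 : ℂ) r then f₀ ⟨x, h⟩ else 0 with hg₀
  have hval : ∀ x : ball (0 : ℂ) r, g₀ x = f₀ x := fun x => dif_pos x.2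
  have hunif : TendstoUniformlyOn g g₀ atTop (ball 0 r) := by
    rw [Metric.tendstoUniformlyOn_iff]
    intro ε hε
    filter_upwards [(Metric.tendsto_nhds.1 hlim) ε hε] with k hk x hx
    have e1 := hval ⟨x, hx⟩
    have e2 := hgf k ⟨x, hx⟩
    simp only at e1 e2
    rw [e1, ← e2, dist_comm]
    exact (dist_coe_le_dist _).trans_lt hk
  refine ⟨g₀, hunif.tendstoLocallyUniformlyOn.differentiableOn
    (Eventually.of_forall hgd) isOpen_ball, ?_, fun x => (hval x).symm⟩
  have := hunif.tendsto_at h0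
  simp only [hg0] at this
  exact tendsto_nhds_unique this tendsto_const_nhds

theorem completeSpace_Br {r : ℝ} (hr : 0 < r) : CompleteSpace (Br r) :=
  (isClosed_Br hr).completeSpace_coe

theorem norm_coe_pow_le {r : ℝ} (n : ℕ) (x : ball (0 : ℂ) r) : ‖(x : ℂ) ^ n‖ ≤ r ^ n := by
  have : ‖(x : ℂ)‖ < r := mem_ball_zero_iff.1 x.2
  rw [norm_pow]
  exact pow_le_pow_left₀ (norm_nonneg _) this.le n

/-- The monomial `z ^ (n + 1)`, as an element of `B_r`. -/
noncomputable def monomialBr (r : ℝ) (n : ℕ) : Br r :=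
  ⟨BoundedContinuousFunction.ofNormedAddCommGroup (fun x : ball (0 : ℂ) r => (x : ℂ) ^ (n + 1))
    (by fun_prop) (r ^ (n + 1)) (norm_coe_pow_le (n + 1)),
    fun z => z ^ (n + 1), by fun_prop, by simp, fun _ => rfl⟩

theorem norm_monomialBr_le {r : ℝ} (hr : 0 < r) (n : ℕ) : ‖monomialBr r n‖ ≤ r ^ (n + 1) :=
  BoundedContinuousFunction.norm_ofNormedAddCommGroup_le _ (by positivity)
    (norm_coe_pow_le (n + 1))

/-- Evaluation at a point of the disk, as a continuous linear form on `B_r`. -/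
noncomputable def evalBr (r : ℝ) (x : ball (0 : ℂ) r) : Br r →L[ℂ] ℂ :=
  (BoundedContinuousFunction.evalCLM ℂ x).comp (Br r).subtypeL

theorem evalBr_apply {r : ℝ} (x : ball (0 : ℂ) r) (f : Br r) : evalBr r x f = f.1 x := rfl

theorem norm_apply_le {r : ℝ} (x : ball (0 : ℂ) r) (f : Br r) : ‖f.1 x‖ ≤ ‖f‖ :=
  f.1.norm_coe_le_norm x

/-! ### The Gevrey-1 expansion: existence and uniqueness -/

theorem pow_le_factorial_mul_exp {η x : ℝ} (hη : 0 < η) (hx : 0 ≤ x) (k : ℕ) :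
    x ^ k ≤ (k.factorial : ℝ) * (1 / η) ^ k * Real.exp (η * x) := by
  have h := Real.pow_div_factorial_le_exp (η * x) (by positivity) k
  rw [div_le_iff₀ (by positivity), mul_pow] at h
  rw [one_div, inv_pow]
  have : 0 < η ^ k := by positivity
  field_simp
  linarith

/-- Gevrey-1 growth of the moments of a geometric sequence. -/
theorem exists_moment_bound {r : ℝ} (hr : 0 < r) (hr1 : r < 1) :
    ∃ (η : ℝ) (v : ℕ → ℝ), 0 < η ∧ Summable v ∧ (∀ n, 0 < v n) ∧ ∀ k n : ℕ,
      ((n + 1 : ℕ) : ℝ) ^ k * r ^ (n + 1) ≤ (k.factorial : ℝ) * (1 / η) ^ k * v n := by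
  have hlog : Real.log r < 0 := Real.log_neg hr hr1
  have he : Real.exp (Real.log r / 2) < 1 := by
    rw [← Real.exp_zero]
    exact Real.exp_lt_exp.2 (by linarith)
  -- Half of the decay of rⁿ⁺¹ = exp((n + 1) log r) absorbs the power of n + 1; the other half is
  -- kept as the summable v.
  refine ⟨-Real.log r / 2, fun n => Real.exp (Real.log r / 2) ^ (n + 1), by linarith,
    ((summable_geometric_of_lt_one (Real.exp_pos _).le he).comp_injective
      (add_left_injective 1)), fun n => by positivity, fun k n => ?_⟩
  have h := pow_le_factorial_mul_exp (η := -Real.log r / 2) (by linarith)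
    (Nat.cast_nonneg (n + 1)) k
  refine (mul_le_mul_of_nonneg_right h (by positivity)).trans (le_of_eq ?_)
  rw [mul_assoc]
  congr 1
  beta_reduce
  rw [← Real.exp_nat_mul]
  nth_rewrite 2 [← Real.exp_log hr]
  rw [← Real.exp_nat_mul, ← Real.exp_add]
  congr 1
  ring

/-- The coefficients of the expansion of `(q - Λ) f_δ(q, z)` in powers of `q - Λ`. -/
noncomputable def expansionCoeff (Λ : ℂ) (k : ℕ) (z : ℂ) : ℂ :=
  ∑' n : ℕ, stepCoeff Λ (n + 1) k * z ^ (n + 1)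

section Expansion

variable {m : ℕ} {Λ : ℂ}

theorem abs_sub_one_le_abs_pow_sub_one {x : ℝ} (hx : 0 ≤ x) (n : ℕ) :
    |x - 1| ≤ |x ^ (n + 1) - 1| := by
  rw [← mul_geom_sum, abs_mul]
  refine le_mul_of_one_le_right (abs_nonneg _) ?_
  rw [Finset.sum_range_succ']
  have : 0 ≤ ∑ k ∈ Finset.range n, x ^ (k + 1) := Finset.sum_nonneg fun k _ => by positivity
  rw [abs_of_nonneg (by positivity)]
  simpa using this

theorem summable_norm_smul_of_le {B : Type*} [NormedAddCommGroup B] [NormedSpace ℂ B] {r : ℝ}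
    {e : ℕ → B} (he : ∀ n, ‖e n‖ ≤ r ^ (n + 1)) {c : ℕ → ℂ}
    (hc : Summable fun n => ‖c n‖ * r ^ (n + 1)) : Summable fun n => ‖c n • e n‖ := by
  refine hc.of_nonneg_of_le (fun _ => norm_nonneg _) fun n => ?_
  rw [norm_smul]
  exact mul_le_mul_of_nonneg_left (he n) (norm_nonneg _)

theorem tsum_smul_monomialBr_apply {r : ℝ} (hr : 0 < r) {c : ℕ → ℂ}
    (hc : Summable fun n => ‖c n‖ * r ^ (n + 1)) (x : ball (0 : ℂ) r) :
    (∑' n, c n • monomialBr r n : Br r).1 x = ∑' n, c n * (x : ℂ) ^ (n + 1) := by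
  have := completeSpace_Br hr
  have h := (summable_norm_smul_of_le (norm_monomialBr_le hr) hc).of_norm.hasSum.mapL (evalBr r x)
  rw [← evalBr_apply, ← h.tsum_eq]
  rfl

theorem summable_fDelta_coeff {r : ℝ} (hr : 0 < r) (hr1 : r < 1) {q : ℂ} (hq : ‖q‖ ≠ 1) :
    Summable fun n : ℕ => ‖(q - Λ) / (q ^ (n + 1) - 1)‖ * r ^ (n + 1) := by
  have hpos : 0 < |‖q‖ - 1| := abs_pos.2 (sub_ne_zero.2 hq)
  refine Summable.of_nonneg_of_le (fun n => by positivity) (fun n => ?_)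
    ((((summable_geometric_of_lt_one hr.le hr1).comp_injective (add_left_injective 1))).mul_left
      (‖q - Λ‖ / |‖q‖ - 1|))
  simp only [Function.comp_apply]
  gcongr
  rw [norm_div]
  refine div_le_div_of_nonneg_left (norm_nonneg _) hpos ?_
  refine (abs_sub_one_le_abs_pow_sub_one (norm_nonneg q) n).trans ?_
  have := abs_norm_sub_norm_le (q ^ (n + 1)) 1
  rwa [norm_pow, norm_one] at this

theorem summable_stepCoeff (hm : 0 < m) (hΛ : Λ ^ m = 1) {r : ℝ} (hr : 0 < r) (hr1 : r < 1)
    (k : ℕ) : Summable fun n : ℕ => ‖stepCoeff Λ (n + 1) k‖ * r ^ (n + 1) := by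
  obtain ⟨η, v, hη, hv, hv0, hb⟩ := exists_moment_bound hr hr1
  refine Summable.of_nonneg_of_le (fun n => by positivity) (fun n => ?_)
    (hv.mul_left ((m : ℝ) ^ k * ((k.factorial : ℝ) * (1 / η) ^ k)))
  have h1 := norm_stepCoeff_le hm hΛ n.succ_pos k
  refine (mul_le_mul_of_nonneg_right h1 (by positivity)).trans ?_
  rw [Nat.cast_mul, mul_pow, mul_assoc, mul_assoc]
  exact mul_le_mul_of_nonneg_left (hb k n) (by positivity)

/-- The remainders of the single terms are summed against rⁿ⁺¹ with the moment bound, which converts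
powers of n into factorials. -/
theorem hasGevreyOneExpansionOn_tsum {B : Type*} [NormedAddCommGroup B] [NormedSpace ℂ B]
    [CompleteSpace B] (hm : 0 < m) (hΛ : Λ ^ m = 1) {r : ℝ} (hr : 0 < r)
    (hr1 : r < 1) {e : ℕ → B} (he : ∀ n, ‖e n‖ ≤ r ^ (n + 1)) {Δ : Set ℂ} (hΔo : IsOpen Δ)
    (hΔ : ∀ q ∈ Δ, ‖q‖ ≠ 1 ∧ ‖q - Λ‖ ^ 2 ≤ 2 * |‖q‖ - 1|) :
    HasGevreyOneExpansionOn Λ Δ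
      (fun q => ∑' n : ℕ, ((q - Λ) / (q ^ (n + 1) - 1)) • e n)
      (fun k => ∑' n : ℕ, stepCoeff Λ (n + 1) k • e n) := by
  obtain ⟨η, v, hη, hv, hv0, hb⟩ := exists_moment_bound hr hr1
  have hm' : (0 : ℝ) < m := by exact_mod_cast hm
  have hV : 0 < ∑' n, v n := hv.tsum_pos (fun n => (hv0 n).le) 0 (hv0 0)
  have key : ∀ (N n : ℕ), ∀ q ∈ Δ, ‖((q - Λ) / (q ^ (n + 1) - 1) -
      ∑ k ∈ Finset.range N, (q - Λ) ^ k * stepCoeff Λ (n + 1) k) • e n‖ ≤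
      (5 * m / η * (2 * m / η) ^ N * (N.factorial : ℝ) * ‖q - Λ‖ ^ N) * v n := by
    intro N n q hq
    rw [norm_smul]
    have h1 := norm_step_remainder_le hm hΛ n.succ_pos (hΔ q hq).1 (hΔ q hq).2 N
    refine (mul_le_mul h1 (he n) (norm_nonneg _) (by positivity)).trans ?_
    -- The exponent is N + 1 because the single-term remainder carries an extra factor mn; (N + 1)!
    -- ≤ 2ᴺN! restores N! at the cost of doubling c₁.
    have h2 := hb (N + 1) n
    have h3 : ((N + 1).factorial : ℝ) ≤ 2 ^ N * (N.factorial : ℝ) := by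
      rw [Nat.factorial_succ]
      have : N + 1 ≤ 2 ^ N := Nat.lt_two_pow_self
      exact_mod_cast Nat.mul_le_mul_right _ this
    have h4 : ((n + 1 : ℕ) : ℝ) ^ (N + 1) * r ^ (n + 1) ≤
        (2 ^ N * (N.factorial : ℝ)) * (1 / η) ^ (N + 1) * v n := by
      refine h2.trans ?_
      have := hv0 n
      gcongr
    calc 5 * ((m * (n + 1) : ℕ) : ℝ) * (((m * (n + 1) : ℕ) : ℝ) ^ N * ‖q - Λ‖ ^ N) * r ^ (n + 1)
        = (5 * m * m ^ N * ‖q - Λ‖ ^ N) * (((n + 1 : ℕ) : ℝ) ^ (N + 1) * r ^ (n + 1)) := by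
          rw [Nat.cast_mul, mul_pow, pow_succ ((n + 1 : ℕ) : ℝ)]; ring
      _ ≤ (5 * m * m ^ N * ‖q - Λ‖ ^ N) *
          ((2 ^ N * (N.factorial : ℝ)) * (1 / η) ^ (N + 1) * v n) := by gcongr
      _ = _ := by
          rw [div_pow, div_pow, mul_pow, pow_succ η, one_pow]
          field_simp
  refine ⟨?_, 5 * m / η * ∑' n, v n, by positivity, 2 * m / η, by positivity, fun N q hq => ?_⟩
  -- The case N = 0 of `key` bounds the terms uniformly in q, so the Weierstrass theorem applies.
  · refine Complex.differentiableOn_tsum_of_summable_norm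
      (u := fun n => (5 * m / η * (2 * m / η) ^ 0 * (Nat.factorial 0 : ℝ) * 1) * v n)
      (hv.mul_left _) (fun n => ?_) hΔo fun n q hq => by
        refine le_trans (le_of_eq ?_) ((key 0 n q hq).trans_eq ?_)
        · rw [Finset.range_zero, Finset.sum_empty, sub_zero]
        · rw [pow_zero ‖q - Λ‖]
    refine DifferentiableOn.smul_const (DifferentiableOn.div (by fun_prop) (by fun_prop)
      fun q hq => sub_ne_zero.2 (pow_ne_one_of_norm_ne_one (hΔ q hq).1 n.succ_pos)) _
  · have hs1 := (summable_norm_smul_of_le he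
      (summable_fDelta_coeff (Λ := Λ) hr hr1 (hΔ q hq).1)).of_norm.hasSum
    have hs2 : HasSum (fun n => ∑ k ∈ Finset.range N,
        (q - Λ) ^ k • stepCoeff Λ (n + 1) k • e n)
        (∑ k ∈ Finset.range N, (q - Λ) ^ k • ∑' n, stepCoeff Λ (n + 1) k • e n) :=
      hasSum_sum fun k _ => (summable_norm_smul_of_le he
        (summable_stepCoeff hm hΛ hr hr1 k)).of_norm.hasSum.const_smul _
    have hs3 := hs1.sub hs2
    rw [← hs3.tsum_eq]
    have hle : ∀ n, ‖((q - Λ) / (q ^ (n + 1) - 1)) • e n -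
        ∑ k ∈ Finset.range N, (q - Λ) ^ k • stepCoeff Λ (n + 1) k • e n‖ ≤
        (5 * m / η * (2 * m / η) ^ N * (N.factorial : ℝ) * ‖q - Λ‖ ^ N) * v n := by
      intro n
      refine le_trans (le_of_eq ?_) (key N n q hq)
      congr 1
      rw [sub_smul, Finset.sum_smul]
      simp only [smul_smul]
    refine (tsum_of_norm_bounded (hv.mul_left _).hasSum hle).trans (le_of_eq ?_)
    rw [tsum_mul_left]; ring

theorem isExpansionOfFDelta_expansionCoeff (hm : 0 < m) (hΛ : Λ ^ m = 1) :
    IsExpansionOfFDelta Λ (expansionCoeff Λ) := by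
  intro r hr hr1
  have hΛ1 : ‖Λ‖ = 1 := Complex.norm_eq_one_of_pow_eq_one hΛ hm.ne'
  have := completeSpace_Br hr
  refine ⟨fun q => ∑' n : ℕ, ((q - Λ) / (q ^ (n + 1) - 1)) • monomialBr r n,
    fun k => ∑' n : ℕ, stepCoeff Λ (n + 1) k • monomialBr r n, fun q hq x => ?_,
    fun k x => ?_, ⟨1 / 2, by norm_num, by norm_num, ?_⟩, ⟨1 / 2, by norm_num, ?_⟩⟩
  · rw [tsum_smul_monomialBr_apply hr (summable_fDelta_coeff hr hr1 hq), fDelta, ← tsum_mul_left]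
    exact tsum_congr fun n => by ring
  · rw [tsum_smul_monomialBr_apply hr (summable_stepCoeff hm hΛ hr hr1 k), expansionCoeff]
  · exact hasGevreyOneExpansionOn_tsum hm hΛ hr hr1 (norm_monomialBr_le hr) isOpen_ball fun q hq =>
      tangent_inside hΛ1 hq
  · exact hasGevreyOneExpansionOn_tsum hm hΛ hr hr1 (norm_monomialBr_le hr) isOpen_ball fun q hq =>
      tangent_outside hΛ1 hq

/-- The coefficients of the expansion are unique in the unit disk. -/
theorem isExpansionOfFDelta_unique (hΛ1 : ‖Λ‖ = 1) {a a' : ℕ → ℂ → ℂ}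
    (h : IsExpansionOfFDelta Λ a) (h' : IsExpansionOfFDelta Λ a') {z : ℂ} (hz : ‖z‖ < 1) (k : ℕ) :
    a k z = a' k z := by
  set r := (1 + ‖z‖) / 2 with hr
  have hr0 : 0 < r := by positivity
  have hzr : ‖z‖ < r := by rw [hr]; linarith
  set x : ball (0 : ℂ) r := ⟨z, by simpa using hzr⟩ with hx
  obtain ⟨F, A, hF, hA, ⟨ρ, hρ, hρ1, -, c₀, hc₀, c₁, hc₁, hb⟩, -⟩ :=
    h r hr0 (by rw [hr]; linarith)
  obtain ⟨F', A', hF', hA', ⟨ρ', hρ', hρ1', -, c₀', hc₀', c₁', hc₁', hb'⟩, -⟩ :=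
    h' r hr0 (by rw [hr]; linarith)
  have heval : ∀ (G : ℂ → Br r) (B : ℕ → Br r) (b : ℕ → ℂ → ℂ) (N : ℕ) (q : ℂ), ‖q‖ ≠ 1 →
      (∀ q : ℂ, ‖q‖ ≠ 1 → ∀ x : ball (0 : ℂ) r, (G q).1 x = (q - Λ) * fDelta q x) →
      (∀ n : ℕ, ∀ x : ball (0 : ℂ) r, (B n).1 x = b n x) →
      ‖(q - Λ) * fDelta q z - ∑ n ∈ Finset.range N, (q - Λ) ^ n * b n z‖ ≤
      ‖G q - ∑ n ∈ Finset.range N, (q - Λ) ^ n • B n‖ := by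
    intro G B b N q hq hG hB
    refine le_trans (le_of_eq ?_) (norm_apply_le x _)
    rw [← evalBr_apply, map_sub, map_sum]
    simp only [map_smul, evalBr_apply, hG q hq, hB, hx, smul_eq_mul]
  induction k using Nat.strong_induction_on with
  | _ k ih =>
    set C := c₀ * c₁ ^ (k + 1) * ((k + 1).factorial : ℝ) +
      c₀' * c₁' ^ (k + 1) * ((k + 1).factorial : ℝ) with hC
    have hkey : ∀ y : ℝ, 0 < y → y < min ρ ρ' → ‖a k z - a' k z‖ ≤ C * y := by
      intro y hy hyρ
      have hyρ1 := lt_of_lt_of_le hyρ (min_le_left _ _)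
      have hyρ2 := lt_of_lt_of_le hyρ (min_le_right _ _)
      -- On this radius q lies in both inner tangent disks and |q − Λ| = y. Comparing the two
      -- expansions up to order k, with equal lower coefficients, and letting y tend to 0 isolates
      -- the k-th coefficient.
      set q : ℂ := (1 - y) * Λ with hq
      have hqΛ : ‖q - Λ‖ = y := by
        rw [hq, show (1 - (y : ℂ)) * Λ - Λ = -(y * Λ) by ring, norm_neg, norm_mul, hΛ1,
          Complex.norm_real, Real.norm_of_nonneg hy.le, mul_one]
      have hmem : ∀ σ : ℝ, y < σ → q ∈ ball ((1 - (σ : ℂ)) * Λ) σ := by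
        intro σ hσ
        rw [mem_ball, dist_eq_norm, hq,
          show (1 - (y : ℂ)) * Λ - (1 - σ) * Λ = ((σ - y : ℝ) : ℂ) * Λ by push_cast; ring,
          norm_mul, hΛ1, Complex.norm_real, Real.norm_of_nonneg (by linarith)]
        linarith
      have hq1 : ‖q‖ ≠ 1 := by
        rw [hq, show (1 - (y : ℂ)) = ((1 - y : ℝ) : ℂ) by push_cast; ring, norm_mul, hΛ1,
          Complex.norm_real, Real.norm_of_nonneg (by linarith)]
        linarith
      have e1 := (heval F A a (k + 1) q hq1 hF hA).trans (hb (k + 1) q (hmem ρ hyρ1))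
      have e2 := (heval F' A' a' (k + 1) q hq1 hF' hA').trans (hb' (k + 1) q (hmem ρ' hyρ2))
      rw [hqΛ] at e1 e2
      have e3 : (q - Λ) ^ k * (a k z - a' k z) =
          ((q - Λ) * fDelta q z - ∑ n ∈ Finset.range (k + 1), (q - Λ) ^ n * a' n z) -
          ((q - Λ) * fDelta q z - ∑ n ∈ Finset.range (k + 1), (q - Λ) ^ n * a n z) := by
        have : ∑ n ∈ Finset.range k, (q - Λ) ^ n * a n z =
            ∑ n ∈ Finset.range k, (q - Λ) ^ n * a' n z :=
          Finset.sum_congr rfl fun n hn => by rw [ih n (Finset.mem_range.1 hn)]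
        rw [Finset.sum_range_succ, Finset.sum_range_succ, this]
        ring
      have e4 : y ^ k * ‖a k z - a' k z‖ ≤ C * y ^ (k + 1) := by
        rw [← hqΛ, ← norm_pow, ← norm_mul, e3, hqΛ]
        refine (norm_sub_le _ _).trans ?_
        rw [hC]; linarith
      have hyk : 0 < y ^ k := by positivity
      rw [pow_succ, mul_left_comm] at e4
      exact le_of_mul_le_mul_left e4 hyk
    have hlim : Tendsto (fun y : ℝ => C * y) (𝓝[>] 0) (𝓝 0) := by
      have : Continuous fun y : ℝ => C * y := by fun_prop
      simpa using (this.tendsto 0).mono_left nhdsWithin_le_nhds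
    have hle : ‖a k z - a' k z‖ ≤ 0 := by
      refine ge_of_tendsto hlim ?_
      filter_upwards [Ioo_mem_nhdsGT (lt_min hρ hρ')] with y hy
      exact hkey y hy.1 hy.2
    exact sub_eq_zero.1 (norm_le_zero_iff.1 hle)

end Expansion

theorem resonance_pow_self {m₀ : ℕ} (hm : 0 < m₀) (n₀ : ℕ) : resonance m₀ n₀ ^ m₀ = 1 := by
  have hm' : (m₀ : ℂ) ≠ 0 := by exact_mod_cast hm.ne'
  rw [resonance_pow, Complex.exp_eq_one_iff]
  exact ⟨n₀, by push_cast; field_simp⟩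

theorem norm_resonance {m₀ : ℕ} (hm : 0 < m₀) (n₀ : ℕ) : ‖resonance m₀ n₀‖ = 1 :=
  Complex.norm_eq_one_of_pow_eq_one (resonance_pow_self hm n₀) hm.ne'

/-! ### Linearity and continuity of the kernel transform -/

section KernelTransform

theorem continuous_borelKernel_segment (ζ : ℂ) :
    Continuous fun x : ℝ => borelKernel (x * ζ) ζ :=
  continuous_borelKernel.comp (f := fun x : ℝ => ((x : ℂ) * ζ, ζ)) (by fun_prop)

theorem kernelTransform_congr {G G' : ℂ → ℂ} {ζ : ℂ}
    (h : ∀ x ∈ Set.Icc (0 : ℝ) 1, G (x * ζ) = G' (x * ζ)) :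
    kernelTransform G ζ = kernelTransform G' ζ := by
  have h1 := h 1 (by simp)
  rw [Complex.ofReal_one, one_mul] at h1
  rw [kernelTransform, kernelTransform, h1]
  congr 2
  refine intervalIntegral.integral_congr fun x hx => ?_
  rw [Set.uIcc_of_le zero_le_one] at hx
  simp only [h x hx]

theorem intervalIntegrable_kernel {G : ℂ → ℂ} {ζ : ℂ}
    (hG : ContinuousOn (fun x : ℝ => G (x * ζ)) (Set.Icc 0 1)) :
    IntervalIntegrable (fun x : ℝ => G (x * ζ) * borelKernel (x * ζ) ζ) MeasureTheory.volume 0 1 :=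
  ContinuousOn.intervalIntegrable (by
    rw [Set.uIcc_of_le zero_le_one]
    exact hG.mul (continuous_borelKernel_segment ζ).continuousOn)

theorem kernelTransform_add {G G' : ℂ → ℂ} {ζ : ℂ}
    (hG : ContinuousOn (fun x : ℝ => G (x * ζ)) (Set.Icc 0 1))
    (hG' : ContinuousOn (fun x : ℝ => G' (x * ζ)) (Set.Icc 0 1)) :
    kernelTransform (fun ξ => G ξ + G' ξ) ζ = kernelTransform G ζ + kernelTransform G' ζ := by
  simp only [kernelTransform, add_mul]
  rw [intervalIntegral.integral_add (intervalIntegrable_kernel hG) (intervalIntegrable_kernel hG')]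
  ring

theorem kernelTransform_const_mul (c : ℂ) (G : ℂ → ℂ) (ζ : ℂ) :
    kernelTransform (fun ξ => c * G ξ) ζ = c * kernelTransform G ζ := by
  simp only [kernelTransform, mul_assoc c]
  rw [intervalIntegral.integral_const_mul]
  ring

theorem kernelTransform_sum {ι : Type*} {S : Finset ι} {G : ι → ℂ → ℂ} {ζ : ℂ}
    (hG : ∀ i ∈ S, ContinuousOn (fun x : ℝ => G i (x * ζ)) (Set.Icc 0 1)) :
    kernelTransform (fun ξ => ∑ i ∈ S, G i ξ) ζ = ∑ i ∈ S, kernelTransform (G i) ζ := by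
  simp only [kernelTransform, Finset.sum_mul]
  rw [intervalIntegral.integral_finsetSum fun i hi => intervalIntegrable_kernel (hG i hi),
    Finset.mul_sum, Finset.mul_sum, Finset.sum_add_distrib]

/-- Dominated convergence along [0, ζ], where the kernel is bounded. This extends the computation on
exponentials to series of exponentials. -/
theorem hasSum_kernelTransform {ι : Type*} [Countable ι] {f : ι → ℂ → ℂ} {F : ℂ → ℂ}
    {u : ι → ℝ} {ζ : ℂ} (hu : Summable u) (hf : ∀ i, Continuous (f i))
    (hb : ∀ i, ∀ ξ ∈ closedBall (0 : ℂ) ‖ζ‖, ‖f i ξ‖ ≤ u i)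
    (hs : ∀ ξ ∈ closedBall (0 : ℂ) ‖ζ‖, HasSum (fun i => f i ξ) (F ξ)) :
    HasSum (fun i => kernelTransform (f i) ζ) (kernelTransform F ζ) := by
  obtain ⟨C, hC⟩ := (isCompact_uIcc (a := (0 : ℝ)) (b := 1)).exists_bound_of_continuousOn
    (continuous_borelKernel_segment ζ).continuousOn
  have hmem : ∀ x ∈ Set.uIoc (0 : ℝ) 1, (x : ℂ) * ζ ∈ closedBall (0 : ℂ) ‖ζ‖ := by
    intro x hx
    rw [Set.uIoc_of_le zero_le_one] at hx
    rw [mem_closedBall_zero_iff, norm_mul, Complex.norm_real, Real.norm_of_nonneg hx.1.le]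
    exact mul_le_of_le_one_left (norm_nonneg _) hx.2
  refine HasSum.add ((hs ζ (by simp)).mul_left _) (HasSum.mul_left _ ?_)
  refine intervalIntegral.hasSum_integral_of_dominated_convergence (fun i _ => u i * C)
    (fun i => ?_) (fun i => ?_) ?_ ?_ ?_
  · exact (((hf i).comp (by fun_prop)).mul
      (continuous_borelKernel_segment ζ)).aestronglyMeasurable
  · refine MeasureTheory.ae_of_all _ fun x hx => ?_
    rw [norm_mul]
    exact mul_le_mul (hb i _ (hmem x hx)) (hC x (Set.uIoc_subset_uIcc hx)) (norm_nonneg _)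
      ((norm_nonneg _).trans (hb i _ (hmem x hx)))
  · exact MeasureTheory.ae_of_all _ fun _ _ => hu.mul_right _
  · exact intervalIntegrable_const
  · exact MeasureTheory.ae_of_all _ fun x hx => (hs _ (hmem x hx)).mul_right _

theorem kernelTransform_exp_sub_one (c α ζ : ℂ) :
    kernelTransform (fun ξ => c * (Complex.exp (α * ξ) - 1)) ζ =
      c * (kernelTransform (fun ξ => Complex.exp (α * ξ)) ζ - 1) := by
  rw [kernelTransform_const_mul]
  congr 1
  simp only [sub_eq_add_neg]
  rw [kernelTransform_add (G' := fun _ => -1) (by fun_prop) (by fun_prop)]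
  have : kernelTransform (fun _ => -1) ζ = -1 := by
    have := kernelTransform_const_mul (-1) (fun _ => 1) ζ
    rw [kernelTransform_one] at this
    simpa using this
  rw [this]

end KernelTransform

/-! ### Convergent expansion of a single term and its Borel transform -/

/-- The value of a double series does not depend on the order of summation. -/
theorem hasSum_of_hasSum_swap {ι κ : Type*} {f : ι × κ → ℂ} (hf : Summable f) {g : ι → ℂ}
    {g' : κ → ℂ} (hg : ∀ i, HasSum (fun k => f (i, k)) (g i))
    (hg' : ∀ k, HasSum (fun i => f (i, k)) (g' k)) {a : ℂ} (ha : HasSum g' a) : HasSum g a := by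
  have h1 := hf.hasSum.prod_fiberwise hg
  have h2 : HasSum (fun p : κ × ι => f (p.2, p.1)) (∑' p, f p) :=
    (Equiv.prodComm κ ι).hasSum_iff.2 hf.hasSum
  have h3 := h2.prod_fiberwise hg'
  rwa [h3.unique ha] at h1

section StepExpansion

variable {m : ℕ} {Λ : ℂ}

theorem hasSum_rootCoeff {ζ q : ℂ} {ν : ℝ}
    (hd : ζ ≠ Λ → 1 ≤ ν * ‖ζ - Λ‖) (hq0 : q ≠ Λ) (hq : ν * ‖q - Λ‖ < 1) :
    HasSum (fun k => (q - Λ) ^ k * rootCoeff Λ ζ k) ((q - Λ) * (ζ / (q - ζ))) := by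
  have hQ : q - Λ ≠ 0 := sub_ne_zero.2 hq0
  by_cases hζΛ : ζ = Λ
  · have h := hasSum_single (f := fun k => (q - Λ) ^ k * rootCoeff Λ ζ k) 0
      (fun k hk => by simp [rootCoeff, hζΛ, hk])
    convert h using 1
    simp only [rootCoeff, hζΛ, if_true, pow_zero, one_mul]
    field_simp
  · have hd0 : ζ - Λ ≠ 0 := sub_ne_zero.2 hζΛ
    have hdpos : 0 < ‖ζ - Λ‖ := norm_pos_iff.2 hd0
    have hlt : ‖(q - Λ) / (ζ - Λ)‖ < 1 := by
      rw [norm_div, div_lt_one hdpos]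
      have h1 := hd hζΛ
      have hν : 0 < ν := by
        by_contra hν
        have : ν * ‖ζ - Λ‖ ≤ 0 := mul_nonpos_of_nonpos_of_nonneg (not_lt.1 hν) hdpos.le
        linarith
      exact lt_of_mul_lt_mul_left (hq.trans_le h1) hν.le
    have hqζ : q - ζ ≠ 0 := by
      intro h
      rw [sub_eq_zero.1 h, div_self hd0, norm_one] at hlt
      exact lt_irrefl _ hlt
    have hg := ((hasSum_geometric_of_norm_lt_one hlt).sub (hasSum_ite_eq 0 (1 : ℂ))).mul_left (-ζ)
    have hx : 1 - (q - Λ) / (ζ - Λ) ≠ 0 := by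
      intro h
      rw [← sub_eq_zero.1 h, norm_one] at hlt
      exact lt_irrefl _ hlt
    have hval : (q - Λ) * (ζ / (q - ζ)) = -ζ * ((1 - (q - Λ) / (ζ - Λ))⁻¹ - 1) := by
      have e : 1 - (q - Λ) / (ζ - Λ) = -(q - ζ) / (ζ - Λ) := by field_simp; ring
      rw [e, inv_div]
      field_simp
      ring
    rw [hval]
    refine hg.congr_fun fun k => ?_
    simp only [rootCoeff, hζΛ, if_false]
    rcases eq_or_ne k 0 with rfl | hk
    · simp
    · rw [if_neg hk, if_neg hk, div_pow]; ring

/-- Every n-th root of unity other than Λ is at distance at least 1/(mn), so the n-th term has a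
convergent expansion on a disk whose guaranteed radius shrinks with n. The summation over n is
therefore carried out after the Borel transform. -/
theorem hasSum_stepCoeff (hm : 0 < m) (hΛ : Λ ^ m = 1) {n : ℕ} (hn : 0 < n) {q : ℂ}
    (hq0 : q ≠ Λ) (hq : ((m * n : ℕ) : ℝ) * ‖q - Λ‖ < 1) :
    q ^ n ≠ 1 ∧
      HasSum (fun k => (q - Λ) ^ k * stepCoeff Λ n k) ((q - Λ) / (q ^ n - 1)) := by
  have hqn : q ^ n ≠ 1 := fun h => not_lt.2 (root_separation hm hΛ hn h hq0) hq
  refine ⟨hqn, ?_⟩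
  have h := (hasSum_sum (s := Polynomial.nthRootsFinset n (1 : ℂ)) fun ζ hζ =>
    hasSum_rootCoeff (ν := ((m * n : ℕ) : ℝ)) (root_separation hm hΛ hn
      ((Polynomial.mem_nthRootsFinset hn _).1 hζ)) hq0 hq).mul_left (1 / (n : ℂ))
  have hval : (q - Λ) / (q ^ n - 1) = 1 / (n : ℂ) *
      ∑ ζ ∈ Polynomial.nthRootsFinset n (1 : ℂ), (q - Λ) * (ζ / (q - ζ)) := by
    rw [div_eq_mul_one_div, sum_nthRootsFinset_div_sub hn hqn, ← Finset.mul_sum]; ring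
  rw [hval]
  refine h.congr_fun fun k => ?_
  rw [stepCoeff, ← Finset.mul_sum]; ring

/-- The radius of the circle used for the Borel transform of the `n`-th term. -/
noncomputable def stepRadius (m n : ℕ) : ℝ := 1 / (4 * (m * n : ℕ))

theorem stepRadius_pos (hm : 0 < m) {n : ℕ} (hn : 0 < n) : 0 < stepRadius m n := by
  have : 0 < m * n := Nat.mul_pos hm hn
  rw [stepRadius]; positivity

theorem stepRadius_le (hm : 0 < m) {n : ℕ} (hn : 0 < n) : stepRadius m n ≤ 1 / 4 := by
  have : (1 : ℝ) ≤ (m * n : ℕ) := by exact_mod_cast Nat.mul_pos hm hn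
  rw [stepRadius]
  exact div_le_div_of_nonneg_left (by norm_num) (by norm_num) (by linarith)

theorem mul_stepRadius (hm : 0 < m) {n : ℕ} (hn : 0 < n) :
    ((m * n : ℕ) : ℝ) * stepRadius m n = 1 / 4 := by
  have : (0 : ℝ) < (m * n : ℕ) := by exact_mod_cast Nat.mul_pos hm hn
  rw [stepRadius]; field_simp

theorem hasSum_borelTerm_stepCoeff (hm : 0 < m) (hΛ : Λ ^ m = 1) {n : ℕ} (hn : 0 < n) (ζ : ℂ) :
    HasSum (borelTerm (fun k => Λ ^ k * stepCoeff Λ n k) ζ)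
      (Λ * Real.circleAverage (fun t => 1 / (Λ ^ n * (1 + t) ^ n - 1) * Complex.exp (ζ / t)) 0
        (stepRadius m n)) := by
  have hε := stepRadius_pos hm hn
  have hΛ1 : ‖Λ‖ = 1 := Complex.norm_eq_one_of_pow_eq_one hΛ hm.ne'
  have hΛ0 : Λ ≠ 0 := by rw [← norm_pos_iff, hΛ1]; exact one_pos
  have h := hasSum_borelTerm_circleAverage (c := fun k => Λ ^ k * stepCoeff Λ n k)
    (A := fun t => Λ * t * (1 / (Λ ^ n * (1 + t) ^ n - 1))) hε ?_ ?_ ζ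
  · convert h using 1
    rw [← smul_eq_mul, ← Real.circleAverage_fun_smul]
    refine Real.circleAverage_congr_sphere fun t ht => ?_
    rw [abs_of_pos hε] at ht
    have := ne_zero_of_mem_sphere_zero hε ht
    simp only [smul_eq_mul]
    field_simp
  · refine Summable.of_nonneg_of_le (fun k => by positivity) (fun k => ?_)
      (summable_geometric_of_lt_one (r := 1 / 4) (by norm_num) (by norm_num))
    rw [norm_mul, norm_pow, hΛ1, one_pow, one_mul, ← mul_stepRadius hm hn, mul_pow]
    exact mul_le_mul_of_nonneg_right (norm_stepCoeff_le hm hΛ hn k) (by positivity)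
  · intro t ht
    have ht0 := ne_zero_of_mem_sphere_zero hε ht
    have htn : ‖t‖ = stepRadius m n := by simpa using ht
    have hQ : Λ * (1 + t) - Λ = Λ * t := by ring
    have := (hasSum_stepCoeff hm hΛ hn (q := Λ * (1 + t))
      (by rw [← sub_ne_zero, hQ]; exact mul_ne_zero hΛ0 ht0)
      (by rw [hQ, norm_mul, hΛ1, one_mul, htn, mul_stepRadius hm hn]; norm_num)).2
    rw [hQ, mul_pow] at this
    simp only [mul_one_div]
    refine this.congr_fun fun k => ?_
    rw [mul_pow]; ring

end StepExpansion

/-! ### Borel transform of the partial fractions -/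

section PartialFractionsBorel

variable {m₀ n₀ : ℕ}

/-- With |log(1 + t)| ≤ 2|t|, |μ_j| ≤ m₀ and |t| ≤ 1/(4m₀n), the bound is uniform in j; it keeps all
denominators 1 − nμ_j h away from 0 on the circle. -/
theorem norm_mul_mu_mul_log_le (hm : 0 < m₀) {n : ℕ} (hn : 0 < n) {t : ℂ}
    (ht : t ∈ closedBall (0 : ℂ) (stepRadius m₀ n)) (j : ℤ) :
    ‖n * mu m₀ j * Complex.log (1 + t)‖ ≤ 1 / 2 := by
  have htn : ‖t‖ ≤ stepRadius m₀ n := by simpa using ht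
  have h1 := norm_log_one_add_le_two_mul (t := t) (by linarith [stepRadius_le hm hn])
  have h2 := mul_stepRadius hm hn
  rw [Nat.cast_mul] at h2
  rw [norm_mul, norm_mul, Complex.norm_natCast]
  calc (n : ℝ) * ‖mu m₀ j‖ * ‖Complex.log (1 + t)‖ ≤ n * m₀ * (2 * stepRadius m₀ n) := by
        gcongr
        · exact norm_mu_le_self m₀ j
        · linarith
    _ = 1 / 2 := by linarith

theorem kernelTransform_exp_mu (hm : 0 < m₀) {n : ℕ} (hn : 0 < n) (j : ℤ) (ζ : ℂ) :
    kernelTransform (fun ξ => Complex.exp (n * mu m₀ j * ξ)) ζ - 1 =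
      Real.circleAverage (fun t => (1 / (1 - n * mu m₀ j * Complex.log (1 + t)) - 1) *
        Complex.exp (ζ / t)) 0 (stepRadius m₀ n) := by
  have hε := stepRadius_pos hm hn
  have hε1 : stepRadius m₀ n < 1 := by linarith [stepRadius_le hm hn]
  have hne : ∀ t ∈ sphere (0 : ℂ) (stepRadius m₀ n),
      1 - n * mu m₀ j * Complex.log (1 + t) ≠ 0 := by
    intro t ht h
    have := norm_mul_mu_mul_log_le hm hn (sphere_subset_closedBall ht) j
    rw [← sub_eq_zero.1 h] at this
    norm_num at this
  have hexp : ContinuousOn (fun t => Complex.exp (ζ / t)) (sphere 0 (stepRadius m₀ n)) :=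
    ContinuousOn.cexp (continuousOn_const.div continuousOn_id
      fun t ht => ne_zero_of_mem_sphere_zero hε ht)
  have h1 := kernelTransform_exp hε hε1 (fun t ht =>
    (norm_mul_mu_mul_log_le hm hn ht j).trans_lt (by norm_num)) ζ
  have h2 := circleAverage_exp_div hε ζ
  rw [h1]
  nth_rewrite 3 [← h2]
  rw [← Real.circleAverage_fun_sub]
  · refine Real.circleAverage_congr_sphere fun t ht => ?_
    rw [abs_of_pos hε] at ht
    have := ne_zero_of_mem_sphere_zero hε ht
    have := hne t ht
    field_simp
  · refine circleIntegrable_of_continuousOn hε (ContinuousOn.mul (continuousOn_id.div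
      (continuousOn_const.sub (continuousOn_const.mul (continuousOn_log_one_add hε1))) hne)
      (hexp.div continuousOn_id fun t ht => ne_zero_of_mem_sphere_zero hε ht))
  · exact circleIntegrable_of_continuousOn hε hexp

/-- The partial fractions at h = log(1 + t), multiplied by exp(ζ/t), are averaged termwise;
subtracting 1 in each term makes it O(|μ_j|²). The pole at h = 0 contributes `borelKernel 0 ζ` and
the constant contributes 1. -/
theorem hasSum_kernelTransform_exp_mu (hm : 0 < m₀) (hcop : Nat.Coprime n₀ m₀) {n : ℕ}
    (hn : 0 < n) (ζ : ℂ) :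
    HasSum (fun j : ℤ => if (m₀ : ℤ) ∣ j + n * n₀ then
        mu m₀ j * (kernelTransform (fun ξ => Complex.exp (n * mu m₀ j * ξ)) ζ - 1) else 0)
      (polePart m₀ n * borelKernel 0 ζ + constPart m₀ n₀ n -
        Real.circleAverage (fun t => 1 / (resonance m₀ n₀ ^ n * (1 + t) ^ n - 1) *
          Complex.exp (ζ / t)) 0 (stepRadius m₀ n)) := by
  have hε := stepRadius_pos hm hn
  set ε := stepRadius m₀ n with hεdef
  have hε1 : ε < 1 := by linarith [stepRadius_le hm hn]
  have hne : ∀ j, ∀ t ∈ sphere (0 : ℂ) ε,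
      1 / 2 ≤ ‖1 - n * mu m₀ j * Complex.log (1 + t)‖ := by
    intro j t ht
    have h1 := norm_mul_mu_mul_log_le hm hn (sphere_subset_closedBall ht) j
    have h2 := norm_sub_norm_le 1 (n * mu m₀ j * Complex.log (1 + t))
    rw [norm_one] at h2
    linarith
  have hexp : ContinuousOn (fun t => Complex.exp (ζ / t)) (sphere 0 ε) :=
    ContinuousOn.cexp (continuousOn_const.div continuousOn_id
      fun t ht => ne_zero_of_mem_sphere_zero hε ht)
  have hlog := continuousOn_log_one_add hε1
  obtain ⟨C, hC⟩ := (isCompact_sphere (0 : ℂ) ε).exists_bound_of_continuousOn hexp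
  set F : ℂ → ℂ := fun t => (polePart m₀ n / Complex.log (1 + t) + constPart m₀ n₀ n -
        1 / (resonance m₀ n₀ ^ n * (1 + t) ^ n - 1)) * Complex.exp (ζ / t) with hF
  have hΛ := resonance_pow_self hm n₀
  have hΛ1 := norm_resonance hm n₀
  have hΛ0 : resonance m₀ n₀ ≠ 0 := by rw [← norm_pos_iff, hΛ1]; exact one_pos
  have hden : ∀ t ∈ sphere (0 : ℂ) ε, resonance m₀ n₀ ^ n * (1 + t) ^ n - 1 ≠ 0 := by
    intro t ht
    have ht0 := ne_zero_of_mem_sphere_zero hε ht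
    have htn : ‖t‖ = ε := by simpa using ht
    have hQ : resonance m₀ n₀ * (1 + t) - resonance m₀ n₀ = resonance m₀ n₀ * t := by ring
    have := (hasSum_stepCoeff hm hΛ hn (q := resonance m₀ n₀ * (1 + t))
      (by rw [← sub_ne_zero, hQ]; exact mul_ne_zero hΛ0 ht0)
      (by rw [hQ, norm_mul, hΛ1, one_mul, htn, mul_stepRadius hm hn]; norm_num)).1
    rw [mul_pow] at this
    exact sub_ne_zero.2 this
  have key := hasSum_circleAverage (ε := ε) (F := F)
    (f := fun (j : ℤ) t => (if (m₀ : ℤ) ∣ j + n * n₀ then mu m₀ j else 0) *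
      ((1 / (1 - n * mu m₀ j * Complex.log (1 + t)) - 1) * Complex.exp (ζ / t)))
    (u := fun j => ‖mu m₀ j‖ ^ 2 * (2 * n * C)) hε ((summable_norm_mu_sq m₀).mul_right _)
    ?_ ?_ ?_
  · have hval : Real.circleAverage F 0 ε = polePart m₀ n * borelKernel 0 ζ +
        constPart m₀ n₀ n - Real.circleAverage (fun t =>
          1 / (resonance m₀ n₀ ^ n * (1 + t) ^ n - 1) * Complex.exp (ζ / t)) 0 ε := by
      have e : F = fun t => (polePart m₀ n • (Complex.exp (ζ / t - 0 / Complex.log (1 + t)) /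
          Complex.log (1 + t)) + constPart m₀ n₀ n • Complex.exp (ζ / t)) -
          1 / (resonance m₀ n₀ ^ n * (1 + t) ^ n - 1) * Complex.exp (ζ / t) := by
        funext t
        simp only [hF, zero_div, sub_zero, smul_eq_mul]
        ring
      have c1 : CircleIntegrable (fun t => polePart m₀ n • (Complex.exp (ζ / t -
          0 / Complex.log (1 + t)) / Complex.log (1 + t))) 0 ε := by
        refine circleIntegrable_of_continuousOn hε ?_
        simp only [zero_div, sub_zero, smul_eq_mul]
        exact continuousOn_const.mul (hexp.div hlog
          fun t ht => (ne_zero_and_mem_ball hε hε1 ht).2.2)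
      have c2 : CircleIntegrable (fun t => constPart m₀ n₀ n • Complex.exp (ζ / t)) 0 ε := by
        refine circleIntegrable_of_continuousOn hε ?_
        simp only [smul_eq_mul]
        exact continuousOn_const.mul hexp
      have c3 : CircleIntegrable (fun t => 1 / (resonance m₀ n₀ ^ n * (1 + t) ^ n - 1) *
          Complex.exp (ζ / t)) 0 ε := by
        refine circleIntegrable_of_continuousOn hε ?_
        exact (continuousOn_const.div (by fun_prop) hden).mul hexp
      rw [e, Real.circleAverage_fun_sub (c1.fun_add c2) c3, Real.circleAverage_fun_add c1 c2,
        Real.circleAverage_fun_smul, Real.circleAverage_fun_smul, circleAverage_exp_div hε,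
        ← borelKernel_eq_circleAverage hε hε1]
      simp
    rw [hval] at key
    refine key.congr_fun fun j => ?_
    have := Real.circleAverage_fun_smul (𝕜 := ℂ) (a := if (m₀ : ℤ) ∣ j + n * n₀ then mu m₀ j else 0)
      (f := fun t => (1 / (1 - n * mu m₀ j * Complex.log (1 + t)) - 1) * Complex.exp (ζ / t))
      (c := 0) (R := ε)
    simp only [smul_eq_mul] at this
    rw [this, kernelTransform_exp_mu hm hn]
    split_ifs <;> simp [← hεdef]
  · intro j
    refine continuousOn_const.mul (ContinuousOn.mul (ContinuousOn.sub (continuousOn_const.div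
      (continuousOn_const.sub (continuousOn_const.mul hlog)) fun t ht => ?_)
      continuousOn_const) hexp)
    rw [← norm_pos_iff]
    linarith [hne j t ht]
  · intro j t ht
    have h1 := hne j t ht
    have h0 : 1 - n * mu m₀ j * Complex.log (1 + t) ≠ 0 := by
      rw [← norm_pos_iff]; linarith
    have hC0 : 0 ≤ C := (norm_nonneg _).trans (hC t ht)
    have htn : ‖t‖ = ε := by simpa using ht
    have hl : ‖Complex.log (1 + t)‖ ≤ 1 := by
      have := stepRadius_le hm hn
      have := norm_log_one_add_le_two_mul (t := t) (by linarith)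
      linarith
    have e : 1 / (1 - n * mu m₀ j * Complex.log (1 + t)) - 1 =
        n * mu m₀ j * Complex.log (1 + t) / (1 - n * mu m₀ j * Complex.log (1 + t)) := by
      field_simp; ring
    have h2 : ‖1 / (1 - n * mu m₀ j * Complex.log (1 + t)) - 1‖ ≤ 2 * n * ‖mu m₀ j‖ := by
      rw [e, norm_div, norm_mul, norm_mul, Complex.norm_natCast, div_le_iff₀ (by linarith)]
      have h3 : (n : ℝ) * ‖mu m₀ j‖ * ‖Complex.log (1 + t)‖ ≤ n * ‖mu m₀ j‖ :=
        mul_le_of_le_one_right (by positivity) hl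
      have h4 : 0 ≤ (n : ℝ) * ‖mu m₀ j‖ := by positivity
      nlinarith
    rw [norm_mul, norm_mul]
    have h5 : ‖if (m₀ : ℤ) ∣ j + n * n₀ then mu m₀ j else 0‖ ≤ ‖mu m₀ j‖ := by
      split_ifs <;> simp
    calc _ ≤ ‖mu m₀ j‖ * ((2 * n * ‖mu m₀ j‖) * C) := by
          gcongr
          exact hC t ht
      _ = _ := by ring
  · intro t ht
    obtain ⟨h0, hb, hl⟩ := ne_zero_and_mem_ball hε hε1 ht
    have htn : ‖t‖ = ε := by simpa using ht
    have h1 : (n : ℝ) * ‖Complex.log (1 + t)‖ * m₀ < 2 * Real.pi := by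
      have h2 := mul_stepRadius hm hn
      rw [Nat.cast_mul] at h2
      have h3 := norm_log_one_add_le_two_mul (t := t) (by linarith [stepRadius_le hm hn])
      have h4 : (n : ℝ) * ‖Complex.log (1 + t)‖ * m₀ ≤ n * (2 * ε) * m₀ := by
        rw [← htn]; gcongr
      nlinarith [Real.pi_gt_three]
    have := (hasSum_partialFractions (n₀ := n₀) hm hn hcop hl h1).mul_right (Complex.exp (ζ / t))
    rw [Complex.exp_nat_mul, Complex.exp_log (Complex.slitPlane_ne_zero
      (one_add_mem_slitPlane hb))] at this
    refine this.congr_fun fun j => ?_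
    split_ifs <;> ring

end PartialFractionsBorel

/-! ### The explicit Borel transform and its Taylor series at 0 -/

/-- The determinations `s + 2 π i b / m₀` of the logarithms of the numbers
`e ^ (2 π i b / m₀) z`. -/
noncomputable def shiftedLog (m₀ : ℕ) (s : ℂ) (b : ℤ) : ℂ := s + 2 * Real.pi * Complex.I * b / m₀

/-- The `j`-th term of the Borel transform, with respect to `h = log (q / Λ₀)`, of `h f_δ`. -/
noncomputable def poleTerm (m₀ : ℕ) (n₀' : ℤ) (s : ℂ) (j : ℤ) (ξ : ℂ) : ℂ :=
  mu m₀ j * ∑ b ∈ Finset.range m₀, resCoeff m₀ n₀' j b *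
    (geomExp (shiftedLog m₀ s b + mu m₀ j * ξ) - geomExp (shiftedLog m₀ s b))

/-- All `poleTerm`s vanish at ξ = 0, so this is the value of `logBorel` there. -/
noncomputable def constSum (m₀ n₀ : ℕ) (s : ℂ) : ℂ :=
  ∑' n : ℕ, constPart m₀ n₀ (n + 1) * Complex.exp s ^ (n + 1)

/-- The coefficient of 1/h. In h f_δ it becomes a constant, invisible to the Borel transform in h,
but multiplication by t/h makes it reappear as a multiple of `borelKernel 0`. -/
noncomputable def poleConst (m₀ : ℕ) (s : ℂ) : ℂ :=
  ∑' n : ℕ, polePart m₀ (n + 1) * Complex.exp s ^ (n + 1)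

/-- The Borel transform, with respect to `h = log (q / Λ₀)`, of `h f_δ`. -/
noncomputable def logBorel (m₀ n₀ : ℕ) (n₀' : ℤ) (s ξ : ℂ) : ℂ :=
  constSum m₀ n₀ s - ∑' j : ℤ, poleTerm m₀ n₀' s j ξ

/-- The Borel transform, with respect to `t = (q - Λ₀) / Λ₀`, of `(q - Λ₀) f_δ`. -/
noncomputable def fullBorel (m₀ n₀ : ℕ) (n₀' : ℤ) (s ζ : ℂ) : ℂ :=
  resonance m₀ n₀ * (kernelTransform (logBorel m₀ n₀ n₀' s) ζ + poleConst m₀ s * borelKernel 0 ζ)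

section NearZero

variable {m₀ n₀ : ℕ} {n₀' : ℤ} {s : ℂ}

theorem shiftedLog_re (m₀ : ℕ) (s : ℂ) (b : ℤ) : (shiftedLog m₀ s b).re = s.re := by
  have : (2 * Real.pi * Complex.I * b / m₀ : ℂ) = ((2 * Real.pi * b / m₀ : ℝ) : ℂ) * Complex.I := by
    push_cast; ring
  rw [shiftedLog, this]
  simp

theorem exp_natCast_mul_shiftedLog (m₀ : ℕ) (s : ℂ) (b : ℤ) (n : ℕ) :
    Complex.exp (n * shiftedLog m₀ s b) =
      Complex.exp s ^ n * Complex.exp (2 * Real.pi * Complex.I * b * n / m₀) := by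
  rw [← Complex.exp_nat_mul, ← Complex.exp_add, shiftedLog]
  congr 1; ring

theorem norm_exp_sub_one_le_mul_exp (x : ℂ) :
    ‖Complex.exp x - 1‖ ≤ ‖x‖ * Real.exp ‖x‖ := by
  simpa using Complex.norm_exp_sub_sum_le_norm_mul_exp x 1

/-- Orthogonality of characters replaces the congruence by an average over b, and each b then gives
a geometric series. The bound on ξ keeps the real part of its exponent negative. -/
theorem hasSum_poleTerm (hm : 0 < m₀) (hinv : (n₀ : ℤ) * n₀' ≡ 1 [ZMOD (m₀ : ℤ)])
    (hs : s.re < 0) {ξ : ℂ} (hξ : m₀ * ‖ξ‖ < -s.re) (j : ℤ) :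
    HasSum (fun n : ℕ => Complex.exp s ^ (n + 1) *
      (if (m₀ : ℤ) ∣ j + (n + 1 : ℕ) * n₀ then mu m₀ j else 0) *
        (Complex.exp ((n + 1 : ℕ) * mu m₀ j * ξ) - 1)) (poleTerm m₀ n₀' s j ξ) := by
  have hre : ∀ b : ℤ, (shiftedLog m₀ s b + mu m₀ j * ξ).re < 0 := by
    intro b
    rw [Complex.add_re, shiftedLog_re]
    have h1 := Complex.re_le_norm (mu m₀ j * ξ)
    rw [norm_mul] at h1
    have h2 := mul_le_mul_of_nonneg_right (norm_mu_le_self m₀ j) (norm_nonneg ξ)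
    linarith
  have hb : ∀ b ∈ Finset.range m₀, HasSum (fun n : ℕ => resCoeff m₀ n₀' j b *
      (Complex.exp (((n + 1 : ℕ) : ℂ) * (shiftedLog m₀ s b + mu m₀ j * ξ)) -
        Complex.exp (((n + 1 : ℕ) : ℂ) * shiftedLog m₀ s b)))
      (resCoeff m₀ n₀' j b *
        (geomExp (shiftedLog m₀ s b + mu m₀ j * ξ) - geomExp (shiftedLog m₀ s b))) := fun b _ =>
    ((hasSum_geomExp (hre b)).sub (hasSum_geomExp (by rw [shiftedLog_re]; exact hs))).mul_left _
  refine ((hasSum_sum hb).mul_left (mu m₀ j)).congr_fun fun n => ?_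
  have h1 : ∀ b ∈ Finset.range m₀, resCoeff m₀ n₀' j b *
      (Complex.exp (((n + 1 : ℕ) : ℂ) * (shiftedLog m₀ s b + mu m₀ j * ξ)) -
        Complex.exp (((n + 1 : ℕ) : ℂ) * shiftedLog m₀ s b)) =
      (Complex.exp s ^ (n + 1) * (Complex.exp ((n + 1 : ℕ) * mu m₀ j * ξ) - 1)) *
      (resCoeff m₀ n₀' j b * Complex.exp (2 * Real.pi * Complex.I * b * (n + 1 : ℕ) / m₀)) := by
    intro b _
    rw [mul_add, Complex.exp_add, exp_natCast_mul_shiftedLog, ← mul_assoc ((n + 1 : ℕ) : ℂ)]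
    push_cast
    ring
  rw [Finset.sum_congr rfl h1, ← Finset.mul_sum, sum_resCoeff_mul_exp hm hinv]
  split_ifs <;> ring

/-- When m₀ ∤ n, coprimality makes Λ₀ⁿ an m₀-th root of unity other than 1, so it is at distance at
least 1/m₀ from 1. -/
theorem norm_constPart_le (hm : 0 < m₀) (hcop : Nat.Coprime n₀ m₀) (n : ℕ) :
    ‖constPart m₀ n₀ n‖ ≤ m₀ := by
  have hm1 : (1 : ℝ) ≤ m₀ := by exact_mod_cast hm
  unfold constPart
  split_ifs with h
  · norm_num; linarith
  · have hne : resonance m₀ n₀ ^ n ≠ 1 := by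
      intro h1
      rw [resonance_pow, Complex.exp_eq_one_iff] at h1
      obtain ⟨k, hk⟩ := h1
      have hm' : (m₀ : ℂ) ≠ 0 := by exact_mod_cast hm.ne'
      have h3 : (n * n₀ / m₀ : ℂ) = k :=
        mul_left_cancel₀ two_pi_I_ne_zero (by rw [hk]; ring)
      rw [div_eq_iff hm'] at h3
      have h4 : (n * n₀ : ℤ) = k * m₀ := by exact_mod_cast h3
      have h5 : (m₀ : ℤ) ∣ n * n₀ := ⟨k, by rw [h4]; ring⟩
      exact h (hcop.symm.dvd_of_dvd_mul_right (by exact_mod_cast h5))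
    have h1 := one_le_mul_norm_sub_one hm (x := resonance m₀ n₀ ^ n)
      (by rw [← pow_mul, mul_comm, pow_mul, resonance_pow_self hm, one_pow]) hne
    have hpos : 0 < ‖resonance m₀ n₀ ^ n - 1‖ := norm_pos_iff.2 (sub_ne_zero.2 hne)
    rw [norm_div, norm_one, div_le_iff₀ hpos]
    exact h1

theorem norm_polePart_le (m₀ n : ℕ) : ‖polePart m₀ (n + 1)‖ ≤ 1 := by
  unfold polePart
  split_ifs
  · rw [norm_div, norm_one, Complex.norm_natCast]
    exact div_le_one_of_le₀ (by push_cast; linarith [(Nat.cast_nonneg n : (0 : ℝ) ≤ n)])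
      (by positivity)
  · simp

theorem summable_mul_exp_pow (hs : s.re < 0) {c : ℕ → ℂ} {C : ℝ} (hc : ∀ n, ‖c n‖ ≤ C) :
    Summable fun n : ℕ => c n * Complex.exp s ^ (n + 1) := by
  refine Summable.of_norm_bounded (g := fun n => C * ‖Complex.exp s‖ ^ (n + 1))
    (((summable_geometric_of_lt_one (norm_nonneg _) (norm_exp_lt_one hs)).comp_injective
      (add_left_injective 1)).mul_left C) fun n => ?_
  rw [norm_mul, norm_pow]
  exact mul_le_mul_of_nonneg_right (hc n) (by positivity)

theorem summable_succ_mul_exp {x : ℝ} (hx : x < 0) :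
    Summable fun n : ℕ => ((n + 1 : ℕ) : ℝ) * Real.exp x ^ (n + 1) := by
  have h1 : ‖Real.exp x‖ < 1 := by
    rw [Real.norm_of_nonneg (Real.exp_pos x).le]; exact Real.exp_lt_one_iff.2 hx
  have := (summable_pow_mul_geometric_of_norm_lt_one 1 h1).comp_injective (add_left_injective 1)
  simpa [Function.comp_def] using this

/-- The double series over n and j converges absolutely for small ζ. Summing over n first gives the
`poleTerm`s; applying the kernel transform and summing over j first gives the n-th term of f_δ by
the partial fractions. -/
theorem hasSum_fullBorel (hm : 0 < m₀) (hcop : Nat.Coprime n₀ m₀)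
    (hinv : (n₀ : ℤ) * n₀' ≡ 1 [ZMOD (m₀ : ℤ)]) (hs : s.re < 0) {ζ : ℂ}
    (hζ : m₀ * ‖ζ‖ ≤ -s.re / 2) :
    HasSum (fun n : ℕ => Complex.exp s ^ (n + 1) * (resonance m₀ n₀ * Real.circleAverage (fun t =>
        1 / (resonance m₀ n₀ ^ (n + 1) * (1 + t) ^ (n + 1) - 1) * Complex.exp (ζ / t)) 0
          (stepRadius m₀ (n + 1)))) (fullBorel m₀ n₀ n₀' s ζ) := by
  set Λ := resonance m₀ n₀ with hΛdef
  set z := Complex.exp s with hz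
  have hzn : ‖z‖ = Real.exp s.re := Complex.norm_exp s
  set f : ℕ × ℤ → ℂ → ℂ := fun p ξ => z ^ (p.1 + 1) *
      (if (m₀ : ℤ) ∣ p.2 + (p.1 + 1 : ℕ) * n₀ then mu m₀ p.2 else 0) *
        (Complex.exp ((p.1 + 1 : ℕ) * mu m₀ p.2 * ξ) - 1) with hf
  -- The bound |eˣ − 1| ≤ |x|e^|x| supplies the factor n + 1 and the second |μ_j|; half of the decay
  -- exp((n + 1) Re s) pays for e^|x|.
  set u : ℕ × ℤ → ℝ := fun p => (((p.1 + 1 : ℕ) : ℝ) * Real.exp (s.re / 2) ^ (p.1 + 1)) *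
    (‖mu m₀ p.2‖ ^ 2 * ‖ζ‖) with hu
  have hu_sum : Summable u := (summable_succ_mul_exp (by linarith)).mul_of_nonneg
    ((summable_norm_mu_sq m₀).mul_right ‖ζ‖) (fun n => by positivity) (fun j => by positivity)
  have hfu : ∀ p, ∀ ξ ∈ closedBall (0 : ℂ) ‖ζ‖, ‖f p ξ‖ ≤ u p := by
    rintro ⟨n, j⟩ ξ hξ
    have hξ' : ‖ξ‖ ≤ ‖ζ‖ := by simpa using hξ
    simp only [hf, hu]
    rw [norm_mul, norm_mul, norm_pow, hzn]
    have h1 : ‖if (m₀ : ℤ) ∣ j + (n + 1 : ℕ) * n₀ then mu m₀ j else 0‖ ≤ ‖mu m₀ j‖ := by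
      split_ifs <;> simp
    have h2 := norm_exp_sub_one_le_mul_exp (((n + 1 : ℕ) : ℂ) * mu m₀ j * ξ)
    have h3 : ‖((n + 1 : ℕ) : ℂ) * mu m₀ j * ξ‖ = ((n + 1 : ℕ) : ℝ) * ‖mu m₀ j‖ * ‖ξ‖ := by
      rw [norm_mul, norm_mul, Complex.norm_natCast]
    have h4 : ((n + 1 : ℕ) : ℝ) * ‖mu m₀ j‖ * ‖ξ‖ ≤ ((n + 1 : ℕ) : ℝ) * (-s.re / 2) := by
      rw [mul_assoc]
      have h5 : ‖mu m₀ j‖ * ‖ξ‖ ≤ m₀ * ‖ζ‖ :=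
        mul_le_mul (norm_mu_le_self m₀ j) hξ' (norm_nonneg _) (by positivity)
      exact mul_le_mul_of_nonneg_left (h5.trans hζ) (by positivity)
    rw [h3] at h2
    have h6 : ‖Complex.exp (((n + 1 : ℕ) : ℂ) * mu m₀ j * ξ) - 1‖ ≤
        ((n + 1 : ℕ) : ℝ) * ‖mu m₀ j‖ * ‖ζ‖ * Real.exp (((n + 1 : ℕ) : ℝ) * (-s.re / 2)) := by
      refine h2.trans ?_
      gcongr
    calc _ ≤ Real.exp s.re ^ (n + 1) * ‖mu m₀ j‖ * (((n + 1 : ℕ) : ℝ) * ‖mu m₀ j‖ * ‖ζ‖ *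
          Real.exp (((n + 1 : ℕ) : ℝ) * (-s.re / 2))) := by gcongr
      _ = (Real.exp s.re ^ (n + 1) * Real.exp (((n + 1 : ℕ) : ℝ) * (-s.re / 2))) *
          (((n + 1 : ℕ) : ℝ) * (‖mu m₀ j‖ ^ 2 * ‖ζ‖)) := by ring
      _ = _ := by
          rw [← Real.exp_nat_mul, ← Real.exp_add, ← Real.exp_nat_mul,
            show ((n + 1 : ℕ) : ℝ) * s.re + ((n + 1 : ℕ) : ℝ) * (-s.re / 2) =
              ((n + 1 : ℕ) : ℝ) * (s.re / 2) by ring]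
          ring
  have hfc : ∀ p, Continuous (f p) := fun p => by simp only [hf]; fun_prop
  have hfs : ∀ ξ ∈ closedBall (0 : ℂ) ‖ζ‖,
      HasSum (fun p => f p ξ) (∑' j : ℤ, poleTerm m₀ n₀' s j ξ) := by
    intro ξ hξ
    have hξ' : ‖ξ‖ ≤ ‖ζ‖ := by simpa using hξ
    have hsum : Summable fun p => f p ξ :=
      Summable.of_norm_bounded hu_sum fun p => hfu p ξ hξ
    have h2 : HasSum (fun p : ℤ × ℕ => f (p.2, p.1) ξ) (∑' p, f p ξ) :=
      (Equiv.prodComm ℤ ℕ).hasSum_iff.2 hsum.hasSum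
    have h3 := h2.prod_fiberwise (g := fun j => poleTerm m₀ n₀' s j ξ) fun j =>
      hasSum_poleTerm hm hinv hs (by
        have : (m₀ : ℝ) * ‖ξ‖ ≤ m₀ * ‖ζ‖ := by gcongr
        linarith) j
    rw [h3.tsum_eq]
    exact hsum.hasSum
  have hK := hasSum_kernelTransform hu_sum hfc hfu hfs
  have hKn : HasSum (fun n : ℕ => z ^ (n + 1) * (polePart m₀ (n + 1) * borelKernel 0 ζ +
      constPart m₀ n₀ (n + 1) - Real.circleAverage (fun t =>
        1 / (Λ ^ (n + 1) * (1 + t) ^ (n + 1) - 1) * Complex.exp (ζ / t)) 0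
          (stepRadius m₀ (n + 1))))
      (kernelTransform (fun ξ => ∑' j : ℤ, poleTerm m₀ n₀' s j ξ) ζ) := by
    refine hK.prod_fiberwise fun n => ?_
    refine ((hasSum_kernelTransform_exp_mu hm hcop n.succ_pos ζ).mul_left (z ^ (n + 1))).congr_fun
      fun j => ?_
    simp only [hf]
    rw [kernelTransform_exp_sub_one]
    split_ifs <;> simp [mul_assoc]
  have hconst := (summable_mul_exp_pow hs fun n => norm_constPart_le hm hcop (n + 1)).hasSum
  have hpole := (summable_mul_exp_pow hs fun n => norm_polePart_le m₀ n).hasSum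
  have hcont : ContinuousOn (fun ξ => ∑' j : ℤ, poleTerm m₀ n₀' s j ξ)
      (closedBall (0 : ℂ) ‖ζ‖) := by
    refine (continuousOn_tsum (fun p => (hfc p).continuousOn) hu_sum hfu).congr fun ξ hξ => ?_
    exact (hfs ξ hξ).tsum_eq.symm
  have hmem : ∀ x ∈ Set.Icc (0 : ℝ) 1, (x : ℂ) * ζ ∈ closedBall (0 : ℂ) ‖ζ‖ := by
    intro x hx
    rw [mem_closedBall_zero_iff, norm_mul, Complex.norm_real, Real.norm_of_nonneg hx.1]
    exact mul_le_of_le_one_left (norm_nonneg _) hx.2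
  have hG : kernelTransform (logBorel m₀ n₀ n₀' s) ζ = constSum m₀ n₀ s -
      kernelTransform (fun ξ => ∑' j : ℤ, poleTerm m₀ n₀' s j ξ) ζ := by
    have e : logBorel m₀ n₀ n₀' s = fun ξ => constSum m₀ n₀ s * 1 +
        (-1) * ∑' j : ℤ, poleTerm m₀ n₀' s j ξ := by
      funext ξ; rw [logBorel]; ring
    have hc : ContinuousOn (fun x : ℝ => (-1 : ℂ) * ∑' j : ℤ, poleTerm m₀ n₀' s j (x * ζ))
        (Set.Icc 0 1) :=
      continuousOn_const.mul (hcont.comp (f := fun x : ℝ => (x : ℂ) * ζ) (by fun_prop) hmem)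
    rw [e, kernelTransform_add (G := fun _ => constSum m₀ n₀ s * 1)
      (G' := fun ξ => (-1 : ℂ) * ∑' j : ℤ, poleTerm m₀ n₀' s j ξ) (ζ := ζ) (by fun_prop) hc,
      kernelTransform_const_mul (constSum m₀ n₀ s) (fun _ => 1) ζ,
      kernelTransform_const_mul (-1) (fun ξ => ∑' j : ℤ, poleTerm m₀ n₀' s j ξ) ζ,
      kernelTransform_one]
    ring
  have h := ((hconst.add (hpole.mul_right (borelKernel 0 ζ))).sub hKn).mul_left Λ
  have hv : fullBorel m₀ n₀ n₀' s ζ = Λ * (constSum m₀ n₀ s + poleConst m₀ s * borelKernel 0 ζ -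
      kernelTransform (fun ξ => ∑' j : ℤ, poleTerm m₀ n₀' s j ξ) ζ) := by
    rw [fullBorel, hG]; ring
  rw [hv]
  refine h.congr_fun fun n => ?_
  ring

/-- The coefficients are at most (mn)ᵏ, so the k-sum is an exponential of rate mn|ζ|, beaten by |z|ⁿ
for ζ in this disk. -/
theorem summable_norm_mul_borelTerm_stepCoeff {m : ℕ} {Λ : ℂ} (hm : 0 < m) (hΛ : Λ ^ m = 1)
    (hs : s.re < 0) {ζ : ℂ} (hζ : m * ‖ζ‖ ≤ -s.re / 2) :
    Summable fun p : ℕ × ℕ => ‖Complex.exp s ^ (p.1 + 1) *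
      borelTerm (fun k => Λ ^ k * stepCoeff Λ (p.1 + 1) k) ζ p.2‖ := by
  have hΛ1 : ‖Λ‖ = 1 := Complex.norm_eq_one_of_pow_eq_one hΛ hm.ne'
  set z := Complex.exp s with hz
  have hzn : ‖z‖ = Real.exp s.re := Complex.norm_exp s
  have hle : ∀ n k : ℕ, ‖z ^ (n + 1) *
      borelTerm (fun k => Λ ^ k * stepCoeff Λ (n + 1) k) ζ k‖ ≤
      (‖z‖ ^ (n + 1) * (m * (n + 1 : ℕ))) *
        ((m * (n + 1 : ℕ) * ‖ζ‖) ^ k / (k.factorial : ℝ)) := by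
    intro n k
    have h1 := norm_stepCoeff_le hm hΛ n.succ_pos (k + 1)
    rw [Nat.cast_mul, pow_succ] at h1
    rw [borelTerm, norm_mul, norm_pow, norm_div, norm_mul, norm_mul, norm_pow, norm_pow, hΛ1,
      one_pow, one_mul, Complex.norm_natCast, mul_assoc, mul_pow]
    refine mul_le_mul_of_nonneg_left ?_ (by positivity)
    rw [mul_div_assoc', ← mul_assoc]
    refine div_le_div_of_nonneg_right ?_ (by positivity)
    refine mul_le_mul_of_nonneg_right (h1.trans_eq ?_) (by positivity)
    ring
  have hexpsum : ∀ n : ℕ, HasSum (fun k : ℕ => (‖z‖ ^ (n + 1) * (m * (n + 1 : ℕ))) *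
        (((m * (n + 1 : ℕ) * ‖ζ‖) ^ k / (k.factorial : ℝ))))
        ((‖z‖ ^ (n + 1) * (m * (n + 1 : ℕ))) * Real.exp (m * (n + 1 : ℕ) * ‖ζ‖)) := by
    intro n
    have := NormedSpace.expSeries_div_hasSum_exp (𝔸 := ℝ) (m * (n + 1 : ℕ) * ‖ζ‖)
    rw [← Real.exp_eq_exp_ℝ] at this
    exact this.mul_left _
  refine Summable.of_nonneg_of_le (fun _ => norm_nonneg _) (fun p => hle p.1 p.2) ?_
  refine (summable_prod_of_nonneg (f := fun p : ℕ × ℕ =>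
    (‖z‖ ^ (p.1 + 1) * (m * (p.1 + 1 : ℕ))) *
        (((m * (p.1 + 1 : ℕ) * ‖ζ‖) ^ p.2 / (p.2.factorial : ℝ))))
      (fun p => by simp only [Pi.zero_apply]; positivity)).2
    ⟨fun n => (hexpsum n).summable, ?_⟩
  simp only [(hexpsum _).tsum_eq]
  refine Summable.of_nonneg_of_le (fun n => by positivity) (fun n => ?_)
    ((summable_succ_mul_exp (x := s.re / 2) (by linarith)).mul_left (m : ℝ))
  rw [hzn]
  have h1 : Real.exp (m * (n + 1 : ℕ) * ‖ζ‖) ≤ Real.exp ((n + 1 : ℕ) * (-s.re / 2)) := by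
    refine Real.exp_le_exp.2 ?_
    have := mul_le_mul_of_nonneg_left hζ (Nat.cast_nonneg (α := ℝ) (n + 1))
    linarith
  calc _ ≤ Real.exp s.re ^ (n + 1) * (m * (n + 1 : ℕ)) *
        Real.exp ((n + 1 : ℕ) * (-s.re / 2)) := by gcongr
    _ = (Real.exp s.re ^ (n + 1) * Real.exp ((n + 1 : ℕ) * (-s.re / 2))) *
        (m * (n + 1 : ℕ)) := by ring
    _ = _ := by
        rw [← Real.exp_nat_mul, ← Real.exp_add, ← Real.exp_nat_mul,
          show ((n + 1 : ℕ) : ℝ) * s.re + ((n + 1 : ℕ) : ℝ) * (-s.re / 2) =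
            ((n + 1 : ℕ) : ℝ) * (s.re / 2) by ring]
        ring

/-- One double series, over powers k and over n: summation over n gives the coefficients of the
expansion, summation over k gives the Borel transforms of the single terms. -/
theorem hasSum_borelTerm_fullBorel (hm : 0 < m₀) (hcop : Nat.Coprime n₀ m₀)
    (hinv : (n₀ : ℤ) * n₀' ≡ 1 [ZMOD (m₀ : ℤ)]) (hs : s.re < 0) {ζ : ℂ}
    (hζ : m₀ * ‖ζ‖ ≤ -s.re / 2) :
    HasSum (borelTerm (fun k => resonance m₀ n₀ ^ k *
      expansionCoeff (resonance m₀ n₀) k (Complex.exp s)) ζ) (fullBorel m₀ n₀ n₀' s ζ) := by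
  have hB := hasSum_fullBorel hm hcop hinv hs hζ
  set Λ := resonance m₀ n₀ with hΛdef
  have hΛ : Λ ^ m₀ = 1 := resonance_pow_self hm n₀
  set z := Complex.exp s with hz
  refine hasSum_of_hasSum_swap (f := fun p : ℕ × ℕ => z ^ (p.2 + 1) *
    borelTerm (fun k => Λ ^ k * stepCoeff Λ (p.2 + 1) k) ζ p.1) ?_ ?_ ?_ hB
  · have hsw := summable_norm_mul_borelTerm_stepCoeff hm hΛ hs hζ
    exact hsw.of_norm.prod_symm
  · intro k
    have hz0 : 0 < ‖z‖ := norm_pos_iff.2 (Complex.exp_ne_zero s)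
    have hsc := summable_stepCoeff hm hΛ hz0 (norm_exp_lt_one hs) (k + 1)
    have h1 : HasSum (fun n : ℕ => stepCoeff Λ (n + 1) (k + 1) * z ^ (n + 1))
        (expansionCoeff Λ (k + 1) z) := by
      refine (Summable.of_norm ?_).hasSum
      refine hsc.congr fun n => ?_
      rw [norm_mul, norm_pow]
    have h2 := h1.mul_left (Λ ^ (k + 1) * ζ ^ k / (k.factorial : ℂ))
    have hv : borelTerm (fun k => Λ ^ k * expansionCoeff Λ k z) ζ k =
        Λ ^ (k + 1) * ζ ^ k / (k.factorial : ℂ) * expansionCoeff Λ (k + 1) z := by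
      rw [borelTerm]; ring
    rw [hv]
    refine h2.congr_fun fun n => ?_
    rw [borelTerm]; ring
  · intro n
    have h := (hasSum_borelTerm_stepCoeff hm hΛ (n := n + 1) n.succ_pos ζ).mul_left (z ^ (n + 1))
    exact h

end NearZero

/-! ### The singular points and the main sheet -/

section SingularPoints

variable {m₀ : ℕ} {n₀' : ℤ} {s : ℂ}

theorem mu_ne_zero (hm : 0 < m₀) {j : ℤ} (hj : j ≠ 0) : mu m₀ j ≠ 0 := by
  have hm' : (m₀ : ℂ) ≠ 0 := by exact_mod_cast hm.ne'
  have hj' : (j : ℂ) ≠ 0 := by exact_mod_cast hj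
  exact div_ne_zero hm' (mul_ne_zero two_pi_I_ne_zero hj')

/-- Pulled back to ξ, the poles 2πil of the geometric series are exactly the ξ_{j,b'}: the class b
modulo m₀ and the index l combine into the single integer b' = b − l m₀. -/
theorem shiftedLog_add_mu_mul_sub (hm : 0 < m₀) {j : ℤ} (hj : j ≠ 0) (b l : ℤ) (ξ : ℂ) :
    shiftedLog m₀ s b + mu m₀ j * ξ - 2 * Real.pi * Complex.I * l =
      mu m₀ j * (ξ - xi m₀ s j (b - l * m₀)) := by
  have hm' : (m₀ : ℂ) ≠ 0 := by exact_mod_cast hm.ne'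
  have hj' : (j : ℂ) ≠ 0 := by exact_mod_cast hj
  have hpi : (Real.pi : ℂ) ≠ 0 := by exact_mod_cast Real.pi_ne_zero
  rw [shiftedLog, mu, xi]
  push_cast
  field_simp
  linear_combination (4 * Real.pi ^ 2 * (b - l * m₀) * j : ℂ) * Complex.I_sq

theorem resCoeff_sub_mul (hm : 0 < m₀) (j b l : ℤ) :
    resCoeff m₀ n₀' j (b - l * m₀) = resCoeff m₀ n₀' j b := by
  have hm' : (m₀ : ℂ) ≠ 0 := by exact_mod_cast hm.ne'
  rw [resCoeff, resCoeff,
    ← Complex.exp_periodic.int_mul (-(j * l * n₀')) (2 * _ * _ * j * b * _ / _)]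
  congr 2
  push_cast
  field_simp
  ring

/-- The singular points lie on horizontal lines indexed by a, separated since Re s < 0.
Nonvanishing, injectivity and finiteness in disks rely on this. -/
theorem xi_im (m₀ : ℕ) (s : ℂ) (a b : ℤ) : (xi m₀ s a b).im = 2 * Real.pi * a / m₀ * -s.re := by
  have : xi m₀ s a b = ((2 * Real.pi * a / m₀ : ℝ) : ℂ) *
      (-Complex.I * s + ((2 * Real.pi * b / m₀ : ℝ) : ℂ)) := by
    rw [xi]; push_cast; ring
  rw [this, Complex.im_ofReal_mul]
  simp

theorem xi_ne_zero (hm : 0 < m₀) (hs : s.re < 0) {a : ℤ} (ha : a ≠ 0) (b : ℤ) :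
    xi m₀ s a b ≠ 0 := by
  intro h
  have h1 := xi_im m₀ s a b
  have hm' : (m₀ : ℝ) ≠ 0 := by exact_mod_cast hm.ne'
  have ha' : (a : ℝ) ≠ 0 := by exact_mod_cast ha
  rw [h, Complex.zero_im] at h1
  exact mul_ne_zero (div_ne_zero (mul_ne_zero (mul_ne_zero two_ne_zero Real.pi_ne_zero) ha') hm')
    (by linarith : -s.re ≠ 0) h1.symm

theorem xi_injective (hm : 0 < m₀) (hs : s.re < 0) {a b a' b' : ℤ} (ha : a ≠ 0)
    (h : xi m₀ s a b = xi m₀ s a' b') : a = a' ∧ b = b' := by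
  have hm' : (m₀ : ℝ) ≠ 0 := by exact_mod_cast hm.ne'
  have h1 := congrArg Complex.im h
  rw [xi_im, xi_im] at h1
  have h2 := mul_right_cancel₀ (by linarith : -s.re ≠ 0) h1
  have h3 : (a : ℝ) = a' := by
    have hpi := Real.pi_ne_zero
    field_simp at h2
    exact h2
  have haa : a = a' := by exact_mod_cast h3
  subst haa
  refine ⟨rfl, ?_⟩
  have hm'' : (m₀ : ℂ) ≠ 0 := by exact_mod_cast hm.ne'
  have hj' : (a : ℂ) ≠ 0 := by exact_mod_cast ha
  have hpi : (Real.pi : ℂ) ≠ 0 := by exact_mod_cast Real.pi_ne_zero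
  rw [xi, xi] at h
  have h4 := add_left_cancel (mul_left_cancel₀
    (div_ne_zero (mul_ne_zero (mul_ne_zero two_ne_zero hpi) hj') hm'') h)
  field_simp at h4
  exact_mod_cast h4

theorem notMem_singularSet_of_mem_mainSheet {S : Set ℂ} {ξ : ℂ} (h : ξ ∈ mainSheet S) : ξ ∉ S :=
  fun h' => h ξ h' (right_mem_segment ℝ _ _)

/-- The main sheet is star-shaped, so the segment of integration in `kernelTransform` stays inside
it. -/
theorem mul_mem_mainSheet {S : Set ℂ} {ξ : ℂ} (h : ξ ∈ mainSheet S) {x : ℝ}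
    (hx : x ∈ Set.Icc (0 : ℝ) 1) : (x : ℂ) * ξ ∈ mainSheet S := by
  intro ω hω hmem
  refine h ω hω ?_
  rw [segment_eq_image] at hmem ⊢
  obtain ⟨y, hy, rfl⟩ := hmem
  refine ⟨y * x, ⟨mul_nonneg hy.1 hx.1, mul_le_one₀ hy.2 hx.1 hx.2⟩, ?_⟩
  simp [mul_assoc]

theorem mul_mem_ball_zero {M : ℝ} {ξ : ℂ} (h : ξ ∈ ball (0 : ℂ) M) {x : ℝ}
    (hx : x ∈ Set.Icc (0 : ℝ) 1) : (x : ℂ) * ξ ∈ ball (0 : ℂ) M := by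
  rw [mem_ball_zero_iff] at h ⊢
  rw [norm_mul, Complex.norm_real, Real.norm_of_nonneg hx.1]
  exact (mul_le_of_le_one_left (norm_nonneg _) hx.2).trans_lt h

/-- A value ≤ 0 would put ω on the segment. Hence the principal branch of log(1 − ζ/ω) is the right
one on the main sheet. -/
theorem one_sub_mul_div_mem_slitPlane {ω ζ : ℂ} (hω : ω ∉ segment ℝ (0 : ℂ) ζ) {x : ℝ}
    (hx : x ∈ Set.Icc (0 : ℝ) 1) : 1 - x * ζ / ω ∈ Complex.slitPlane := by
  rcases eq_or_ne ω 0 with rfl | h0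
  · exact absurd (left_mem_segment ℝ _ _) hω
  rw [Complex.mem_slitPlane_iff_not_le_zero]
  intro hle
  refine hω ?_
  obtain ⟨hr, him⟩ := Complex.le_def.1 hle
  set r := (1 - x * ζ / ω).re with hrdef
  have hr' : (r : ℂ) = 1 - x * ζ / ω := Complex.ext rfl (by simpa using him.symm)
  rw [Complex.zero_re] at hr
  have h1 : (x : ℂ) * ζ = (1 - r : ℝ) * ω := by
    have : x * ζ / ω = (1 - r : ℝ) := by push_cast; rw [hr']; ring
    rw [← this]; field_simp
  have hr1 : (0 : ℝ) < 1 - r := by linarith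
  have hr1' : ((1 - r : ℝ) : ℂ) ≠ 0 := by exact_mod_cast hr1.ne'
  rw [segment_eq_image]
  refine ⟨x / (1 - r), ⟨div_nonneg hx.1 hr1.le, div_le_one_of_le₀ (by linarith [hx.2]) hr1.le⟩, ?_⟩
  simp only [smul_zero, zero_add, Complex.real_smul]
  rw [Complex.ofReal_div, div_mul_eq_mul_div, h1, mul_div_cancel_left₀ _ hr1']

theorem one_sub_div_mem_slitPlane {ω ζ : ℂ} (hω : ω ∉ segment ℝ (0 : ℂ) ζ) :
    1 - ζ / ω ∈ Complex.slitPlane := by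
  have := one_sub_mul_div_mem_slitPlane hω (x := 1) (by simp)
  rwa [Complex.ofReal_one, one_mul] at this

end SingularPoints

/-! ### Simple poles of the Borel transform in h -/

section GeomExp

/-- The difference equals e^q(e^(p−q) − 1)/((1 − e^p)(1 − e^q)). This Lipschitz bound supplies a
second factor μ_j in `poleTerm`, making the sum over j converge. -/
theorem norm_geomExp_sub_geomExp_le {y : ℝ} (hy : 0 < y) {p q : ℂ} (hq : q.re ≤ -y)
    (hpq : ‖p - q‖ ≤ y / 2) :
    ‖geomExp p - geomExp q‖ ≤ 1 / (1 - Real.exp (-y / 2)) ^ 2 * ‖p - q‖ := by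
  have hp : p.re ≤ -y / 2 := by
    have h1 := (Complex.re_le_norm (p - q)).trans hpq
    rw [Complex.sub_re] at h1
    linarith
  have hc : 0 < 1 - Real.exp (-y / 2) := by
    have : Real.exp (-y / 2) < 1 := Real.exp_lt_one_iff.2 (by linarith)
    linarith
  have hlow : ∀ w : ℂ, w.re ≤ -y / 2 → 1 - Real.exp (-y / 2) ≤ ‖1 - Complex.exp w‖ := by
    intro w hw
    have h1 := norm_sub_norm_le 1 (Complex.exp w)
    rw [norm_one, Complex.norm_exp] at h1
    linarith [Real.exp_le_exp.2 hw]
  have hp1 := hlow p hp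
  have hq1 := hlow q (by linarith)
  have hp0 : 1 - Complex.exp p ≠ 0 := norm_pos_iff.1 (hc.trans_le hp1)
  have hq0 : 1 - Complex.exp q ≠ 0 := norm_pos_iff.1 (hc.trans_le hq1)
  have e : geomExp p - geomExp q =
      Complex.exp q * (Complex.exp (p - q) - 1) / ((1 - Complex.exp p) * (1 - Complex.exp q)) := by
    rw [geomExp, geomExp, mul_sub, ← Complex.exp_add, add_sub_cancel, mul_one]
    field_simp
    ring
  have h2 : ‖Complex.exp q * (Complex.exp (p - q) - 1)‖ ≤ ‖p - q‖ := by
    rw [norm_mul, Complex.norm_exp]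
    have h3 := norm_exp_sub_one_le_mul_exp (p - q)
    calc Real.exp q.re * ‖Complex.exp (p - q) - 1‖
        ≤ Real.exp (-y) * (‖p - q‖ * Real.exp (y / 2)) :=
          mul_le_mul (Real.exp_le_exp.2 hq) (h3.trans (by gcongr)) (norm_nonneg _) (by positivity)
      _ = Real.exp (-y / 2) * ‖p - q‖ := by
          rw [mul_left_comm, ← Real.exp_add, show -y + y / 2 = -y / 2 by ring, mul_comm]
      _ ≤ ‖p - q‖ := mul_le_of_le_one_left (norm_nonneg _) (by linarith)
  rw [e, norm_div, norm_mul (1 - _), one_div_mul_eq_div, sq]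
  exact div_le_div₀ (norm_nonneg _) h2 (by positivity) (mul_le_mul hp1 hq1 hc.le (norm_nonneg _))

theorem differentiableAt_geomExp {p : ℂ} (hp : Complex.exp p ≠ 1) : DifferentiableAt ℂ geomExp p :=
  Complex.differentiable_exp.differentiableAt.div
    ((differentiableAt_const _).sub Complex.differentiable_exp.differentiableAt)
    (sub_ne_zero.2 hp.symm)

end GeomExp

section LogBorelPoles

variable {m₀ : ℕ} {n₀' : ℤ} {s : ℂ}

theorem norm_poleTerm_le (hm : 0 < m₀) (hs : s.re < 0) {j : ℤ} {ξ : ℂ}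
    (hξ : ‖mu m₀ j‖ * ‖ξ‖ ≤ -s.re / 2) :
    ‖poleTerm m₀ n₀' s j ξ‖ ≤
      1 / (1 - Real.exp (s.re / 2)) ^ 2 * ‖ξ‖ * ‖mu m₀ j‖ ^ 2 := by
  have hm' : (m₀ : ℝ) ≠ 0 := by exact_mod_cast hm.ne'
  have hb : ∀ b ∈ Finset.range m₀, ‖resCoeff m₀ n₀' j b *
      (geomExp (shiftedLog m₀ s b + mu m₀ j * ξ) - geomExp (shiftedLog m₀ s b))‖ ≤
      1 / m₀ * (1 / (1 - Real.exp (s.re / 2)) ^ 2 * (‖mu m₀ j‖ * ‖ξ‖)) := by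
    intro b _
    have h := norm_geomExp_sub_geomExp_le (y := -s.re) (by linarith)
      (p := shiftedLog m₀ s b + mu m₀ j * ξ) (q := shiftedLog m₀ s b)
      (by rw [shiftedLog_re, neg_neg]) (by rw [add_sub_cancel_left, norm_mul]; exact hξ)
    rw [add_sub_cancel_left, norm_mul, neg_neg] at h
    rw [norm_mul, norm_resCoeff]
    exact mul_le_mul_of_nonneg_left h (by positivity)
  have h1 := norm_sum_le_of_le _ hb
  rw [Finset.sum_const, Finset.card_range, nsmul_eq_mul] at h1
  rw [poleTerm, norm_mul]
  calc _ ≤ ‖mu m₀ j‖ * _ := mul_le_mul_of_nonneg_left h1 (norm_nonneg _)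
    _ = _ := by field_simp

theorem differentiableOn_poleTerm (hs : s.re < 0) {j : ℤ} {M : ℝ}
    (hM : ‖mu m₀ j‖ * M ≤ -s.re / 2) :
    DifferentiableOn ℂ (poleTerm m₀ n₀' s j) (ball 0 M) := by
  intro ξ hξ
  have hξ' : ‖ξ‖ < M := by simpa using hξ
  refine DifferentiableAt.differentiableWithinAt ?_
  unfold poleTerm
  refine DifferentiableAt.const_mul (DifferentiableAt.fun_sum fun b _ =>
    DifferentiableAt.const_mul (DifferentiableAt.sub_const ?_ _) _) _
  refine DifferentiableAt.comp (g := geomExp) ξ (differentiableAt_geomExp fun h => ?_)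
    ((differentiableAt_id.const_mul _).const_add _)
  have h1 := congrArg norm h
  rw [Complex.norm_exp, norm_one, Real.exp_eq_one_iff, Complex.add_re, shiftedLog_re] at h1
  have h2 := Complex.re_le_norm (mu m₀ j * ξ)
  rw [norm_mul] at h2
  have h3 := mul_le_mul_of_nonneg_left hξ'.le (norm_nonneg (mu m₀ j))
  linarith

/-- The polar part of a single term in a disk. -/
theorem exists_neg_poleTerm_eq (hm : 0 < m₀) {j : ℤ} (hj : j ≠ 0) {M : ℝ} {N : ℕ}
    (hN : ‖s‖ + 2 * Real.pi + m₀ * M ≤ N) :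
    ∃ G : ℂ → ℂ, DifferentiableOn ℂ G (ball 0 M) ∧
      ∀ ξ ∈ ball (0 : ℂ) M, ξ ∉ singularSet m₀ s → -poleTerm m₀ n₀' s j ξ =
        ∑ b ∈ Finset.range m₀, ∑ l ∈ Finset.Icc (-N : ℤ) N,
          resCoeff m₀ n₀' j (b - l * m₀) / (ξ - xi m₀ s j (b - l * m₀)) + G ξ := by
  obtain ⟨P, hP, hPe⟩ := exists_geomExp_eq_sub_sum N
  have hmem : ∀ b ∈ Finset.range m₀, ∀ ξ ∈ ball (0 : ℂ) M,
      shiftedLog m₀ s (b : ℕ) + mu m₀ j * ξ ∈ ball (0 : ℂ) N := by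
    intro b hb ξ hξ
    have hm' : (0 : ℝ) < m₀ := by exact_mod_cast hm
    have hξ' : ‖ξ‖ < M := by simpa using hξ
    have hb' : (b : ℝ) ≤ m₀ := by exact_mod_cast (Finset.mem_range.1 hb).le
    rw [mem_ball_zero_iff]
    have h1 : ‖(2 * Real.pi * Complex.I * ((b : ℕ) : ℤ) / m₀ : ℂ)‖ ≤ 2 * Real.pi := by
      rw [norm_div, norm_mul, norm_two_pi_I, Complex.norm_natCast, Int.cast_natCast,
        Complex.norm_natCast, div_le_iff₀ hm']
      exact mul_le_mul_of_nonneg_left hb' (by positivity)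
    have h2 : ‖mu m₀ j * ξ‖ < m₀ * M := by
      rw [norm_mul]
      calc _ ≤ m₀ * ‖ξ‖ := mul_le_mul_of_nonneg_right (norm_mu_le_self m₀ j) (norm_nonneg _)
        _ < _ := mul_lt_mul_of_pos_left hξ' hm'
    have h3 := norm_add_le (shiftedLog m₀ s (b : ℕ)) (mu m₀ j * ξ)
    have h4 := norm_add_le s (2 * Real.pi * Complex.I * ((b : ℕ) : ℤ) / m₀ : ℂ)
    rw [shiftedLog] at h3 ⊢
    linarith
  refine ⟨fun ξ => -mu m₀ j * ∑ b ∈ Finset.range m₀, resCoeff m₀ n₀' j b *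
    (P (shiftedLog m₀ s b + mu m₀ j * ξ) - geomExp (shiftedLog m₀ s b)), ?_, ?_⟩
  · refine DifferentiableOn.const_mul (DifferentiableOn.fun_sum fun b hb =>
      DifferentiableOn.const_mul (DifferentiableOn.sub ?_ (differentiableOn_const _)) _) _
    exact hP.comp (f := fun ξ => shiftedLog m₀ s b + mu m₀ j * ξ) (by fun_prop) (hmem b hb)
  · intro ξ hξ hξS
    have hμ := mu_ne_zero hm hj
    beta_reduce
    rw [poleTerm, ← neg_mul, Finset.mul_sum, Finset.mul_sum, ← Finset.sum_add_distrib]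
    refine Finset.sum_congr rfl fun b hb => ?_
    rw [hPe _ (hmem b hb ξ hξ)]
    · have e : ∀ l : ℤ, 1 / (shiftedLog m₀ s b + mu m₀ j * ξ - 2 * Real.pi * Complex.I * l) =
          1 / mu m₀ j * (1 / (ξ - xi m₀ s j (b - l * m₀))) := fun l => by
        rw [shiftedLog_add_mu_mul_sub hm hj, one_div_mul_one_div]
      have e' : ∑ l ∈ Finset.Icc (-N : ℤ) N,
          resCoeff m₀ n₀' j (b - l * m₀) / (ξ - xi m₀ s j (b - l * m₀)) =
          resCoeff m₀ n₀' j b * ∑ l ∈ Finset.Icc (-N : ℤ) N,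
            1 / (ξ - xi m₀ s j (b - l * m₀)) := by
        rw [Finset.mul_sum]
        exact Finset.sum_congr rfl fun l _ => by rw [resCoeff_sub_mul hm, mul_one_div]
      rw [e', Finset.sum_congr rfl fun l _ => e l, ← Finset.mul_sum]
      field_simp
      ring
    · intro l hl
      rw [← sub_eq_zero, shiftedLog_add_mu_mul_sub hm hj] at hl
      exact hξS ⟨j, _, hj, sub_eq_zero.1 ((mul_eq_zero.1 hl).resolve_left hμ)⟩

/-- In any disk, the Borel transform in the variable `log (q / Λ₀)` is the sum of finitely many
simple poles and of a holomorphic function. -/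
theorem exists_logBorel_eq (hm : 0 < m₀) (n₀ : ℕ) (n₀' : ℤ) (hs : s.re < 0) (M : ℝ) :
    ∃ (F : Finset (ℤ × ℤ)) (G : ℂ → ℂ), (∀ p ∈ F, p.1 ≠ 0) ∧
      (∀ a b : ℤ, a ≠ 0 → xi m₀ s a b ∈ ball (0 : ℂ) M → (a, b) ∈ F) ∧
      DifferentiableOn ℂ G (ball 0 M) ∧
      ∀ ξ ∈ ball (0 : ℂ) M, ξ ∉ singularSet m₀ s → logBorel m₀ n₀ n₀' s ξ =
        ∑ p ∈ F, resCoeff m₀ n₀' p.1 p.2 / (ξ - xi m₀ s p.1 p.2) + G ξ := by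
  rcases le_or_gt M 0 with hM0 | hM0
  · refine ⟨∅, 0, by simp, fun a b _ h => ?_, differentiableOn_const 0, fun ξ h => ?_⟩ <;>
      simp [ball_eq_empty.2 hM0] at h
  have hm' : (0 : ℝ) < m₀ := by exact_mod_cast hm
  have hmC : (m₀ : ℂ) ≠ 0 := by exact_mod_cast hm.ne'
  -- Beyond J the argument of the geometric series keeps a negative real part on the whole disk, so
  -- those terms are holomorphic; N bounds all arguments of the finitely many others.
  obtain ⟨J, hJ⟩ := exists_nat_ge (m₀ * M / -s.re)
  obtain ⟨N, hN⟩ := exists_nat_ge (‖s‖ + 2 * Real.pi + m₀ * M)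
  have hy : 0 < -s.re := by linarith
  rw [div_le_iff₀ hy] at hJ
  set S := (Finset.Icc (-J : ℤ) J).erase 0 with hS
  have hSne : ∀ j ∈ S, j ≠ 0 := fun j hj => Finset.ne_of_mem_erase hj
  have htail : ∀ j : ℤ, j ∉ S → ‖mu m₀ j‖ * M ≤ -s.re / 2 := by
    intro j hj
    rcases eq_or_ne j 0 with rfl | hj0
    · rw [mu_zero]; simp; linarith
    have hjJ : (J : ℤ) < |j| := by
      by_contra h
      exact hj (Finset.mem_erase.2 ⟨hj0, Finset.mem_Icc.2 (abs_le.1 (not_lt.1 h))⟩)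
    have hjJ' : (J : ℝ) < |(j : ℝ)| := by exact_mod_cast hjJ
    have hpos : 0 < |(j : ℝ)| := (Nat.cast_nonneg J).trans_lt hjJ'
    rw [norm_mu, div_mul_eq_mul_div, div_le_iff₀ (by positivity)]
    calc (m₀ : ℝ) * M ≤ J * -s.re := hJ
      _ ≤ |(j : ℝ)| * -s.re := mul_le_mul_of_nonneg_right hjJ'.le hy.le
      _ ≤ Real.pi * (|(j : ℝ)| * -s.re) :=
          le_mul_of_one_le_left (by positivity) (by linarith [Real.pi_gt_three])
      _ = _ := by ring
  choose! Gj hGj hGje using fun j (hj : j ∈ S) =>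
    exists_neg_poleTerm_eq (s := s) (n₀' := n₀') hm (hSne j hj) hN
  set T : ℤ → ℂ → ℂ := fun j ξ => if j ∈ S then 0 else poleTerm m₀ n₀' s j ξ with hT
  set K := 1 / (1 - Real.exp (s.re / 2)) ^ 2 with hK
  have hTb : ∀ j, ∀ ξ ∈ ball (0 : ℂ) M, ‖T j ξ‖ ≤ K * M * ‖mu m₀ j‖ ^ 2 := by
    intro j ξ hξ
    have hξ' : ‖ξ‖ < M := by simpa using hξ
    simp only [hT]
    split_ifs with hj
    · rw [norm_zero]; positivity
    · refine (norm_poleTerm_le hm hs ?_).trans ?_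
      · exact (mul_le_mul_of_nonneg_left hξ'.le (norm_nonneg _)).trans (htail j hj)
      · gcongr
  have hTsum : Summable fun j => K * M * ‖mu m₀ j‖ ^ 2 := (summable_norm_mu_sq m₀).mul_left _
  -- By Euclidean division by m₀, a triple (j, b, l) with 0 ≤ b < m₀ is determined by (j, b − l m₀),
  -- so no pole is counted twice.
  set ι : ℤ × ℕ × ℤ → ℤ × ℤ := fun q => (q.1, q.2.1 - q.2.2 * m₀) with hι
  set I := S ×ˢ Finset.range m₀ ×ˢ Finset.Icc (-N : ℤ) N with hI
  have hinj : Set.InjOn ι I := by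
    rintro ⟨j, b, l⟩ h ⟨j', b', l'⟩ h' he
    simp only [hI, Finset.coe_product, Set.mem_prod, Finset.coe_range, Set.mem_Iio] at h h'
    simp only [hι, Prod.mk.injEq] at he ⊢
    obtain ⟨rfl, he⟩ := he
    have hb1 : ((b : ℤ) - l * m₀) % m₀ = b := by
      rw [Int.sub_mul_emod_self_right]
      exact Int.emod_eq_of_lt (by positivity) (by exact_mod_cast h.2.1)
    have hb2 : ((b' : ℤ) - l' * m₀) % m₀ = b' := by
      rw [Int.sub_mul_emod_self_right]
      exact Int.emod_eq_of_lt (by positivity) (by exact_mod_cast h'.2.1)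
    have hbb : (b : ℤ) = b' := by rw [← hb1, he, hb2]
    refine ⟨rfl, by exact_mod_cast hbb, ?_⟩
    have hm0 : (m₀ : ℤ) ≠ 0 := by exact_mod_cast hm.ne'
    exact mul_right_cancel₀ hm0 (by linarith)
  refine ⟨I.image ι, fun ξ => constSum m₀ n₀ s + ∑ j ∈ S, Gj j ξ - ∑' j, T j ξ, ?_, ?_, ?_, ?_⟩
  · intro p hp
    obtain ⟨q, hq, rfl⟩ := Finset.mem_image.1 hp
    exact hSne _ (Finset.mem_product.1 hq).1
  · intro a b ha hab
    have hn : ‖xi m₀ s a b‖ < M := by simpa using hab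
    have hbe : (b % m₀).toNat - (-(b / m₀)) * (m₀ : ℤ) = b := by
      rw [Int.toNat_of_nonneg (Int.emod_nonneg _ (by exact_mod_cast hm.ne'))]
      linarith [Int.emod_add_mul_ediv b m₀, mul_comm (m₀ : ℤ) (b / m₀)]
    have hlt : (b % m₀).toNat < m₀ := by
      have := Int.emod_lt_of_pos b (by exact_mod_cast hm : (0 : ℤ) < m₀)
      omega
    refine Finset.mem_image.2 ⟨(a, (b % m₀).toNat, -(b / m₀)), ?_, ?_⟩
    · refine Finset.mem_product.2 ⟨Finset.mem_erase.2 ⟨ha, Finset.mem_Icc.2 (abs_le.1 ?_)⟩,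
        Finset.mem_product.2 ⟨Finset.mem_range.2 hlt, Finset.mem_Icc.2 (abs_le.1 ?_)⟩⟩
      · have h1 := (Complex.abs_im_le_norm _).trans_lt hn
        rw [xi_im, abs_mul, abs_of_pos hy, abs_div, abs_mul, abs_of_pos (a := 2 * Real.pi)
          (by positivity), abs_of_pos hm', div_mul_eq_mul_div, div_lt_iff₀ hm'] at h1
        have h2 : |(a : ℝ)| * -s.re ≤ J * -s.re := by
          refine le_trans ?_ hJ
          have : |(a : ℝ)| * -s.re ≤ (2 * Real.pi) * (|(a : ℝ)| * -s.re) :=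
            le_mul_of_one_le_left (by positivity) (by linarith [Real.pi_gt_three])
          nlinarith
        exact_mod_cast le_of_mul_le_mul_right h2 hy
      · have h0 := shiftedLog_add_mu_mul_sub (s := s) hm ha (b % m₀).toNat (-(b / m₀)) (xi m₀ s a b)
        rw [hbe, sub_self, mul_zero, sub_eq_zero] at h0
        have h1 := congrArg norm h0
        rw [norm_mul, norm_two_pi_I, Complex.norm_intCast] at h1
        have h2 := norm_add_le (shiftedLog m₀ s (b % m₀).toNat) (mu m₀ a * xi m₀ s a b)
        have h3 := norm_add_le s (2 * Real.pi * Complex.I * (((b % m₀).toNat : ℕ) : ℤ) / m₀ : ℂ)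
        have h4 : ‖(2 * Real.pi * Complex.I * (((b % m₀).toNat : ℕ) : ℤ) / m₀ : ℂ)‖ ≤
            2 * Real.pi := by
          rw [norm_div, norm_mul, norm_two_pi_I, Complex.norm_natCast, Int.cast_natCast,
            Complex.norm_natCast, div_le_iff₀ hm']
          exact mul_le_mul_of_nonneg_left (by exact_mod_cast hlt.le) (by positivity)
        have h5 : ‖mu m₀ a * xi m₀ s a b‖ ≤ m₀ * M := by
          rw [norm_mul]
          exact mul_le_mul (norm_mu_le_self m₀ a) hn.le (norm_nonneg _) hm'.le
        rw [h1] at h2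
        rw [shiftedLog] at h2
        have h6 : |((-(b / m₀) : ℤ) : ℝ)| ≤ 2 * Real.pi * |((-(b / m₀) : ℤ) : ℝ)| :=
          le_mul_of_one_le_left (abs_nonneg _) (by linarith [Real.pi_gt_three])
        have h7 : |((-(b / m₀) : ℤ) : ℝ)| ≤ N := by linarith
        exact_mod_cast h7
    · exact Prod.ext rfl hbe
  · refine DifferentiableOn.sub (DifferentiableOn.const_add _
      (DifferentiableOn.fun_sum fun j hj => hGj j hj))
      (Complex.differentiableOn_tsum_of_summable_norm hTsum (fun j => ?_) isOpen_ball hTb)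
    simp only [hT]
    split_ifs with hj
    · exact differentiableOn_const _
    · exact differentiableOn_poleTerm hs (htail j hj)
  · intro ξ hξ hξS
    have hTs : HasSum (fun j => T j ξ) (∑' j, T j ξ) :=
      (Summable.of_norm_bounded hTsum fun j => hTb j ξ hξ).hasSum
    have hSs : HasSum (fun j => if j ∈ S then poleTerm m₀ n₀' s j ξ else 0)
        (∑ j ∈ S, poleTerm m₀ n₀' s j ξ) := by
      rw [Finset.sum_congr rfl fun j hj => (if_pos hj : (if j ∈ S then
        poleTerm m₀ n₀' s j ξ else 0) = _).symm]
      exact hasSum_sum_of_ne_finset_zero fun j hj => if_neg hj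
    have htot : ∑' j, poleTerm m₀ n₀' s j ξ = ∑ j ∈ S, poleTerm m₀ n₀' s j ξ + ∑' j, T j ξ := by
      refine ((hSs.add hTs).congr_fun fun j => ?_).tsum_eq
      simp only [hT]
      split_ifs <;> simp
    have hfin : -∑ j ∈ S, poleTerm m₀ n₀' s j ξ = ∑ p ∈ I.image ι,
        resCoeff m₀ n₀' p.1 p.2 / (ξ - xi m₀ s p.1 p.2) + ∑ j ∈ S, Gj j ξ := by
      rw [Finset.sum_image hinj, hI, Finset.sum_product, ← Finset.sum_neg_distrib,
        ← Finset.sum_add_distrib]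
      refine Finset.sum_congr rfl fun j hj => ?_
      rw [hGje j hj ξ hξ hξS, Finset.sum_product]
    rw [logBorel, htot]
    linear_combination hfin

end LogBorelPoles

/-! ### The transform of a simple pole -/

section KernelSlope

theorem differentiable_dslope {f : ℂ → ℂ} (hf : Differentiable ℂ f) (c : ℂ) :
    Differentiable ℂ (dslope f c) := by
  rw [← differentiableOn_univ] at hf ⊢
  exact (Complex.differentiableOn_dslope univ_mem).2 hf

/-- The divided difference in `ξ`, with base point `ω`, of `borelKernel ξ ζ`. -/
noncomputable def kernelSlope (ω ξ ζ : ℂ) : ℂ :=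
  Real.circleAverage (fun t => Complex.exp (ζ / t - ω / Complex.log (1 + t)) / Complex.log (1 + t) *
    (-(1 / Complex.log (1 + t)) * dslope Complex.exp 0 (-(ξ - ω) / Complex.log (1 + t)))) 0 (1 / 2)

theorem mul_dslope_exp (w : ℂ) : w * dslope Complex.exp 0 w = Complex.exp w - 1 := by
  have := sub_smul_dslope Complex.exp 0 w
  simpa using this

theorem continuousOn_slopeIntegrand {X : Type*} [TopologicalSpace X] {ω : ℂ} {s : Set X}
    {u v : X → ℂ} (hu : ContinuousOn u s) (hv : ContinuousOn v s) :
    ContinuousOn (fun p : X × ℂ => Complex.exp (v p.1 / p.2 - ω / Complex.log (1 + p.2)) /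
      Complex.log (1 + p.2) * (-(1 / Complex.log (1 + p.2)) *
        dslope Complex.exp 0 (-(u p.1 - ω) / Complex.log (1 + p.2))))
      (s ×ˢ sphere 0 (1 / 2)) := by
  have h2 : (0 : ℝ) < 1 / 2 := by norm_num
  have hl : ContinuousOn (fun p : X × ℂ => Complex.log (1 + p.2)) (s ×ˢ sphere 0 (1 / 2)) :=
    (continuousOn_log_one_add (by norm_num)).comp continuousOn_snd fun p hp => hp.2
  have hl0 : ∀ p ∈ s ×ˢ sphere (0 : ℂ) (1 / 2), Complex.log (1 + p.2) ≠ 0 := fun p hp =>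
    (ne_zero_and_mem_ball h2 (by norm_num) hp.2).2.2
  have hu' : ContinuousOn (fun p : X × ℂ => u p.1) (s ×ˢ sphere 0 (1 / 2)) :=
    hu.comp continuousOn_fst fun p hp => hp.1
  refine (continuousOn_kernelIntegrand h2 (by norm_num) continuousOn_const hv).mul
    ((continuousOn_const.div hl hl0).neg.mul ?_)
  exact (differentiable_dslope Complex.differentiable_exp 0).continuous.comp_continuousOn
    ((hu'.sub continuousOn_const).neg.div hl hl0)

theorem differentiable_kernelSlope (ω : ℂ) {u v : ℂ → ℂ} (hu : Differentiable ℂ u)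
    (hv : Differentiable ℂ v) : Differentiable ℂ fun ζ => kernelSlope ω (u ζ) (v ζ) := by
  have h2 : (0 : ℝ) < 1 / 2 := by norm_num
  rw [← differentiableOn_univ]
  refine differentiableOn_circleAverage (F := fun ζ t => Complex.exp (v ζ / t -
    ω / Complex.log (1 + t)) / Complex.log (1 + t) * (-(1 / Complex.log (1 + t)) *
      dslope Complex.exp 0 (-(u ζ - ω) / Complex.log (1 + t)))) isOpen_univ h2
    (continuousOn_slopeIntegrand hu.continuous.continuousOn hv.continuous.continuousOn)
    fun t ht => ?_
  have hd := differentiable_dslope Complex.differentiable_exp 0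
  refine Differentiable.differentiableOn ?_
  exact (((hv.div_const _).sub_const _).cexp.div_const _).mul
    ((hd.comp ((hu.sub_const _).neg.div_const _)).const_mul _)

theorem continuous_kernelSlope (ω : ℂ) : Continuous fun p : ℂ × ℂ => kernelSlope ω p.1 p.2 := by
  have h2 : (0 : ℝ) < 1 / 2 := by norm_num
  simp only [kernelSlope, Real.circleAverage_def]
  refine Continuous.const_smul
    (intervalIntegral.continuous_parametric_intervalIntegral_of_continuous' ?_ _ _) _
  refine (continuousOn_slopeIntegrand (X := ℂ × ℂ) (s := Set.univ)
    continuousOn_fst continuousOn_snd).comp_continuous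
    (f := fun p : (ℂ × ℂ) × ℝ => (p.1, circleMap 0 (1 / 2) p.2)) (by fun_prop) ?_
  exact fun p => ⟨trivial, circleMap_mem_sphere_zero h2 _⟩

/-- The exponential factor exp(−ξ/log(1 + t)) is replaced by its divided difference under the
average; dividing by ξ − ω thus leaves an entire remainder. -/
theorem borelKernel_sub_borelKernel (ω ξ ζ : ℂ) :
    borelKernel ξ ζ - borelKernel ω ζ = (ξ - ω) * kernelSlope ω ξ ζ := by
  have h2 : (0 : ℝ) < 1 / 2 := by norm_num
  have hc : ∀ η : ℂ, CircleIntegrable (fun t => Complex.exp (ζ / t - η / Complex.log (1 + t)) /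
      Complex.log (1 + t)) 0 (1 / 2) := fun η =>
    circleIntegrable_of_continuousOn h2 ((continuousOn_kernelIntegrand (X := ℂ) (s := Set.univ) h2
      (by norm_num) (u := fun _ => η) (v := fun _ => ζ) continuousOn_const
      continuousOn_const).comp (f := fun t : ℂ => ((0 : ℂ), t)) (by fun_prop) fun t ht =>
        ⟨trivial, ht⟩)
  rw [borelKernel_eq_circleAverage h2 (by norm_num), borelKernel_eq_circleAverage h2 (by norm_num),
    kernelSlope, ← smul_eq_mul, ← Real.circleAverage_fun_smul, ← Real.circleAverage_fun_sub
      (hc ξ) (hc ω)]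
  refine Real.circleAverage_congr_sphere fun t ht => ?_
  rw [abs_of_pos h2] at ht
  have hl := (ne_zero_and_mem_ball h2 (by norm_num) ht).2.2
  have h3 := mul_dslope_exp (-(ξ - ω) / Complex.log (1 + t))
  have h4 : ζ / t - ξ / Complex.log (1 + t) = (ζ / t - ω / Complex.log (1 + t)) +
      -(ξ - ω) / Complex.log (1 + t) := by ring
  simp only [smul_eq_mul]
  rw [h4, Complex.exp_add]
  linear_combination (-Complex.exp (ζ / t - ω / Complex.log (1 + t)) / Complex.log (1 + t)) * h3

end KernelSlope

section KernelTransformPoles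

/-- The function log(1 − xζ/ω) is a primitive, because its argument stays in the slit plane along
the segment. -/
theorem mul_integral_inv_sub {ω ζ : ℂ} (hω : ω ∉ segment ℝ (0 : ℂ) ζ) :
    ζ * ∫ x in (0 : ℝ)..1, 1 / ((x : ℂ) * ζ - ω) = Complex.log (1 - ζ / ω) := by
  have h0 : ω ≠ 0 := by rintro rfl; exact hω (left_mem_segment ℝ _ _)
  have hmem : ∀ x ∈ Set.uIcc (0 : ℝ) 1, 1 - x * ζ / ω ∈ Complex.slitPlane := fun x hx =>
    one_sub_mul_div_mem_slitPlane hω (by rwa [Set.uIcc_of_le zero_le_one] at hx)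
  have hne : ∀ x ∈ Set.uIcc (0 : ℝ) 1, (x : ℂ) * ζ - ω ≠ 0 := by
    intro x hx h
    refine Complex.slitPlane_ne_zero (hmem x hx) ?_
    rw [sub_eq_zero.1 h, div_self h0, sub_self]
  have hder : ∀ x ∈ Set.uIcc (0 : ℝ) 1,
      HasDerivAt (fun x : ℝ => Complex.log (1 - x * ζ / ω)) (ζ * (1 / (x * ζ - ω))) x := by
    intro x hx
    have h1 : HasDerivAt (fun x : ℝ => 1 - (x : ℂ) * ζ / ω) (-(1 * ζ / ω)) x :=
      (((Complex.ofRealCLM.hasDerivAt (x := x)).mul_const ζ).div_const ω).const_sub 1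
    convert h1.clog_real (hmem x hx) using 1
    have h2 := hne x hx
    have h3 : ω - x * ζ ≠ 0 := by rw [← neg_sub]; exact neg_ne_zero.2 h2
    have h4 : 1 - x * ζ / ω = (ω - x * ζ) / ω := by field_simp
    rw [h4, ← neg_sub ω ((x : ℂ) * ζ)]
    field_simp
  rw [← intervalIntegral.integral_const_mul, intervalIntegral.integral_eq_sub_of_hasDerivAt hder]
  · simp
  · refine ContinuousOn.intervalIntegrable (continuousOn_const.mul
      (continuousOn_const.div (by fun_prop) hne))

/-- The transform of a simple pole. -/
theorem exists_kernelTransform_inv_sub (ω : ℂ) : ∃ H : ℂ → ℂ, Differentiable ℂ H ∧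
    ∀ ζ : ℂ, ω ∉ segment ℝ (0 : ℂ) ζ → kernelTransform (fun ξ => 1 / (ξ - ω)) ζ =
      Complex.exp (-ω / 2) / (ζ - ω) + LomegaHat ω (ζ - ω) * Complex.log (1 - ζ / ω) + H ζ := by
  have hE : Differentiable ℂ fun ξ : ℂ => Complex.exp (-ξ / 2) := by fun_prop
  -- The two remainders after freezing ξ = ω in the numerators: that of exp(−ζ/2) in the boundary
  -- term, and that of the kernel in the integral.
  refine ⟨fun ζ => dslope (fun ξ : ℂ => Complex.exp (-ξ / 2)) ω ζ +
    ζ * ∫ x in (0 : ℝ)..1, kernelSlope ω (x * ζ) ζ, ?_, ?_⟩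
  · refine (differentiable_dslope hE ω).add (differentiable_id.mul ?_)
    rw [← differentiableOn_univ]
    refine differentiableOn_intervalIntegral (F := fun ζ (x : ℝ) => kernelSlope ω (x * ζ) ζ)
      isOpen_univ ?_ fun x _ => (differentiable_kernelSlope ω (u := fun ζ => x * ζ)
        (v := fun ζ => ζ) (by fun_prop) (by fun_prop)).differentiableOn
    exact ((continuous_kernelSlope ω).comp (f := fun p : ℂ × ℝ => ((p.2 : ℂ) * p.1, p.1))
      (by fun_prop)).continuousOn
  · intro ζ hω
    have h0 : ω ≠ 0 := by rintro rfl; exact hω (left_mem_segment ℝ _ _)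
    have hζω : ζ - ω ≠ 0 := by
      rw [sub_ne_zero]; rintro rfl; exact hω (right_mem_segment ℝ _ _)
    have hne : ∀ x ∈ Set.uIcc (0 : ℝ) 1, (x : ℂ) * ζ - ω ≠ 0 := by
      intro x hx h
      refine Complex.slitPlane_ne_zero (one_sub_mul_div_mem_slitPlane hω
        (by rwa [Set.uIcc_of_le zero_le_one] at hx)) ?_
      rw [sub_eq_zero.1 h, div_self h0, sub_self]
    have h1 := sub_smul_dslope (fun ξ : ℂ => Complex.exp (-ξ / 2)) ω ζ
    rw [smul_eq_mul] at h1
    have h2 : ∫ x in (0 : ℝ)..1, 1 / ((x : ℂ) * ζ - ω) * borelKernel (x * ζ) ζ =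
        (∫ x in (0 : ℝ)..1, 1 / ((x : ℂ) * ζ - ω)) * borelKernel ω ζ +
        ∫ x in (0 : ℝ)..1, kernelSlope ω (x * ζ) ζ := by
      rw [← intervalIntegral.integral_mul_const, ← intervalIntegral.integral_add]
      · refine intervalIntegral.integral_congr fun x hx => ?_
        have h3 := borelKernel_sub_borelKernel ω (x * ζ) ζ
        have h4 := hne x hx
        rw [sub_eq_iff_eq_add.1 h3]
        field_simp
        ring
      · exact ContinuousOn.intervalIntegrable ((continuousOn_const.div (by fun_prop) hne).mul
          continuousOn_const)
      · exact ((continuous_kernelSlope ω).comp (f := fun x : ℝ => ((x : ℂ) * ζ, ζ))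
          (by fun_prop)).intervalIntegrable _ _
    have h5 := mul_integral_inv_sub hω
    have h6 : Complex.exp (-ζ / 2) * (1 / (ζ - ω)) = Complex.exp (-ω / 2) / (ζ - ω) +
        dslope (fun ξ : ℂ => Complex.exp (-ξ / 2)) ω ζ := by
      have := sub_eq_iff_eq_add.1 h1.symm
      rw [this]
      field_simp
      ring
    rw [kernelTransform, h2, h6]
    rw [borelKernel] at *
    linear_combination LomegaHat ω (ζ - ω) * h5

theorem differentiableOn_kernelTransform {G : ℂ → ℂ} {M : ℝ}
    (hG : DifferentiableOn ℂ G (ball 0 M)) : DifferentiableOn ℂ (kernelTransform G) (ball 0 M) := by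
  unfold kernelTransform
  refine ((by fun_prop : Differentiable ℂ fun ζ : ℂ => Complex.exp (-ζ / 2)).differentiableOn.mul
    hG).add (differentiableOn_id.mul ?_)
  refine differentiableOn_intervalIntegral
    (F := fun ζ (x : ℝ) => G (x * ζ) * borelKernel (x * ζ) ζ) isOpen_ball ?_ fun x hx => ?_
  · refine ContinuousOn.mul (hG.continuousOn.comp (f := fun p : ℂ × ℝ => (p.2 : ℂ) * p.1)
      (by fun_prop) fun p hp => mul_mem_ball_zero hp.1 (by
        have := hp.2; rwa [Set.uIcc_of_le zero_le_one] at this)) ?_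
    exact (continuous_borelKernel.comp (f := fun p : ℂ × ℝ => ((p.2 : ℂ) * p.1, p.1))
      (by fun_prop)).continuousOn
  · rw [Set.uIcc_of_le zero_le_one] at hx
    refine (hG.comp (f := fun ζ : ℂ => x * ζ) (by fun_prop) fun ζ hζ =>
      mul_mem_ball_zero hζ hx).mul ?_
    exact (differentiable_borelKernel (u := fun ζ => x * ζ) (v := fun ζ => ζ) (by fun_prop)
      (by fun_prop)).differentiableOn

end KernelTransformPoles

/-! ### Structure of the Borel transform in a disk -/

section Structure

variable {m₀ : ℕ} {s : ℂ}

/-- In any disk, on the main sheet, the Borel transform is the sum of finitely many explicit simple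
singularities and of a function which is holomorphic in the whole disk. -/
theorem exists_fullBorel_eq (hm : 0 < m₀) (n₀ : ℕ) (n₀' : ℤ) (hs : s.re < 0) (M : ℝ) :
    ∃ (F : Finset (ℤ × ℤ)) (H : ℂ → ℂ), (∀ p ∈ F, p.1 ≠ 0) ∧
      (∀ a b : ℤ, a ≠ 0 → xi m₀ s a b ∈ ball (0 : ℂ) M → (a, b) ∈ F) ∧
      DifferentiableOn ℂ H (ball 0 M) ∧
      ∀ ζ ∈ ball (0 : ℂ) M ∩ mainSheet (singularSet m₀ s), fullBorel m₀ n₀ n₀' s ζ =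
        ∑ p ∈ F, resonance m₀ n₀ * resCoeff m₀ n₀' p.1 p.2 *
          (Complex.exp (-xi m₀ s p.1 p.2 / 2) / (ζ - xi m₀ s p.1 p.2) +
            LomegaHat (xi m₀ s p.1 p.2) (ζ - xi m₀ s p.1 p.2) *
              Complex.log (1 - ζ / xi m₀ s p.1 p.2)) + H ζ := by
  obtain ⟨F, G, hF0, hF, hG, hGe⟩ := exists_logBorel_eq hm n₀ n₀' hs M
  choose Hω hHω hHωe using exists_kernelTransform_inv_sub
  refine ⟨F, fun ζ => resonance m₀ n₀ * (∑ p ∈ F, resCoeff m₀ n₀' p.1 p.2 *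
    Hω (xi m₀ s p.1 p.2) ζ + kernelTransform G ζ + poleConst m₀ s * borelKernel 0 ζ),
    hF0, hF, ?_, ?_⟩
  · refine DifferentiableOn.const_mul (((DifferentiableOn.fun_sum fun p _ =>
      ((hHω _).const_mul _).differentiableOn).add (differentiableOn_kernelTransform hG)).add
      ((differentiable_borelKernel (u := fun _ => 0) (v := fun ζ => ζ) (by fun_prop)
        (by fun_prop)).const_mul _).differentiableOn) _
  · rintro ζ ⟨hζM, hζS⟩
    have hseg : ∀ p ∈ F, xi m₀ s p.1 p.2 ∉ segment ℝ (0 : ℂ) ζ := fun p hp =>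
      hζS _ ⟨p.1, p.2, hF0 p hp, rfl⟩
    have hne : ∀ p ∈ F, ∀ x ∈ Set.Icc (0 : ℝ) 1, (x : ℂ) * ζ - xi m₀ s p.1 p.2 ≠ 0 := by
      intro p hp x hx h
      refine notMem_singularSet_of_mem_mainSheet (mul_mem_mainSheet hζS hx) ?_
      exact ⟨p.1, p.2, hF0 p hp, sub_eq_zero.1 h⟩
    have h1 : kernelTransform (logBorel m₀ n₀ n₀' s) ζ = kernelTransform (fun ξ =>
        ∑ p ∈ F, resCoeff m₀ n₀' p.1 p.2 * (1 / (ξ - xi m₀ s p.1 p.2)) + G ξ) ζ := by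
      refine kernelTransform_congr fun x hx => ?_
      rw [hGe _ (mul_mem_ball_zero hζM hx)
        (notMem_singularSet_of_mem_mainSheet (mul_mem_mainSheet hζS hx))]
      simp only [mul_one_div]
    have hc : ∀ p ∈ F, ContinuousOn (fun x : ℝ => resCoeff m₀ n₀' p.1 p.2 *
        (1 / ((x : ℂ) * ζ - xi m₀ s p.1 p.2))) (Set.Icc 0 1) := fun p hp =>
      continuousOn_const.mul (continuousOn_const.div (by fun_prop) (hne p hp))
    have hcG : ContinuousOn (fun x : ℝ => G (x * ζ)) (Set.Icc 0 1) :=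
      hG.continuousOn.comp (f := fun x : ℝ => (x : ℂ) * ζ) (by fun_prop) fun x hx =>
        mul_mem_ball_zero hζM hx
    have hcs : ContinuousOn (fun x : ℝ => ∑ p ∈ F, resCoeff m₀ n₀' p.1 p.2 *
        (1 / ((x : ℂ) * ζ - xi m₀ s p.1 p.2))) (Set.Icc 0 1) := continuousOn_finsetSum _ hc
    have h3 := kernelTransform_add (G := fun ξ => ∑ p ∈ F, resCoeff m₀ n₀' p.1 p.2 *
      (1 / (ξ - xi m₀ s p.1 p.2))) (ζ := ζ) hcs hcG
    have h4 := kernelTransform_sum (S := F) (G := fun p ξ => resCoeff m₀ n₀' p.1 p.2 *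
      (1 / (ξ - xi m₀ s p.1 p.2))) (ζ := ζ) hc
    have h2 : ∀ p ∈ F, kernelTransform (fun ξ => resCoeff m₀ n₀' p.1 p.2 *
        (1 / (ξ - xi m₀ s p.1 p.2))) ζ = resCoeff m₀ n₀' p.1 p.2 *
          (Complex.exp (-xi m₀ s p.1 p.2 / 2) / (ζ - xi m₀ s p.1 p.2) +
            LomegaHat (xi m₀ s p.1 p.2) (ζ - xi m₀ s p.1 p.2) *
              Complex.log (1 - ζ / xi m₀ s p.1 p.2)) +
        resCoeff m₀ n₀' p.1 p.2 * Hω (xi m₀ s p.1 p.2) ζ := by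
      intro p hp
      rw [kernelTransform_const_mul _ (fun ξ => 1 / (ξ - xi m₀ s p.1 p.2)), hHωe _ _ (hseg p hp)]
      ring
    rw [fullBorel, h1, h3, h4, Finset.sum_congr rfl h2, Finset.sum_add_distrib]
    simp only [mul_assoc (resonance m₀ n₀), ← Finset.mul_sum]
    ring

end Structure

/-! ### Branches of the logarithm -/

section Logarithms

/-- Two continuous logarithms of proportional functions on a connected set differ by a constant. -/
theorem exists_eq_add_const_of_exp_eq {V : Set ℂ} (hV : IsPreconnected V) {f g : ℂ → ℂ} {κ : ℂ}
    (hf : ContinuousOn f V) (hg : ContinuousOn g V)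
    (h : ∀ ξ ∈ V, Complex.exp (f ξ) = κ * Complex.exp (g ξ)) :
    ∃ c : ℂ, ∀ ξ ∈ V, f ξ = g ξ + c := by
  rcases V.eq_empty_or_nonempty with rfl | ⟨ξ₀, hξ₀⟩
  · exact ⟨0, by simp⟩
  refine ⟨f ξ₀ - g ξ₀, ?_⟩
  -- Two lifts of the same map through the covering exp that agree at one point of a connected set
  -- agree everywhere.
  refine Complex.isCoveringMap_exp.eqOn_of_comp_eqOn hV hf (hg.add continuousOn_const)
    (fun ξ hξ => ?_) hξ₀ (by ring)
  refine Subtype.ext ?_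
  change Complex.exp (f ξ) = Complex.exp (g ξ + (f ξ₀ - g ξ₀))
  rw [Complex.exp_add, Complex.exp_sub, h ξ hξ, h ξ₀ hξ₀, mul_div_cancel_right₀ _
    (Complex.exp_ne_zero _), mul_comm]

/-- The logarithms of 1 form the discrete set 2πiℤ. -/
theorem eventually_eq_zero_of_exp_eq_one {X : Type*} [TopologicalSpace X] {f : X → ℂ} {c : X}
    (hf : ContinuousAt f c) (h0 : f c = 0) (h1 : ∀ᶠ x in 𝓝 c, Complex.exp (f x) = 1) :
    ∀ᶠ x in 𝓝 c, f x = 0 := by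
  have hball : ∀ᶠ x in 𝓝 c, f x ∈ ball (0 : ℂ) 1 :=
    hf.eventually_mem (by rw [h0]; exact ball_mem_nhds _ one_pos)
  filter_upwards [hball, h1] with x hx hx1
  obtain ⟨n, hn⟩ := Complex.exp_eq_one_iff.1 hx1
  rw [mem_ball_zero_iff, hn, norm_mul, norm_two_pi_I, Complex.norm_intCast] at hx
  have hn0 : n = 0 := by
    by_contra hne
    have : (1 : ℝ) ≤ |(n : ℝ)| := by exact_mod_cast Int.one_le_abs hne
    nlinarith [Real.pi_gt_three]
  rw [hn, hn0]; simp

/-- The logarithm of a nowhere vanishing path. -/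
theorem exists_path_log {f : unitInterval → ℂ} (hf : Continuous f) (h0 : ∀ t, f t ≠ 0)
    (h1 : f 0 = 1) :
    ∃ l : unitInterval → ℂ, Continuous l ∧ l 0 = 0 ∧ ∀ t, Complex.exp (l t) = f t := by
  obtain ⟨Γ, hΓ, hΓ0⟩ := Complex.isCoveringMap_exp.exists_path_lifts
    (⟨fun t => ⟨f t, h0 t⟩, by fun_prop⟩ : C(unitInterval, {z : ℂ // z ≠ 0})) 0
    (by simp [h1])
  exact ⟨Γ, Γ.continuous, hΓ0, fun t => congrArg Subtype.val (congrFun hΓ t)⟩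

end Logarithms

/-! ### Analytic continuation along paths -/

section Continuation

variable {m₀ : ℕ} {s : ℂ}

theorem differentiableOn_fullBorel (hm : 0 < m₀) (n₀ : ℕ) (n₀' : ℤ) (hs : s.re < 0) :
    DifferentiableOn ℂ (fullBorel m₀ n₀ n₀' s) (mainSheet (singularSet m₀ s)) := by
  intro ζ hζ
  obtain ⟨F, H, hF0, -, hH, he⟩ := exists_fullBorel_eq hm n₀ n₀' hs (‖ζ‖ + 1)
  have hζM : ζ ∈ ball (0 : ℂ) (‖ζ‖ + 1) := by simp
  have hnhds := isOpen_ball.mem_nhds hζM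
  refine DifferentiableWithinAt.congr_of_eventuallyEq ?_ (eventuallyEq_of_mem
    (inter_mem (mem_nhdsWithin_of_mem_nhds hnhds) self_mem_nhdsWithin) he) (he ζ ⟨hζM, hζ⟩)
  refine DifferentiableAt.differentiableWithinAt (DifferentiableAt.add
    (DifferentiableAt.fun_sum fun p hp => DifferentiableAt.const_mul ?_ _)
    (hH.differentiableAt hnhds))
  have hω := hζ _ ⟨p.1, p.2, hF0 p hp, rfl⟩
  have hne : ζ - xi m₀ s p.1 p.2 ≠ 0 := by
    rw [sub_ne_zero]; intro h; rw [← h] at hω; exact hω (right_mem_segment ℝ _ _)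
  refine DifferentiableAt.add ((differentiableAt_const _).div (by fun_prop) hne)
    (DifferentiableAt.mul ?_ ?_)
  · exact ((differentiable_LomegaHat _).comp (by fun_prop :
      Differentiable ℂ fun ζ => ζ - xi m₀ s p.1 p.2)).differentiableAt
  · exact DifferentiableAt.clog (by fun_prop) (one_sub_div_mem_slitPlane hω)

/-- Every singular point has imaginary part at least 2π(−Re s)/m₀ in modulus. -/
theorem mainSheet_singularSet_mem_nhds (hm : 0 < m₀) (hs : s.re < 0) :
    mainSheet (singularSet m₀ s) ∈ 𝓝 (0 : ℂ) := by
  have hm' : (0 : ℝ) < m₀ := by exact_mod_cast hm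
  refine mem_of_superset (ball_mem_nhds (0 : ℂ) (div_pos (neg_pos.2 hs) hm')) fun ξ hξ => ?_
  rintro ω ⟨a, b, ha, rfl⟩ hseg
  have hmem := (convex_ball (0 : ℂ) (-s.re / m₀)).segment_subset
    (mem_ball_self (div_pos (neg_pos.2 hs) hm')) hξ hseg
  rw [mem_ball_zero_iff] at hmem
  have h1 := (Complex.abs_im_le_norm _).trans_lt hmem
  have ha' : (1 : ℝ) ≤ |(a : ℝ)| := by exact_mod_cast Int.one_le_abs ha
  rw [xi_im, abs_mul, abs_of_pos (neg_pos.2 hs), abs_div, abs_mul, abs_of_pos (a := 2 * Real.pi)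
    (by positivity), abs_of_pos hm', div_mul_eq_mul_div, div_lt_div_iff_of_pos_right hm'] at h1
  have h2 : (1 : ℝ) ≤ 2 * Real.pi * |(a : ℝ)| := by nlinarith [Real.pi_gt_three]
  nlinarith [neg_pos.2 hs]

/-- In a disk containing the path, only finitely many logarithms log(1 − ζ/ω) are multivalued. Each
is continued by lifting 1 − γ/ω, which never vanishes, through exp. -/
theorem extendsToUniversalCover_fullBorel (hm : 0 < m₀) (n₀ : ℕ) (n₀' : ℤ) (hs : s.re < 0) :
    ExtendsToUniversalCover (fullBorel m₀ n₀ n₀' s) (singularSet m₀ s) := by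
  intro γ hγ hγ0 hγS
  obtain ⟨M, hM⟩ := (isCompact_range hγ).isBounded.subset_ball (0 : ℂ)
  have hγM : ∀ t, γ t ∈ ball (0 : ℂ) M := fun t => hM ⟨t, rfl⟩
  obtain ⟨F, H, hF0, -, hH, he⟩ := exists_fullBorel_eq hm n₀ n₀' hs M
  set ω : ℤ × ℤ → ℂ := fun p => xi m₀ s p.1 p.2 with hω
  have hω0 : ∀ p ∈ F, ω p ≠ 0 := fun p hp => xi_ne_zero hm hs (hF0 p hp) _
  have hγω : ∀ p ∈ F, ∀ t, γ t - ω p ≠ 0 := fun p hp t h =>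
    hγS t ⟨p.1, p.2, hF0 p hp, sub_eq_zero.1 h⟩
  have hγ1 : ∀ p ∈ F, ∀ t, 1 - γ t / ω p ≠ 0 := by
    intro p hp t h
    refine hγω p hp t ?_
    have := hω0 p hp
    field_simp at h
    linear_combination -h
  choose! l hlc hl0 hle using fun p (hp : p ∈ F) => exists_path_log
    (f := fun t => 1 - γ t / ω p) (by fun_prop) (hγ1 p hp) (by simp [hγ0])
  -- The local branch near γ t: the lifted value at γ t plus a principal logarithm of a ratio close
  -- to 1.
  set ℓ : ℤ × ℤ → unitInterval → ℂ → ℂ := fun p t ζ =>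
    l p t + Complex.log ((1 - ζ / ω p) / (1 - γ t / ω p)) with hℓ
  refine ⟨fun t ζ => ∑ p ∈ F, resonance m₀ n₀ * resCoeff m₀ n₀' p.1 p.2 *
    (Complex.exp (-ω p / 2) / (ζ - ω p) + LomegaHat (ω p) (ζ - ω p) * ℓ p t ζ) + H ζ, ?_, ?_, ?_⟩
  · intro t
    have hid : ∀ c : ℂ, AnalyticAt ℂ (fun ζ => ζ - c) (γ t) := fun c =>
      analyticAt_id.sub analyticAt_const
    refine AnalyticAt.add (Finset.analyticAt_fun_sum _ fun p hp => analyticAt_const.mul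
      ((analyticAt_const.div (hid _) (hγω p hp t)).add (AnalyticAt.mul ?_ ?_)))
      (hH.analyticAt (isOpen_ball.mem_nhds (hγM t)))
    · exact ((differentiable_LomegaHat (ω p)).comp (by fun_prop :
        Differentiable ℂ fun ζ => ζ - ω p)).analyticAt _
    · refine analyticAt_const.add (AnalyticAt.clog ((analyticAt_const.sub
        (analyticAt_id.div_const)).div_const) ?_)
      rw [div_self (hγ1 p hp t)]
      exact Complex.one_mem_slitPlane
  · rw [hγ0]
    filter_upwards [mainSheet_singularSet_mem_nhds hm hs,
      isOpen_ball.mem_nhds (hγ0 ▸ hγM 0)] with ζ hζ hζM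
    rw [he ζ ⟨hζM, hζ⟩]
    congr 1
    refine Finset.sum_congr rfl fun p hp => ?_
    simp only [hℓ, hl0 p hp, hγ0, zero_div, sub_zero, div_one, zero_add, hω]
  · intro t
    have key : ∀ p ∈ F, ∀ᶠ u in 𝓝 t, ∀ᶠ ζ in 𝓝 (γ u), ℓ p u ζ = ℓ p t ζ := by
      intro p hp
      have hc1 : ContinuousAt (fun u => (1 - γ u / ω p) / (1 - γ t / ω p)) t := by fun_prop
      have hslit : ∀ᶠ u in 𝓝 t, (1 - γ u / ω p) / (1 - γ t / ω p) ∈ Complex.slitPlane :=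
        hc1.eventually_mem (Complex.isOpen_slitPlane.mem_nhds (by
          rw [div_self (hγ1 p hp t)]; exact Complex.one_mem_slitPlane))
      have h1 : ∀ᶠ u in 𝓝 t,
          l p u - l p t - Complex.log ((1 - γ u / ω p) / (1 - γ t / ω p)) = 0 := by
        refine eventually_eq_zero_of_exp_eq_one ?_ ?_ ?_
        · refine ((hlc p hp).continuousAt.sub continuousAt_const).sub (hc1.clog ?_)
          rw [div_self (hγ1 p hp t)]; exact Complex.one_mem_slitPlane
        · rw [div_self (hγ1 p hp t), Complex.log_one]; ring
        · filter_upwards [hslit] with u hu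
          rw [Complex.exp_sub, Complex.exp_sub, Complex.exp_log (Complex.slitPlane_ne_zero hu),
            hle p hp, hle p hp, div_self (Complex.slitPlane_ne_zero hu)]
      filter_upwards [h1, hslit] with u hu hus
      -- The two branches have equal exponentials and agree at ζ = γ u by `hu`, so they agree near γ
      -- u.
      have h2 : ∀ᶠ ζ in 𝓝 (γ u), ℓ p u ζ - ℓ p t ζ = 0 := by
        have hcu : ContinuousAt (fun ζ => (1 - ζ / ω p) / (1 - γ u / ω p)) (γ u) := by fun_prop
        have hct : ContinuousAt (fun ζ => (1 - ζ / ω p) / (1 - γ t / ω p)) (γ u) := by fun_prop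
        have hu1 : (1 - γ u / ω p) / (1 - γ u / ω p) ∈ Complex.slitPlane := by
          rw [div_self (hγ1 p hp u)]; exact Complex.one_mem_slitPlane
        refine eventually_eq_zero_of_exp_eq_one ?_ ?_ ?_
        · exact (continuousAt_const.add (hcu.clog hu1)).sub (continuousAt_const.add (hct.clog hus))
        · simp only [hℓ]
          rw [div_self (hγ1 p hp u), Complex.log_one]
          linear_combination hu
        · filter_upwards [hcu.eventually_mem (Complex.isOpen_slitPlane.mem_nhds hu1),
            hct.eventually_mem (Complex.isOpen_slitPlane.mem_nhds hus)] with ζ hζu hζt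
          have h3 := Complex.slitPlane_ne_zero hζu
          have h4 := Complex.slitPlane_ne_zero hζt
          simp only [hℓ]
          rw [Complex.exp_sub, Complex.exp_add, Complex.exp_add, Complex.exp_log h3,
            Complex.exp_log h4, hle p hp, hle p hp, mul_div_cancel₀ _ (hγ1 p hp u),
            mul_div_cancel₀ _ (hγ1 p hp t), div_self]
          exact fun h => h3 (by rw [h, zero_div])
      exact h2.mono fun ζ h => sub_eq_zero.1 h
    filter_upwards [(eventually_all_finset F).2 key] with u hu
    filter_upwards [(eventually_all_finset F).2 hu] with ζ hζ
    congr 1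
    exact Finset.sum_congr rfl fun p hp => by rw [hζ p hp]

end Continuation

/-! ### Local form at the singular points -/

section Singularities

variable {m₀ : ℕ} {s : ℂ}

/-- Of the finitely many explicit terms only that of ω is singular at ω. On the connected piece V
each other logarithm differs by a constant from a branch holomorphic in the whole ball, and log(1 −
ξ/ω) differs by a constant from the given ℓ; these constants go into R. -/
theorem hasSimpleSingularity_fullBorel (hm : 0 < m₀) (n₀ : ℕ) (n₀' : ℤ) (hs : s.re < 0) {k : ℤ}
    (hk : k ≠ 0) (b : ℤ) :
    HasSimpleSingularity (singularSet m₀ s) (fullBorel m₀ n₀ n₀' s) (xi m₀ s k b)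
      (resonance m₀ n₀ * resCoeff m₀ n₀' k b) := by
  set ω := xi m₀ s k b with hωdef
  obtain ⟨F, H, hF0, hF, hH, he⟩ := exists_fullBorel_eq hm n₀ n₀' hs (‖ω‖ + 1)
  have hωF : (k, b) ∈ F := hF k b hk (by simp [hωdef])
  set F' := F.erase (k, b) with hF'
  have hF'ne : ∀ p ∈ F', xi m₀ s p.1 p.2 ≠ ω := by
    intro p hp h
    obtain ⟨h1, h2⟩ := xi_injective hm hs (hF0 p (Finset.mem_of_mem_erase hp)) h
    exact Finset.ne_of_mem_erase hp (Prod.ext h1 h2)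
  -- Near ω every point is closer to ω than each other singular point ω_p is, so |(ξ − ω)/(ω_p − ω)|
  -- < 1 and log(1 − (ξ − ω)/(ω_p − ω)) is holomorphic even across the cut hidden behind ω_p.
  have hnhds : {ξ | ξ ∈ ball (0 : ℂ) (‖ω‖ + 1) ∧
      ∀ p ∈ F', ‖ξ - ω‖ < ‖xi m₀ s p.1 p.2 - ω‖} ∈ 𝓝 ω := by
    refine inter_mem (isOpen_ball.mem_nhds (by simp)) ?_
    refine (eventually_all_finset F').2 fun p hp => ?_
    have hc : ContinuousAt (fun ξ : ℂ => ‖ξ - ω‖) ω := by fun_prop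
    refine hc.eventually_lt continuousAt_const ?_
    rw [sub_self, norm_zero, norm_pos_iff, sub_ne_zero]
    exact hF'ne p hp
  obtain ⟨ρ, hρ, hρs'⟩ := Metric.mem_nhds_iff.1 hnhds
  have hρs : ∀ {ξ}, ξ ∈ ball ω ρ → ξ ∈ ball (0 : ℂ) (‖ω‖ + 1) ∧
      ∀ p ∈ F', ‖ξ - ω‖ < ‖xi m₀ s p.1 p.2 - ω‖ := fun h => hρs' h
  have hω0 : ω ≠ 0 := xi_ne_zero hm hs hk b
  refine ⟨ρ, hρ, ?_, ?_⟩
  · rintro _ ⟨a, c, ha, rfl⟩ hmem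
    by_contra hne
    have h1 := hρs hmem
    have h2 : (a, c) ∈ F' := by
      refine Finset.mem_erase.2 ⟨fun h => hne ?_, hF a c ha h1.1⟩
      rw [Prod.mk.injEq] at h
      rw [h.1, h.2]
    have h3 := h1.2 (a, c) h2
    exact h3.ne rfl
  intro V hV hVc ℓ hℓ hℓe
  have hVseg : ∀ p ∈ F, ∀ ξ ∈ V, xi m₀ s p.1 p.2 ∉ segment ℝ (0 : ℂ) ξ := fun p hp ξ hξ =>
    (hV hξ).2 _ ⟨p.1, p.2, hF0 p hp, rfl⟩
  have hlogc : ∀ p ∈ F, ContinuousOn (fun ξ => Complex.log (1 - ξ / xi m₀ s p.1 p.2)) V :=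
    fun p hp => ContinuousOn.clog (by fun_prop) fun ξ hξ =>
      one_sub_div_mem_slitPlane (hVseg p hp ξ hξ)
  obtain ⟨c₀, hc₀⟩ := exists_eq_add_const_of_exp_eq hVc (κ := -1 / ω) (hlogc _ hωF) hℓ
    fun ξ hξ => by
      rw [hℓe ξ hξ, Complex.exp_log (Complex.slitPlane_ne_zero
        (one_sub_div_mem_slitPlane (hVseg _ hωF ξ hξ)))]
      change 1 - ξ / ω = _
      field_simp
      ring
  have hbr : ∀ p ∈ F', ∀ ξ ∈ ball ω ρ,
      1 - (ξ - ω) / (xi m₀ s p.1 p.2 - ω) ∈ Complex.slitPlane := by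
    intro p hp ξ hξ
    have h1 := (hρs hξ).2 p hp
    rw [sub_eq_add_neg]
    refine Complex.mem_slitPlane_of_norm_lt_one ?_
    rw [norm_neg, norm_div, div_lt_one ((norm_nonneg _).trans_lt h1)]
    exact h1
  have hcp : ∀ p ∈ F', ∃ c : ℂ, ∀ ξ ∈ V, Complex.log (1 - ξ / xi m₀ s p.1 p.2) =
      Complex.log (1 - (ξ - ω) / (xi m₀ s p.1 p.2 - ω)) + c := by
    intro p hp
    have hpF := Finset.mem_of_mem_erase hp
    have hp0 : xi m₀ s p.1 p.2 ≠ 0 := xi_ne_zero hm hs (hF0 p hpF) _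
    have hp1 := sub_ne_zero.2 (hF'ne p hp)
    refine exists_eq_add_const_of_exp_eq hVc (κ := (xi m₀ s p.1 p.2 - ω) / xi m₀ s p.1 p.2)
      (hlogc p hpF) (ContinuousOn.clog (by fun_prop) fun ξ hξ => hbr p hp ξ (hV hξ).1)
      fun ξ hξ => ?_
    rw [Complex.exp_log (Complex.slitPlane_ne_zero (one_sub_div_mem_slitPlane (hVseg p hpF ξ hξ))),
      Complex.exp_log (Complex.slitPlane_ne_zero (hbr p hp ξ (hV hξ).1))]
    field_simp
    ring
  choose! c hc using hcp
  have hLd : ∀ η : ℂ, Differentiable ℂ fun ξ => LomegaHat η (ξ - η) := fun η =>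
    (differentiable_LomegaHat η).comp (by fun_prop)
  refine ⟨fun ξ => resonance m₀ n₀ * resCoeff m₀ n₀' k b * (LomegaHat ω (ξ - ω) * c₀) +
    ∑ p ∈ F', resonance m₀ n₀ * resCoeff m₀ n₀' p.1 p.2 *
      (Complex.exp (-xi m₀ s p.1 p.2 / 2) / (ξ - xi m₀ s p.1 p.2) +
        LomegaHat (xi m₀ s p.1 p.2) (ξ - xi m₀ s p.1 p.2) *
          (Complex.log (1 - (ξ - ω) / (xi m₀ s p.1 p.2 - ω)) + c p)) + H ξ, ?_, ?_⟩
  · refine DifferentiableOn.add (DifferentiableOn.add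
      (((hLd ω).mul_const _).const_mul _).differentiableOn (DifferentiableOn.fun_sum fun p hp =>
        DifferentiableOn.const_mul (DifferentiableOn.add (DifferentiableOn.div
          (differentiableOn_const _) (by fun_prop) fun ξ hξ h => ?_)
          ((hLd _).differentiableOn.mul (DifferentiableOn.add_const _ (DifferentiableOn.clog
            (by fun_prop) (hbr p hp))))) _)) (hH.mono fun ξ hξ => (hρs hξ).1)
    have h1 := (hρs hξ).2 p hp
    rw [sub_eq_zero.1 h] at h1
    exact lt_irrefl _ h1
  · intro ξ hξ
    rw [he ξ ⟨(hρs (hV hξ).1).1, (hV hξ).2⟩, ← Finset.add_sum_erase F _ hωF]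
    have h1 := hc₀ ξ hξ
    beta_reduce at h1 ⊢
    rw [h1, Finset.sum_congr rfl fun p hp => by rw [hc p hp ξ hξ]]
    ring

end Singularities

/-! ### Exponential growth on lines -/

section Growth

theorem norm_geomExp_le {η : ℝ} (hη : 0 < η) {p : ℂ} (hp : η ≤ |p.re|) :
    ‖geomExp p‖ ≤ 1 / (1 - Real.exp (-η)) := by
  have hc : 0 < 1 - Real.exp (-η) := by
    have : Real.exp (-η) < 1 := Real.exp_lt_one_iff.2 (by linarith)
    linarith
  rcases le_abs'.1 hp with h | h
  · have h1 : ‖Complex.exp p‖ ≤ Real.exp (-η) := by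
      rw [Complex.norm_exp]; exact Real.exp_le_exp.2 h
    have h2 := norm_sub_norm_le 1 (Complex.exp p)
    rw [norm_one] at h2
    rw [geomExp, norm_div]
    exact div_le_div₀ zero_le_one (by linarith) hc (by linarith)
  · have h1 : Real.exp η ≤ ‖Complex.exp p‖ := by
      rw [Complex.norm_exp]; exact Real.exp_le_exp.2 h
    have h2 := norm_sub_norm_le (Complex.exp p) 1
    rw [norm_one, norm_sub_rev] at h2
    have h3 : 1 < Real.exp η := Real.one_lt_exp_iff.2 hη
    have h4 : Real.exp (-η) * ‖Complex.exp p‖ ≥ 1 := by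
      calc (1 : ℝ) = Real.exp (-η) * Real.exp η := by rw [← Real.exp_add]; simp
        _ ≤ _ := mul_le_mul_of_nonneg_left h1 (Real.exp_pos _).le
    rw [geomExp, norm_div, div_le_div_iff₀ (by linarith) hc]
    linarith

/-- If Re v = 0, the line stays at a fixed distance from the imaginary axis. Otherwise this holds
outside a compact interval, and on the interval the function is continuous. -/
theorem exists_norm_geomExp_line_le {σ v : ℂ} (hσ : σ.re < 0)
    (h : ∀ x : ℝ, Complex.exp (σ + x * v) ≠ 1) :
    ∃ B : ℝ, ∀ x : ℝ, ‖geomExp (σ + x * v)‖ ≤ B := by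
  have hη : 0 < -σ.re / 2 := by linarith
  have hre : ∀ x : ℝ, (σ + x * v).re = σ.re + x * v.re := fun x => by simp
  rcases eq_or_ne v.re 0 with hv | hv
  · refine ⟨_, fun x => norm_geomExp_le hη ?_⟩
    rw [hre, hv, mul_zero, add_zero, abs_of_neg hσ]
    linarith
  have hv' : 0 < |v.re| := abs_pos.2 hv
  have hcont : Continuous fun x : ℝ => geomExp (σ + x * v) := continuous_iff_continuousAt.2 fun x =>
    (differentiableAt_geomExp (h x)).continuousAt.comp (f := fun x : ℝ => σ + x * v) (by fun_prop)
  set r := 2 * -σ.re / |v.re| with hr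
  obtain ⟨B, hB⟩ := (isCompact_Icc (a := -r) (b := r)).exists_bound_of_continuousOn
    hcont.continuousOn
  refine ⟨max B (1 / (1 - Real.exp (-(-σ.re / 2)))), fun x => ?_⟩
  by_cases hx : |x| ≤ r
  · exact (hB x (abs_le.1 hx)).trans (le_max_left _ _)
  · refine (norm_geomExp_le hη ?_).trans (le_max_right _ _)
    rw [not_le, hr, div_lt_iff₀ hv', ← abs_mul] at hx
    rw [hre]
    have h1 := abs_sub_abs_le_abs_sub (x * v.re) (-σ.re)
    rw [sub_neg_eq_add, add_comm (x * v.re), abs_of_pos (by linarith : 0 < -σ.re)] at h1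
    linarith

/-- The Lipschitz bound serves for small x and the uniform bound for the others; the factor |x| is
what makes the sum over j converge. -/
theorem exists_norm_geomExp_line_sub_le {σ v : ℂ} (hσ : σ.re < 0)
    (h : ∀ x : ℝ, Complex.exp (σ + x * v) ≠ 1) :
    ∃ C : ℝ, ∀ x : ℝ, ‖geomExp (σ + x * v) - geomExp σ‖ ≤ C * |x| := by
  obtain ⟨B, hB⟩ := exists_norm_geomExp_line_le hσ h
  have hB0 : 0 ≤ B := (norm_nonneg _).trans (hB 0)
  have hy : 0 < -σ.re := by linarith
  set K := 1 / (1 - Real.exp (- -σ.re / 2)) ^ 2 with hK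
  have hK0 : 0 ≤ K := by positivity
  refine ⟨K * ‖v‖ + 4 * B * ‖v‖ / -σ.re, fun x => ?_⟩
  have hxv : ‖(x : ℂ) * v‖ = |x| * ‖v‖ := by rw [norm_mul, Complex.norm_real, Real.norm_eq_abs]
  rcases le_or_gt (|x| * ‖v‖) (-σ.re / 2) with hx | hx
  · have h1 := norm_geomExp_sub_geomExp_le hy (p := σ + x * v) (q := σ) (by simp)
      (by rw [add_sub_cancel_left, hxv]; exact hx)
    rw [add_sub_cancel_left, hxv] at h1
    refine h1.trans ?_
    have : 0 ≤ 4 * B * ‖v‖ / -σ.re * |x| := by positivity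
    linarith
  · have h1 := norm_sub_le (geomExp (σ + x * v)) (geomExp σ)
    have h2 := hB 0
    rw [Complex.ofReal_zero, zero_mul, add_zero] at h2
    have h3 : 2 * B ≤ 4 * B * ‖v‖ / -σ.re * |x| := by
      rw [div_mul_eq_mul_div, le_div_iff₀ hy]
      nlinarith
    have : 0 ≤ K * ‖v‖ * |x| := by positivity
    linarith [hB x]

variable {m₀ : ℕ} {s : ℂ}

theorem exp_shiftedLog_line_ne_one (hm : 0 < m₀) {u : ℂ}
    (hu : ∀ x : ℝ, (x : ℂ) * u ∉ singularSet m₀ s) (b : ℤ) (x : ℝ) :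
    Complex.exp (shiftedLog m₀ s b + x * (mu m₀ 1 * u)) ≠ 1 := by
  intro h
  obtain ⟨l, hl⟩ := Complex.exp_eq_one_iff.1 h
  have h1 := shiftedLog_add_mu_mul_sub (s := s) hm one_ne_zero b l (x * u)
  have h2 : shiftedLog m₀ s b + mu m₀ 1 * (x * u) - 2 * Real.pi * Complex.I * l = 0 := by
    linear_combination hl
  rw [h2, eq_comm, mul_eq_zero] at h1
  exact hu x ⟨1, _, one_ne_zero, sub_eq_zero.1 (h1.resolve_left (mu_ne_zero hm one_ne_zero))⟩

/-- Since μ_j = μ₁/j, the j-th term samples the line of j = 1 at x/j. One constant thus works for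
all j, and the j-th term is O(|x|/j²). -/
theorem exists_norm_logBorel_line_le (hm : 0 < m₀) (n₀ : ℕ) (n₀' : ℤ) (hs : s.re < 0) {u : ℂ}
    (hu : ∀ x : ℝ, (x : ℂ) * u ∉ singularSet m₀ s) :
    ∃ A : ℝ, 0 ≤ A ∧ ∀ x : ℝ, ‖logBorel m₀ n₀ n₀' s (x * u)‖ ≤ A * Real.exp |x| := by
  choose C hC using fun b : ℤ => exists_norm_geomExp_line_sub_le
    (σ := shiftedLog m₀ s b) (v := mu m₀ 1 * u) (by rw [shiftedLog_re]; exact hs)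
    (exp_shiftedLog_line_ne_one hm hu b)
  have hmu : ∀ j : ℤ, mu m₀ j = ((1 / (j : ℝ) : ℝ) : ℂ) * mu m₀ 1 := fun j => by
    rw [mu, mu]; push_cast; rw [mul_one, mul_comm _ (j : ℂ), div_mul_div_comm, one_mul]
  set D := ‖mu m₀ 1‖ * ∑ b ∈ Finset.range m₀, 1 / (m₀ : ℝ) * C b with hD
  have hb : ∀ (x : ℝ) (j : ℤ), ‖poleTerm m₀ n₀' s j (x * u)‖ ≤ |x| * D * (1 / (j : ℝ) ^ 2) := by
    intro x j
    have h1 : ∀ b ∈ Finset.range m₀, ‖resCoeff m₀ n₀' j b * (geomExp (shiftedLog m₀ s b +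
        mu m₀ j * (x * u)) - geomExp (shiftedLog m₀ s b))‖ ≤
        1 / m₀ * C b * (|1 / (j : ℝ)| * |x|) := by
      intro b _
      have h2 := hC b (1 / j * x)
      have h3 : ((1 / (j : ℝ) * x : ℝ) : ℂ) * (mu m₀ 1 * u) = mu m₀ j * (x * u) := by
        rw [hmu j]; push_cast; ring
      rw [h3, abs_mul] at h2
      rw [norm_mul, norm_resCoeff, mul_assoc]
      exact mul_le_mul_of_nonneg_left h2 (by positivity)
    have h4 := norm_sum_le_of_le _ h1
    rw [← Finset.sum_mul] at h4
    rw [poleTerm, norm_mul]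
    calc _ ≤ ‖mu m₀ j‖ * _ := mul_le_mul_of_nonneg_left h4 (norm_nonneg _)
      _ = _ := by
        rw [hmu j, norm_mul, Complex.norm_real, Real.norm_eq_abs, hD, ← one_div_pow,
          ← sq_abs (1 / (j : ℝ))]
        ring
  have hsum := ((Real.summable_one_div_int_pow (p := 2)).2 (by norm_num)).hasSum
  set T := ∑' j : ℤ, 1 / (j : ℝ) ^ 2 with hT
  refine ⟨‖constSum m₀ n₀ s‖ + |D * T|, by positivity, fun x => ?_⟩
  have h1 : ‖∑' j : ℤ, poleTerm m₀ n₀' s j (x * u)‖ ≤ |x| * D * T :=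
    tsum_of_norm_bounded (hsum.mul_left _) (hb x)
  have h2 : |x| * D * T ≤ |x| * |D * T| := by
    rw [mul_assoc]; exact mul_le_mul_of_nonneg_left (le_abs_self _) (abs_nonneg _)
  have h3 := norm_sub_le (constSum m₀ n₀ s) (∑' j : ℤ, poleTerm m₀ n₀' s j (x * u))
  have h4 := Real.add_one_le_exp |x|
  rw [logBorel]
  calc _ ≤ ‖constSum m₀ n₀ s‖ * 1 + |D * T| * |x| := by linarith
    _ ≤ ‖constSum m₀ n₀ s‖ * Real.exp |x| + |D * T| * Real.exp |x| := by
        gcongr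
        · exact Real.one_le_exp (abs_nonneg x)
        · linarith
    _ = _ := by ring

theorem exists_norm_fullBorel_line_le (hm : 0 < m₀) (n₀ : ℕ) (n₀' : ℤ) (hs : s.re < 0) {u : ℂ}
    (hu1 : ‖u‖ = 1) (hu : ∀ x : ℝ, (x : ℂ) * u ∉ singularSet m₀ s) :
    ∃ K δ : ℝ, ∀ x : ℝ, ‖fullBorel m₀ n₀ n₀' s (x * u)‖ ≤ K * Real.exp (δ * |x|) := by
  obtain ⟨A, hA0, hA⟩ := exists_norm_logBorel_line_le hm n₀ n₀' hs hu
  obtain ⟨C, hC0, hC⟩ := exists_norm_borelKernel_le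
  -- In the integral term the rate is 1 for the factor |x|, 1 for `logBorel` and 2C for the kernel
  -- with both arguments of modulus at most |x|; the other two terms grow more slowly.
  refine ⟨A + A * C + ‖poleConst m₀ s‖ * C, 2 + 2 * C, fun x => ?_⟩
  have hxn : ∀ y : ℝ, ‖(y : ℂ) * u‖ = |y| := fun y => by
    rw [norm_mul, hu1, mul_one, Complex.norm_real, Real.norm_eq_abs]
  have hx0 := abs_nonneg x
  have h1 : ‖Complex.exp (-(x * u) / 2) * logBorel m₀ n₀ n₀' s (x * u)‖ ≤
      A * Real.exp ((2 + 2 * C) * |x|) := by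
    rw [norm_mul, Complex.norm_exp]
    have h2 : (-(x * u) / 2 : ℂ).re ≤ |x| := by
      refine (Complex.re_le_norm _).trans ?_
      rw [norm_div, norm_neg, hxn]
      norm_num
    calc _ ≤ Real.exp |x| * (A * Real.exp |x|) :=
          mul_le_mul (Real.exp_le_exp.2 h2) (hA x) (norm_nonneg _) (Real.exp_pos _).le
      _ = A * Real.exp (2 * |x|) := by rw [mul_left_comm, ← Real.exp_add]; ring_nf
      _ ≤ _ := by
          refine mul_le_mul_of_nonneg_left (Real.exp_le_exp.2 ?_) hA0
          nlinarith
  have h3 : ‖∫ y in (0 : ℝ)..1, logBorel m₀ n₀ n₀' s (y * (x * u)) *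
      borelKernel (y * (x * u)) (x * u)‖ ≤
      A * Real.exp |x| * (C * Real.exp (C * (|x| + |x|))) := by
    have := intervalIntegral.norm_integral_le_of_norm_le_const (a := (0 : ℝ)) (b := 1)
      (f := fun y : ℝ => logBorel m₀ n₀ n₀' s (y * (x * u)) * borelKernel (y * (x * u)) (x * u))
      (C := A * Real.exp |x| * (C * Real.exp (C * (|x| + |x|)))) ?_
    · simpa using this
    · intro y hy
      rw [Set.uIoc_of_le zero_le_one] at hy
      have e : (y : ℂ) * (x * u) = ((y * x : ℝ) : ℂ) * u := by push_cast; ring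
      have hyx : |y * x| ≤ |x| := by
        rw [abs_mul, abs_of_pos hy.1]
        exact mul_le_of_le_one_left hx0 hy.2
      rw [norm_mul, e]
      refine mul_le_mul ((hA _).trans ?_) ((hC _ _).trans ?_) (norm_nonneg _) (by positivity)
      · gcongr
      · rw [hxn, hxn]
        gcongr
  have h4 : ‖(x : ℂ) * u * ∫ y in (0 : ℝ)..1, logBorel m₀ n₀ n₀' s (y * (x * u)) *
      borelKernel (y * (x * u)) (x * u)‖ ≤ A * C * Real.exp ((2 + 2 * C) * |x|) := by
    rw [norm_mul, hxn]
    calc _ ≤ Real.exp |x| * (A * Real.exp |x| * (C * Real.exp (C * (|x| + |x|)))) :=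
          mul_le_mul (by linarith [Real.add_one_le_exp |x|]) h3 (norm_nonneg _) (Real.exp_pos _).le
      _ = A * C * (Real.exp |x| * Real.exp |x| * Real.exp (C * (|x| + |x|))) := by ring
      _ = _ := by rw [← Real.exp_add, ← Real.exp_add]; ring_nf
  have h5 : ‖poleConst m₀ s * borelKernel 0 (x * u)‖ ≤
      ‖poleConst m₀ s‖ * C * Real.exp ((2 + 2 * C) * |x|) := by
    rw [norm_mul, mul_assoc]
    refine mul_le_mul_of_nonneg_left ((hC _ _).trans ?_) (norm_nonneg _)
    rw [norm_zero, zero_add, hxn]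
    gcongr
    linarith
  rw [fullBorel, kernelTransform, norm_mul, norm_resonance hm, one_mul]
  refine (norm_add_le _ _).trans ((add_le_add (norm_add_le _ _) le_rfl).trans ?_)
  linarith

end Growth

end QLog

/-! ### Conclusion -/

theorem theorem4p2 (m₀ n₀ : ℕ) (hn : n₀ < m₀) (hcop : Nat.Coprime n₀ m₀)
    (n₀' : ℤ) (hinv : (n₀ : ℤ) * n₀' ≡ 1 [ZMOD (m₀ : ℤ)]) :
    -- the asymptotic expansion of `(q - Λ₀) f_δ` at `Λ₀` exists
    (∃ a : ℕ → ℂ → ℂ, QLog.IsExpansionOfFDelta (QLog.resonance m₀ n₀) a) ∧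
    ∀ a : ℕ → ℂ → ℂ, QLog.IsExpansionOfFDelta (QLog.resonance m₀ n₀) a →
      ∀ z s : ℂ, z ≠ 0 → ‖z‖ < 1 → Complex.exp s = z →
        ∃ Φ : ℂ → ℂ,
          -- `Φ` is the Borel transform of the expansion near the origin
          (∃ ρ > (0 : ℝ), ∀ ξ ∈ Metric.ball (0 : ℂ) ρ,
            HasSum (QLog.borelTerm (fun n => QLog.resonance m₀ n₀ ^ n * a n z) ξ) (Φ ξ)) ∧
          -- `Φ` is holomorphic on the main sheet
          DifferentiableOn ℂ Φ (QLog.mainSheet (QLog.singularSet m₀ s)) ∧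
          QLog.ExtendsToUniversalCover Φ (QLog.singularSet m₀ s) ∧
          -- singularities
          (∀ k b : ℤ, k ≠ 0 →
            AnalyticAt ℂ (QLog.Lomega (QLog.xi m₀ s k b)) 0 ∧
            QLog.Lomega (QLog.xi m₀ s k b) 0 = 0 ∧
            (∀ ζ : ℂ, Summable (QLog.borelTerm
              (QLog.taylorCoeff (QLog.Lomega (QLog.xi m₀ s k b))) ζ)) ∧
            Differentiable ℂ (QLog.LomegaHat (QLog.xi m₀ s k b)) ∧
            QLog.HasSimpleSingularity (QLog.singularSet m₀ s) Φ (QLog.xi m₀ s k b)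
              (QLog.resonance m₀ n₀ * QLog.resCoeff m₀ n₀' k b)) ∧
          -- exponential growth on the lines through the origin which avoid the singular points
          (∀ u : ℂ, ‖u‖ = 1 → (∀ x : ℝ, (x : ℂ) * u ∉ QLog.singularSet m₀ s) →
            ∃ K δ : ℝ, ∀ x : ℝ, ‖Φ (x * u)‖ ≤ K * Real.exp (δ * |x|)) := by
  have hm : 0 < m₀ := Nat.zero_lt_of_lt hn
  have hΛ := QLog.resonance_pow_self hm n₀
  have hexp := QLog.isExpansionOfFDelta_expansionCoeff hm hΛ
  refine ⟨⟨_, hexp⟩, ?_⟩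
  rintro a ha z s - hz1 rfl
  have hs : s.re < 0 := by rwa [Complex.norm_exp, Real.exp_lt_one_iff] at hz1
  have hm' : (0 : ℝ) < m₀ := by exact_mod_cast hm
  refine ⟨QLog.fullBorel m₀ n₀ n₀' s, ⟨-s.re / 2 / m₀, by
      have : 0 < -s.re := by linarith
      positivity, fun ξ hξ => ?_⟩,
    QLog.differentiableOn_fullBorel hm n₀ n₀' hs,
    QLog.extendsToUniversalCover_fullBorel hm n₀ n₀' hs, fun k b hk =>
      ⟨QLog.analyticAt_Lomega _, QLog.Lomega_zero _, QLog.summable_borelTerm_Lomega _,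
        QLog.differentiable_LomegaHat _, QLog.hasSimpleSingularity_fullBorel hm n₀ n₀' hs hk b⟩,
    fun u hu1 hu => QLog.exists_norm_fullBorel_line_le hm n₀ n₀' hs hu1 hu⟩
  have hξ' : m₀ * ‖ξ‖ ≤ -s.re / 2 := by
    rw [mem_ball_zero_iff, lt_div_iff₀ hm'] at hξ
    linarith
  have h := QLog.hasSum_borelTerm_fullBorel hm hcop hinv hs hξ'
  have e : (fun k => QLog.resonance m₀ n₀ ^ k * a k (Complex.exp s)) = fun k =>
      QLog.resonance m₀ n₀ ^ k *
        QLog.expansionCoeff (QLog.resonance m₀ n₀) k (Complex.exp s) := by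
    funext k
    -- Uniqueness replaces the given coefficients by the explicit ones, for which the Borel
    -- transform was summed.
    rw [QLog.isExpansionOfFDelta_unique (QLog.norm_resonance hm n₀) ha hexp hz1 k]
  rw [e]
  exact h
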